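/- **Setting.** Let $\alpha\ge\beta>-\frac12$ and let $\gamma$ be the probability measure $d\gamma(x)=c_{\alpha,\beta}(1-x)^\alpha(1+x)^\beta dx$ on $[-1,1]$; $\|\cdot\|_p$ is the norm of $L_p(\gamma)$. Let $(e_i)_{i\ge0}$ be an orthonormal basis of the real space $L_2(\gamma)$ consisting of functions on $[-1,1]$, with $e_0$ constant and $e_ke_l\in\mathrm{span}(e_0,\dots,e_{k+l})$ for all $k,l$. Let $\varphi\in C^\infty(\mathbb R)$, $0\le\varphi\le1$, $\operatorname{supp}\varphi\subset[-1,1]$, $\varphi=1$ on $[-\frac12,\frac12]$, and $a(\xi)=\sqrt{\varphi(\xi/2)-\varphi(\xi)}$. For $j\ge0$ let $\mathbb Z_j\subset[-1,1]$ be finite and $\lambda_\eta=\lambda_{j,\eta}>0$ $(\eta\in\mathbb Z_j)$ with $\int f\,d\gamma=\sum_{\eta\in\mathbb Z_j}\lambda_\eta f(\eta)$ for $f\in\mathrm{span}(e_i: i\le2^{j+1}-2)$. The needlets are $$\psi_{j\eta}(x)=\sqrt{\lambda_\eta}\sum_k a(k/2^{j-1})e_k(x)e_k(\eta),\qquad \eta\in\mathbb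 Z_j,\ j\ge0,$$ together with the constant $\psi_{-1,\eta}=1$, where $\mathbb Z_{-1}$ is one point. Put $\psi^i_{j\eta}=\langle\psi_{j\eta},e_i\rangle$ and $\beta_{j\eta}=\langle f,\psi_{j\eta}\rangle$. Let $k(\eta)\in\{1,2,\dots\}$ be the position of $\eta$ in $\mathbb Z_j$ listed in decreasing order. Assume that for each $q\in[1,\infty)$ there are constants $c_q,C_q>0$ such that: * $\operatorname{Card}\mathbb Z_j\le2^j$ for $j\ge0$; * $\sum_{\eta\in\mathbb Z_j}\|\psi_{j\eta}\|_q^q\le C_q\,\bigl(2^{jq/2}\vee2^{j(q-2)(1+\alpha)}\bigr)$ for $j\ge0$, if $q\ne2+\frac1{\alpha+1/2}$; * $\bigl\|\sum_{\eta\in\mathbb Z_j}u_\eta\psi_{j\eta}\bigr\|_q\le C_q\bigl(\sum_{\eta\in\mathbb Z_j}|u_\eta|^q\|\psi_{j\eta}\|_q^q\bigr)^{1/q}$ for $j\ge0$ and all real $(u_\eta)$; * for $j\ge1$, $\eta\in\mathbb Z_j$ and $k=k(\eta)\le2^{j-1}$: $c_q\le\|\psi_{j\eta}\|_q^q\big/\bigl(2^{j(q-2)(\alpha+1)}k^{-(q-2)(\alpha+1/2)}\bigr)\le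 C_q$; * for $j\ge1$, $\eta\in\mathbb Z_j$, $k(\eta)>2^{j-1}$ and $k'=2^j-k(\eta)+1$: $c_q\le\|\psi_{j\eta}\|_q^q\big/\bigl(2^{j(q-2)(\beta+1)}k'^{-(q-2)(\beta+1/2)}\bigr)\le C_q$. **Observation.** Let $K$ be a bounded (for instance compact) linear operator from $L_2(\gamma)$ to a real Hilbert space $\mathbb K$ with singular value decomposition $Ke_i=b_ig_i$, $K^*g_i=b_ie_i$, $(g_i)$ orthonormal, in the regular case: $b_0\neq0$ and $c'i^{-\nu}\le b_i\le c\,i^{-\nu}$ for all $i\ge1$, with constants $c,c'>0$ and $\nu>-\frac12$. One observes $Y_i=\langle Kf,g_i\rangle+\varepsilon\,\xi(g_i)$, where $\xi$ is a white noise on $\mathbb K$ (a centred Gaussian process with covariance $\mathbb E\,\xi(g)\xi(h)=\langle g,h\rangle$). **Estimator.** Let $\sigma_j^2=\sup_{\eta\in\mathbb Z_j}\sum_i(\psi^i_{j\eta}/b_i)^2$, $\hat\beta_{j\eta}=\sum_i\frac{Y_i}{b_i}\psi^i_{j\eta}$, $t_\varepsilon=\varepsilon\sqrt{\log(1/\varepsilon)}$,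 let $J$ be the largest integer with $2^J\le t_\varepsilon^{-2/(1+2\nu)}$, and $$\hat f=\sum_{j=-1}^J\sum_{\eta\in\mathbb Z_j}\hat\beta_{j\eta}\,I\{|\hat\beta_{j\eta}|\ge\kappa t_\varepsilon\sigma_j\}\,\psi_{j\eta}.$$ **Besov ball.** For $s>0$, $1\le\pi<\infty$, $0<r\le\infty$, $f\in L_2(\gamma)$ belongs to $\tilde B^s_{\pi,r}(M)$ if the $\ell_r$-norm of $\bigl(2^{js}(\sum_{\eta\in\mathbb Z_j}|\beta_{j\eta}|^\pi\|\psi_{j\eta}\|_\pi^\pi)^{1/\pi}\bigr)_{j\ge-1}$ is at most $M$. **Theorem.** Let $1<p<\infty$, $1\le\pi<\infty$, $0<r\le\infty$, $M>0$, let $\kappa>0$ satisfy $$\kappa^2\ge16p\Bigl[1+4\Bigl\{\bigl(\tfrac\alpha2-\tfrac{\alpha+1}p\bigr)_+\vee\bigl(\tfrac\beta2-\tfrac{\beta+1}p\bigr)_+\Bigr\}\Bigr],$$ and let $$s>\max_{\tau\in\{\alpha,\beta\}}\Bigl\{\tfrac12-2(\tau+1)\bigl(\tfrac12-\tfrac1\pi\bigr)\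 \vee\ 2(\tau+1)\bigl(\tfrac1\pi-\tfrac1p\bigr)\ \vee\ 0\Bigr\}.$$ Put $\mu=\min\{\mu(s),\mu(s,\alpha),\mu(s,\beta)\}$ with $$\mu(s)=\frac s{s+\nu+\frac12},\qquad \mu(s,\tau)=\frac{s-2(1+\tau)(\frac1\pi-\frac1p)}{s+\nu+2(1+\tau)(\frac12-\frac1\pi)},$$ and $a=\max\{a(\alpha),a(\beta)\}$ with $$a(\tau)=\begin{cases}I\{\delta_p=0\}&\text{if }(p-\pi)\,\delta_p\le0,\\[2pt] \dfrac{(\tau+\frac12)(\pi-p)}{(\pi-2)(\tau+\frac12)-1}+I\{\delta_s=0\}&\text{if }(p-\pi)\,\delta_p>0,\end{cases}$$ where $\delta_p=1-(p-2)(\tau+\frac12)$ and $\delta_s=s\,\delta_p-p(2\nu+1)(\tau+1)(\frac1\pi-\frac1p)$. Then $a\le2$, and there is a constant $C>0$, independent of $f$ and $\varepsilon$, such that for all $0<\varepsilon\le\frac12$ and all $f\in\tilde B^s_{\pi,r}(M)$ $$\mathbb E\|\hat f-f\|_p^p\le C\,[\log(1/\varepsilon)]^{p-1+a}\,\bigl[\varepsilon\sqrt{\log(1/\varepsilon)}\bigr]^{p\mu}.$$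 -/

import Mathlib

open MeasureTheory ProbabilityTheory
open scoped ENNReal

noncomputable section

namespace Needlet

/-! ### The Jacobi space -/

/-- The unnormalised Jacobi weight `(1 - x)^α (1 + x)^β`. -/
def jacobiWeight (α β x : ℝ) : ℝ := (1 - x) ^ α * (1 + x) ^ β

/-- The probability measure `dγ(x) = c (1 - x)^α (1 + x)^β dx` on `[-1, 1]`
(seen as a measure on `ℝ`). -/
def jacobiMeasure (α β : ℝ) : Measure ℝ :=
  (volume.restrict (Set.Icc (-1 : ℝ) 1)).withDensity fun x =>
    ENNReal.ofReal
      ((∫ y in Set.Icc (-1 : ℝ) 1, jacobiWeight α β y)⁻¹ * jacobiWeight α β x)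

/-! ### Needlet systems -/

/-- The data from which needlets are built on `L²(γ)`, `γ` being carried by `[-1, 1]`:
* an orthonormal basis `(e_k)_{k ≥ 0}` of `L²(γ)` with pointwise defined representatives, `e_0`
  being constant and products of an element of `span(e_0, …, e_k)` and an element of
  `span(e_0, …, e_l)` lying in `span(e_0, …, e_{k+l})`;
* a Littlewood-Paley function `φ`;
* quadrature nodes `Z_j ⊆ [-1, 1]` with positive weights, `j ≥ -1`. The quadrature at level `j ≥ 0`
  is exact on `span(e_i : i ≤ 2^{j+1} - 2)`, and `Z_{-1}` is one point. -/
structure NeedletSystem (γ : Measure ℝ) where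
  /-- the orthonormal basis, as elements of `L²(γ)` -/
  basis : HilbertBasis ℕ ℝ (Lp ℝ 2 γ)
  /-- the basis functions, as genuine functions -/
  e : ℕ → ℝ → ℝ
  basis_ae : ∀ k, ⇑(basis k) =ᵐ[γ] e k
  e_zero : ∃ c : ℝ, ∀ x ∈ Set.Icc (-1 : ℝ) 1, e 0 x = c
  e_mul : ∀ k l : ℕ, ∃ c : ℕ → ℝ, ∀ x ∈ Set.Icc (-1 : ℝ) 1,
    e k x * e l x = ∑ i ∈ Finset.range (k + l + 1), c i * e i x
  /-- the Littlewood-Paley function -/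
  φ : ℝ → ℝ
  φ_smooth : ContDiff ℝ (⊤ : ℕ∞) φ
  φ_mem : ∀ ξ, φ ξ ∈ Set.Icc (0 : ℝ) 1
  φ_supp : ∀ ξ, 1 < |ξ| → φ ξ = 0
  φ_one : ∀ ξ, |ξ| ≤ 1 / 2 → φ ξ = 1
  /-- the nodes `Z_j` -/
  Z : ℤ → Finset ℝ
  Z_subset : ∀ j : ℤ, -1 ≤ j → ∀ η ∈ Z j, η ∈ Set.Icc (-1 : ℝ) 1
  card_Z_neg_one : (Z (-1)).card = 1
  /-- the quadrature weights -/
  weight : ℤ → ℝ → ℝ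
  weight_pos : ∀ j : ℤ, 0 ≤ j → ∀ η ∈ Z j, 0 < weight j η
  quadrature : ∀ j : ℤ, 0 ≤ j → ∀ i : ℕ, (i : ℝ) ≤ (2 : ℝ) ^ (j + 1) - 2 →
    ∫ x, e i x ∂γ = ∑ η ∈ Z j, weight j η * e i η

namespace NeedletSystem

variable {γ : Measure ℝ} (N : NeedletSystem γ)

/-- The filter `a`, defined by `a(ξ)² = φ(ξ/2) - φ(ξ)`, `a ≥ 0`. -/
def a (ξ : ℝ) : ℝ := Real.sqrt (N.φ (ξ / 2) - N.φ ξ)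

/-- The needlets: `ψ_{-1,η}` is the constant `1`, and for `j ≥ 0`
`ψ_{j,η}(x) = √λ_η ∑_k a(k / 2^{j-1}) e_k(x) e_k(η)` (a finite sum, over `2^{j-2} < k < 2^j`). -/
def ψ (j : ℤ) (η x : ℝ) : ℝ :=
  if j = -1 then 1
  else Real.sqrt (N.weight j η) * ∑' k : ℕ, N.a (k / (2 : ℝ) ^ (j - 1)) * N.e k x * N.e k η

/-- `‖ψ_{j,η}‖_q^q`, as an extended nonnegative real number. -/
def ψNormPow (q : ℝ) (j : ℤ) (η : ℝ) : ℝ≥0∞ :=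
  eLpNorm (N.ψ j η) (ENNReal.ofReal q) γ ^ q

/-- The coefficients `ψ_{j,η}^i = (ψ_{j,η}, e_i)` of a needlet in the basis. -/
def ψCoeff (j : ℤ) (η : ℝ) (i : ℕ) : ℝ := ∫ x, N.ψ j η x * N.e i x ∂γ

/-- The needlet coefficients `β_{j,η} = (f, ψ_{j,η})` of `f ∈ L²(γ)`. -/
def coeff (f : Lp ℝ 2 γ) (j : ℤ) (η : ℝ) : ℝ := ∫ x, f x * N.ψ j η x ∂γ

/-- The position `k(η) ∈ {1, 2, …}` of `η ∈ Z_j`, the nodes being listed in decreasing order. -/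
def position (j : ℤ) (η : ℝ) : ℕ := ((N.Z j).filter fun η' => η ≤ η').card

/-! ### The assumptions on the needlets -/

/-- `Card Z_j ≤ 2^j`. -/
def CardBound : Prop := ∀ j : ℤ, 0 ≤ j → ((N.Z j).card : ℝ) ≤ (2 : ℝ) ^ j

/-- `∑_η ‖ψ_{j,η}‖_q^q ≤ C_q (2^{jq/2} ∨ 2^{j(q-2)(1+α)})` for `q ≠ 2 + 1/(α + 1/2)`. -/
def SumNormBound (α : ℝ) : Prop :=
  ∀ q : ℝ, 1 ≤ q → q ≠ 2 + 1 / (α + 1 / 2) → ∃ C : ℝ, 0 < C ∧ ∀ j : ℤ, 0 ≤ j →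
    ∑ η ∈ N.Z j, N.ψNormPow q j η ≤
      ENNReal.ofReal (C * max ((2 : ℝ) ^ (j * q / 2)) ((2 : ℝ) ^ (j * (q - 2) * (1 + α))))

/-- `‖∑_η u_η ψ_{j,η}‖_q ≤ C_q (∑_η |u_η|^q ‖ψ_{j,η}‖_q^q)^{1/q}`. -/
def SynthesisBound : Prop :=
  ∀ q : ℝ, 1 ≤ q → ∃ C : ℝ, 0 < C ∧ ∀ j : ℤ, 0 ≤ j → ∀ u : ℝ → ℝ,
    eLpNorm (fun x => ∑ η ∈ N.Z j, u η * N.ψ j η x) (ENNReal.ofReal q) γ ≤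
      ENNReal.ofReal C * (∑ η ∈ N.Z j, ‖u η‖ₑ ^ q * N.ψNormPow q j η) ^ (1 / q)

/-- Two-sided bounds for the nodes of the right half, `k = k(η) ≤ 2^{j-1}`:
`‖ψ_{j,η}‖_q^q` is comparable to `2^{j(q-2)(α+1)} k^{-(q-2)(α+1/2)}`. -/
def RightNormBounds (α : ℝ) : Prop :=
  ∀ q : ℝ, 1 ≤ q → ∃ c C : ℝ, 0 < c ∧ 0 < C ∧ ∀ j : ℤ, 1 ≤ j → ∀ η ∈ N.Z j,
    (N.position j η : ℝ) ≤ (2 : ℝ) ^ (j - 1) →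
    ENNReal.ofReal (c * (2 : ℝ) ^ (j * (q - 2) * (α + 1)) *
        (N.position j η : ℝ) ^ (-(q - 2) * (α + 1 / 2))) ≤ N.ψNormPow q j η ∧
    N.ψNormPow q j η ≤ ENNReal.ofReal (C * (2 : ℝ) ^ (j * (q - 2) * (α + 1)) *
        (N.position j η : ℝ) ^ (-(q - 2) * (α + 1 / 2)))

/-- Two-sided bounds for the nodes of the left half, `k(η) > 2^{j-1}`: with
`k' = 2^j - k(η) + 1`, the position counted from the left end,
`‖ψ_{j,η}‖_q^q` is comparable to `2^{j(q-2)(β+1)} k'^{-(q-2)(β+1/2)}`. -/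
def LeftNormBounds (β : ℝ) : Prop :=
  ∀ q : ℝ, 1 ≤ q → ∃ c C : ℝ, 0 < c ∧ 0 < C ∧ ∀ j : ℤ, 1 ≤ j → ∀ η ∈ N.Z j,
    (2 : ℝ) ^ (j - 1) < (N.position j η : ℝ) →
    ENNReal.ofReal (c * (2 : ℝ) ^ (j * (q - 2) * (β + 1)) *
        ((2 : ℝ) ^ j - N.position j η + 1) ^ (-(q - 2) * (β + 1 / 2))) ≤ N.ψNormPow q j η ∧
    N.ψNormPow q j η ≤ ENNReal.ofReal (C * (2 : ℝ) ^ (j * (q - 2) * (β + 1)) *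
        ((2 : ℝ) ^ j - N.position j η + 1) ^ (-(q - 2) * (β + 1 / 2)))

/-! ### Besov spaces -/

/-- `2^{js} (∑_η |β_{j,η}|^π ‖ψ_{j,η}‖_π^π)^{1/π}`. -/
def besovLevel (s π : ℝ) (f : Lp ℝ 2 γ) (j : ℤ) : ℝ≥0∞ :=
  ENNReal.ofReal ((2 : ℝ) ^ (j * s)) *
    (∑ η ∈ N.Z j, ‖N.coeff f j η‖ₑ ^ π * N.ψNormPow π j η) ^ (1 / π)

/-- The Besov norm: the `ℓ_r` norm (`0 < r ≤ ∞`) of `(besovLevel j)_{j ≥ -1}`. -/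
def besovNorm (s π : ℝ) (r : ℝ≥0∞) (f : Lp ℝ 2 γ) : ℝ≥0∞ :=
  eLpNorm (fun n : ℕ => N.besovLevel s π f ((n : ℤ) - 1)) r Measure.count

/-- The Besov ball of radius `M`. -/
def besovBall (s π : ℝ) (r : ℝ≥0∞) (M : ℝ) : Set (Lp ℝ 2 γ) :=
  {f | N.besovNorm s π r f ≤ ENNReal.ofReal M}

/-! ### The thresholding estimator -/

/-- `σ_j = (sup_η ∑_i (ψ_{j,η}^i / b_i)²)^{1/2}`. -/
def σ (b : ℕ → ℝ) (j : ℤ) : ℝ :=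
  Real.sqrt (⨆ η : {η // η ∈ N.Z j}, ∑' i : ℕ, (N.ψCoeff j η i / b i) ^ 2)

/-- The empirical coefficient `∑_i (Y_i / b_i) ψ_{j,η}^i` (a finite sum). -/
def empCoeff (b Y : ℕ → ℝ) (j : ℤ) (η : ℝ) : ℝ := ∑' i : ℕ, Y i / b i * N.ψCoeff j η i

end NeedletSystem

/-- `t_ε = ε (log (1/ε))^{1/2}`. -/
def tEps (ε : ℝ) : ℝ := ε * Real.sqrt (Real.log (1 / ε))

/-- The finest level: the largest integer `J` with `2^J ≤ t_ε^{-2/(1+2ν)}`. -/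
def maxLevel (ν ε : ℝ) : ℤ := ⌊Real.logb 2 (tEps ε ^ (-2 / (1 + 2 * ν)))⌋

/-- Hard thresholding at level `τ`. -/
def hardThreshold (τ x : ℝ) : ℝ := if τ ≤ |x| then x else 0

/-- The estimator `∑_{j=-1}^J ∑_{η ∈ Z_j} t(β̂_{j,η}) ψ_{j,η}`, with hard thresholding of `β̂_{j,η}` at
`κ t_ε σ_j`, computed from the data `Y = (Y_i)`. -/
def NeedletSystem.estimator {γ : Measure ℝ} (N : NeedletSystem γ) (b : ℕ → ℝ) (κ ν ε : ℝ)
    (Y : ℕ → ℝ) (x : ℝ) : ℝ :=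
  ∑ j ∈ Finset.Icc (-1 : ℤ) (maxLevel ν ε), ∑ η ∈ N.Z j,
    hardThreshold (κ * tEps ε * N.σ b j) (N.empCoeff b Y j η) * N.ψ j η x

/-! ### The observation model -/

/-- `(e_i)`, `(g_i)`, `(b_i)` is a singular value decomposition of `K`. -/
structure IsSVD {H G : Type*} [NormedAddCommGroup H] [InnerProductSpace ℝ H] [CompleteSpace H]
    [NormedAddCommGroup G] [InnerProductSpace ℝ G] [CompleteSpace G]
    (K : H →L[ℝ] G) (e : HilbertBasis ℕ ℝ H) (g : ℕ → G) (b : ℕ → ℝ) : Prop where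
  orthonormal : Orthonormal ℝ g
  map_e : ∀ i, K (e i) = b i • g i
  adjoint_g : ∀ i, ContinuousLinearMap.adjoint K (g i) = b i • e i

/-- The regular case `b_i ∼ i^{-ν}` (two-sided bounds for `i ≥ 1`; `b_0` is only nonzero). -/
def IsRegular (b : ℕ → ℝ) (ν : ℝ) : Prop :=
  b 0 ≠ 0 ∧ ∃ c' c : ℝ, 0 < c' ∧ 0 < c ∧
    ∀ i : ℕ, 1 ≤ i → c' * (i : ℝ) ^ (-ν) ≤ b i ∧ b i ≤ c * (i : ℝ) ^ (-ν)

/-- `W` is a white noise on the Hilbert space `G`: a centred Gaussian process indexed by `G` whose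
covariance is the inner product. -/
structure IsWhiteNoise {G Ω : Type*} [NormedAddCommGroup G] [InnerProductSpace ℝ G]
    [MeasurableSpace Ω] (W : G → Ω → ℝ) (P : Measure Ω) : Prop where
  gaussian : IsGaussianProcess W P
  centered : ∀ g, ∫ ω, W g ω ∂P = 0
  covariance_eq : ∀ g h, covariance (W g) (W h) P = inner ℝ g h

/-- The observed coefficients `Y_i = (K f, g_i) + ε W(g_i)`. -/
def observation {H G Ω : Type*} [NormedAddCommGroup H] [InnerProductSpace ℝ H]
    [NormedAddCommGroup G] [InnerProductSpace ℝ G]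
    (K : H →L[ℝ] G) (g : ℕ → G) (W : G → Ω → ℝ) (ε : ℝ) (f : H) (ω : Ω) (i : ℕ) : ℝ :=
  inner ℝ (K f) (g i) + ε * W (g i) ω

/-! ### The exponents -/

/-- `γ/2 - (γ+1)/p`, truncated at `0`. -/
def excess (p γ : ℝ) : ℝ := max (γ / 2 - (γ + 1) / p) 0

/-- The smoothness threshold attached to `γ ∈ {α, β}`. -/
def smoothnessThreshold (p π γ : ℝ) : ℝ :=
  max (max (1 / 2 - 2 * (γ + 1) * (1 / 2 - 1 / π)) (2 * (γ + 1) * (1 / π - 1 / p))) 0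

/-- `μ(s) = s / (s + ν + 1/2)`. -/
def rate₀ (ν s : ℝ) : ℝ := s / (s + ν + 1 / 2)

/-- `μ(s, γ)`. -/
def rate₁ (p π ν s γ : ℝ) : ℝ :=
  (s - 2 * (1 + γ) * (1 / π - 1 / p)) / (s + ν + 2 * (1 + γ) * (1 / 2 - 1 / π))

/-- `μ = min {μ(s), μ(s, α), μ(s, β)}`. -/
def rate (p π ν s α β : ℝ) : ℝ :=
  min (rate₀ ν s) (min (rate₁ p π ν s α) (rate₁ p π ν s β))

/-- `δ_p = 1 - (p - 2)(γ + 1/2)`. -/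
def deltaP (p γ : ℝ) : ℝ := 1 - (p - 2) * (γ + 1 / 2)

/-- `δ_s = s δ_p - p (2ν + 1)(γ + 1)(1/π - 1/p)`. -/
def deltaS (p π ν s γ : ℝ) : ℝ :=
  s * (1 - (p - 2) * (γ + 1 / 2)) - p * (2 * ν + 1) * (γ + 1) * (1 / π - 1 / p)

open Classical in
/-- The power `a(γ)` of the logarithm attached to `γ ∈ {α, β}`. -/
def logPower₁ (p π ν s γ : ℝ) : ℝ :=
  if (p - π) * (1 - (p - 2) * (γ + 1 / 2)) ≤ 0 then
    if deltaP p γ = 0 then 1 else 0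
  else
    (γ + 1 / 2) * (π - p) / ((π - 2) * (γ + 1 / 2) - 1) + if deltaS p π ν s γ = 0 then 1 else 0

/-- `a = max {a(α), a(β)}`. -/
def logPower (p π ν s α β : ℝ) : ℝ := max (logPower₁ p π ν s α) (logPower₁ p π ν s β)

end Needlet

end

noncomputable section

namespace Needlet

/-! ### Sums of powers -/

/-! The loss splits into the errors of the levels `-1 ≤ j ≤ J` and the bias `partialSum f J - f`.

Bias. Exact quadrature makes the levels telescope: those up to `J` add up to the smoothed partial
sum with multipliers `φ(k/2^J)` (`partialSum_natCast`), which tends to `f` in `L²`. By the synthesis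
inequality and the comparison of weighted `ℓ_π` with weighted `ℓ_p`, level `n` of `f` has `L_p` norm
`O(2^{-nx})`, with `x` the smaller of the two values of `biasExponent`. The choice of `J` makes the
tail `O(t_ε^μ)` (`rate_bounds`).

Levels. The errors of the coefficients are centred Gaussian with standard deviation at most `ε σ_j`,
where `σ_j = O(2^{jν})`. Hard thresholding at `T` costs at most a constant times `min(|β|, T)`, plus
the noise when it exceeds `T/2` (`abs_hardThreshold_sub_le`). The lower bound on `κ` makes the
second part negligible (`large_error_level_le`). There remains the deterministic sum of `min(|β|,
T)^p ‖ψ‖_p^p`. It is treated separately on the two halves of the interval, where `‖ψ‖_q^q` is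
comparable to `X^{q-2}` with one scale `X` for all `q`.

At level `N = 2^n` this sum has bounds of the form `t^A N^θ`: a noise bound (replace the minimum by
`T`), a bias bound (replace it by `|β|`) and, if `(p - π) δ_p > 0`, a middle bound obtained by
cutting at a critical node. In the logarithmic scale these are lines in `n`. A rising and a falling
line together bound the sum over `n` by a multiple of the height of their crossing
(`sum_le_of_two_lines`), and this height is `t^{p μ(s)}` or `t^{p μ(s,τ)}` (`sum_truncSum_le`). A
flat middle line (`δ_s = 0`) or a harmonic sum (`δ_p = 0`) costs one logarithm, recorded in
`levelPower`, which is at most the power `a` of the theorem. The factor `log^{p-1}` is the convexity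
inequality over `J + 2 = O(log(1/ε))` levels. -/

theorem rpow_sub_one_le_mul_sub {d : ℝ} (hd : 0 < d) {x : ℝ} (hx : 1 ≤ x) :
    x ^ (d - 1) ≤ max 1 d⁻¹ * (x ^ d - (x - 1) ^ d) := by
  have hx0 : 0 < x := by linarith
  have h1 : x - 1 = x * (1 + -(1 / x)) := by field_simp; ring
  have h3 : 1 / x ≤ 1 := by rw [div_le_one hx0]; exact hx
  have hxi : 0 < 1 / x := by positivity
  have h2 : (x - 1) ^ d = x ^ d * (1 + -(1 / x)) ^ d := by
    rw [h1, Real.mul_rpow hx0.le (by linarith)]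
  have h4 : x ^ (d - 1) = x ^ d * (1 / x) := by
    rw [Real.rpow_sub hx0, Real.rpow_one]; ring
  have h5 : (1 / x) ≤ max 1 d⁻¹ * (1 - (1 + -(1 / x)) ^ d) := by
    -- With `y = 1 - 1/x` in `[0, 1)`: Bernoulli's inequality bounds `y ^ d` if `d ≤ 1`, and `y ^ d
    -- ≤ y` if `d ≥ 1`. Only the first case needs the factor `d⁻¹`.
    rcases le_total d 1 with h | h
    · have := rpow_one_add_le_one_add_mul_self (s := -(1 / x)) (by linarith) hd.le h
      calc 1 / x = d⁻¹ * (d * (1 / x)) := by field_simp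
        _ ≤ d⁻¹ * (1 - (1 + -(1 / x)) ^ d) := by
          apply mul_le_mul_of_nonneg_left _ (by positivity); linarith
        _ ≤ _ := by
          apply mul_le_mul_of_nonneg_right (le_max_right _ _)
          have : 0 < d * (1 / x) := by positivity
          linarith
    · have : (1 + -(1 / x)) ^ d ≤ (1 + -(1 / x)) ^ (1 : ℝ) :=
        Real.rpow_le_rpow_of_exponent_ge' (by linarith) (by linarith) (by norm_num) h
      rw [Real.rpow_one] at this
      calc 1 / x ≤ 1 * (1 - (1 + -(1 / x)) ^ d) := by linarith
        _ ≤ _ := mul_le_mul_of_nonneg_right (le_max_left _ _) (by linarith)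
  rw [h4, h2]
  calc x ^ d * (1 / x) ≤ x ^ d * (max 1 d⁻¹ * (1 - (1 + -(1 / x)) ^ d)) := by gcongr
    _ = _ := by ring

/-- A discrete integral comparison: each term is at most an increment of `max 1 d⁻¹ * x ^ d`, and
the increments telescope. `S` is arbitrary because the nodes need not occupy every position. -/
theorem sum_rpow_le_rpow {d : ℝ} (hd : 0 < d) {K : ℝ} (hK : 0 < K) (S : Finset ℕ)
    (hS : ∀ k ∈ S, 1 ≤ k ∧ (k : ℝ) ≤ K) :
    ∑ k ∈ S, (k : ℝ) ^ (d - 1) ≤ max 1 d⁻¹ * K ^ d := by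
  have key : ∀ m : ℕ, ∑ k ∈ Finset.Icc 1 m, (k : ℝ) ^ (d - 1) ≤ max 1 d⁻¹ * (m : ℝ) ^ d := by
    intro m
    induction m with
    | zero => simp [Real.zero_rpow hd.ne']
    | succ m ih =>
      rw [Finset.sum_Icc_succ_top (by omega)]
      have := rpow_sub_one_le_mul_sub hd (x := ((m + 1 : ℕ) : ℝ)) (by push_cast; linarith [m.cast_nonneg (α := ℝ)])
      push_cast at this ⊢
      rw [add_sub_cancel_right] at this
      linarith
  calc ∑ k ∈ S, (k : ℝ) ^ (d - 1) ≤ ∑ k ∈ Finset.Icc 1 ⌊K⌋₊, (k : ℝ) ^ (d - 1) := by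
        apply Finset.sum_le_sum_of_subset_of_nonneg
        · intro k hk
          exact Finset.mem_Icc.2 ⟨(hS k hk).1, Nat.le_floor (hS k hk).2⟩
        · intros; positivity
    _ ≤ _ := key _
    _ ≤ _ := by
      gcongr
      exact Nat.floor_le hK.le

theorem rpow_neg_sub_one_le_mul_sub {d : ℝ} (hd : 0 < d) {x : ℝ} (hx : 1 ≤ x) :
    (x + 1) ^ (-d - 1) ≤ d⁻¹ * (x ^ (-d) - (x + 1) ^ (-d)) := by
  have hx0 : 0 < x := by linarith
  have hy : 0 < x + 1 := by linarith
  have h1 : 1 + d / (x + 1) ≤ (x / (x + 1)) ^ (-d) := by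
    have hq : 0 < x / (x + 1) := by positivity
    have hl : Real.log (x / (x + 1)) ≤ -(1 / (x + 1)) := by
      have := Real.log_le_sub_one_of_pos hq
      have h : x / (x + 1) - 1 = -(1 / (x + 1)) := by field_simp; ring
      linarith
    rw [Real.rpow_def_of_pos hq]
    have h2 : d / (x + 1) ≤ Real.log (x / (x + 1)) * -d := by
      have : d * (1 / (x + 1)) ≤ d * (-Real.log (x / (x + 1))) := by
        apply mul_le_mul_of_nonneg_left _ hd.le; linarith
      calc d / (x + 1) = d * (1 / (x + 1)) := by ring
        _ ≤ _ := this
        _ = _ := by ring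
    have := Real.add_one_le_exp (Real.log (x / (x + 1)) * -d)
    linarith
  have h3 : x ^ (-d) = (x / (x + 1)) ^ (-d) * (x + 1) ^ (-d) := by
    rw [← Real.mul_rpow (by positivity) hy.le]; congr 1; field_simp
  have h4 : (x + 1) ^ (-d - 1) = (x + 1) ^ (-d) * (1 / (x + 1)) := by
    rw [Real.rpow_sub hy, Real.rpow_one]; ring
  have hp : 0 < (x + 1) ^ (-d) := by positivity
  rw [h3, h4]
  calc (x + 1) ^ (-d) * (1 / (x + 1)) = d⁻¹ * ((1 + d / (x + 1)) * (x + 1) ^ (-d) - (x + 1) ^ (-d)) := by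
        field_simp; ring
    _ ≤ _ := by gcongr

/-- Telescoping for a decreasing power. The first term is bounded on its own, which accounts for the
summand `1` in `1 + d⁻¹`. -/
theorem sum_rpow_tail_le {d : ℝ} (hd : 0 < d) {K : ℝ} (hK : 0 < K) (S : Finset ℕ)
    (hS : ∀ k ∈ S, 1 ≤ k ∧ K ≤ (k : ℝ)) :
    ∑ k ∈ S, (k : ℝ) ^ (-d - 1) ≤ (1 + d⁻¹) * K ^ (-d) := by
  set m := max 1 ⌈K⌉₊ with hm
  have hm1 : 1 ≤ m := le_max_left _ _
  have hmr : (1 : ℝ) ≤ m := by exact_mod_cast hm1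
  have hKm : K ≤ m := (Nat.le_ceil K).trans (by exact_mod_cast le_max_right _ _)
  have hm0 : (0 : ℝ) < m := by linarith
  have key : ∀ i : ℕ, ∑ k ∈ Finset.Icc m (m + i), (k : ℝ) ^ (-d - 1) ≤
      (1 + d⁻¹) * (m : ℝ) ^ (-d) - d⁻¹ * ((m + i : ℕ) : ℝ) ^ (-d) := by
    intro i
    induction i with
    | zero =>
      simp only [add_zero, Finset.Icc_self, Finset.sum_singleton]
      have : (m : ℝ) ^ (-d - 1) ≤ (m : ℝ) ^ (-d) :=
        Real.rpow_le_rpow_of_exponent_le hmr (by linarith)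
      linarith
    | succ i ih =>
      rw [← add_assoc, Finset.sum_Icc_succ_top (by omega)]
      have h1 : (1 : ℝ) ≤ ((m + i : ℕ) : ℝ) := by push_cast; linarith [i.cast_nonneg (α := ℝ)]
      have := rpow_neg_sub_one_le_mul_sub hd h1
      push_cast at this ih ⊢
      linarith
  obtain ⟨i, hi⟩ : ∃ i, ∀ k ∈ S, k ≤ m + i := ⟨S.sup id, fun k hk => by
    have := Finset.le_sup (f := id) hk
    simp only [id] at this; omega⟩
  calc ∑ k ∈ S, (k : ℝ) ^ (-d - 1) ≤ ∑ k ∈ Finset.Icc m (m + i), (k : ℝ) ^ (-d - 1) := by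
        apply Finset.sum_le_sum_of_subset_of_nonneg
        · intro k hk
          exact Finset.mem_Icc.2 ⟨max_le (hS k hk).1 (Nat.ceil_le.2 (hS k hk).2), hi k hk⟩
        · intros; positivity
    _ ≤ _ := key i
    _ ≤ (1 + d⁻¹) * (m : ℝ) ^ (-d) := by
      have : 0 ≤ d⁻¹ * ((m + i : ℕ) : ℝ) ^ (-d) := by positivity
      linarith
    _ ≤ _ := by
      apply mul_le_mul_of_nonneg_left _ (by positivity)
      exact Real.rpow_le_rpow_of_nonpos hK hKm (by linarith)

/-- After `k⁻¹` is pulled out, `k ^ (1 - x)` is monotone in `k`, so its values at `1` and `2 ^ n`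
bound it. The price is a harmonic sum; the gain is that no exponent is exceptional. -/
theorem sum_rpow_le_log_mul (x : ℝ) (n : ℕ) (S : Finset ℕ)
    (hS : ∀ k ∈ S, 1 ≤ k ∧ (k : ℝ) ≤ 2 ^ n) :
    ∑ k ∈ S, (k : ℝ) ^ (-x) ≤ (1 + n) * max 1 (((2 : ℝ) ^ n) ^ (1 - x)) := by
  have hh : ∑ k ∈ S, (k : ℝ) ^ (-1 : ℝ) ≤ 1 + n := by
    calc ∑ k ∈ S, (k : ℝ) ^ (-1 : ℝ) ≤ ∑ k ∈ Finset.Icc (1 : ℕ) (2 ^ n), (k : ℝ) ^ (-1 : ℝ) := by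
          apply Finset.sum_le_sum_of_subset_of_nonneg
          · intro k hk
            exact Finset.mem_Icc.2 ⟨(hS k hk).1, by exact_mod_cast (hS k hk).2⟩
          · intros; positivity
      _ = ((harmonic (2 ^ n) : ℚ) : ℝ) := by
        rw [harmonic_eq_sum_Icc]; push_cast
        exact Finset.sum_congr rfl fun k _ => by rw [Real.rpow_neg_one]
      _ ≤ 1 + Real.log ((2 ^ n : ℕ) : ℝ) := harmonic_le_one_add_log _
      _ ≤ 1 + n := by
        push_cast
        rw [Real.log_pow]
        have := Real.log_two_lt_d9
        have h2 : (n : ℝ) * Real.log 2 ≤ n * 1 := by gcongr; linarith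
        linarith
  calc ∑ k ∈ S, (k : ℝ) ^ (-x)
      ≤ ∑ k ∈ S, (k : ℝ) ^ (-1 : ℝ) * max 1 (((2 : ℝ) ^ n) ^ (1 - x)) := by
        apply Finset.sum_le_sum
        intro k hk
        have hk1 : (1 : ℝ) ≤ k := by exact_mod_cast (hS k hk).1
        rw [show -x = -1 + (1 - x) by ring, Real.rpow_add (by linarith)]
        gcongr
        rcases le_total 0 (1 - x) with h | h
        · exact (Real.rpow_le_rpow (by linarith) (hS k hk).2 h).trans (le_max_right _ _)
        · exact (Real.rpow_le_one_of_one_le_of_nonpos hk1 h).trans (le_max_left _ _)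
    _ = (∑ k ∈ S, (k : ℝ) ^ (-1 : ℝ)) * max 1 (((2 : ℝ) ^ n) ^ (1 - x)) := by
        rw [Finset.sum_mul]
    _ ≤ _ := by gcongr

/-! ### Sums over the levels -/

/-- A family that is dominated by an increasing and by a decreasing geometric sequence. -/
theorem sum_min_geometric_le {a b : ℝ} (ha : 0 < a) (hb : 0 < b) :
    ∃ C : ℝ, 0 < C ∧ ∀ (x : ℝ) (m : ℕ),
      ∑ n ∈ Finset.range m, min ((2 : ℝ) ^ (a * (n - x))) ((2 : ℝ) ^ (-b * (n - x))) ≤ C := by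
  set c := min a b with hc
  have hc0 : 0 < c := lt_min ha hb
  set r : ℝ := (2 : ℝ) ^ (-c) with hr
  have hr0 : 0 < r := by positivity
  have hr1 : r < 1 := Real.rpow_lt_one_of_one_lt_of_neg (by norm_num) (by linarith)
  -- Both sequences are compared with one geometric sequence in `|n - ⌊x⌋|`; rounding `x` costs the
  -- factor `2 ^ c`. Summing over all of `ℤ` makes the bound independent of `x` and `m`.
  have hsum : Summable fun n : ℤ => (2 : ℝ) ^ c * r ^ n.natAbs := by
    apply Summable.mul_left
    apply Summable.of_nat_of_neg
    · simpa using summable_geometric_of_lt_one hr0.le hr1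
    · simpa using summable_geometric_of_lt_one hr0.le hr1
  refine ⟨∑' n : ℤ, (2 : ℝ) ^ c * r ^ n.natAbs, ?_, ?_⟩
  · exact hsum.tsum_pos (fun i => by positivity) 0 (by positivity)
  intro x m
  have hterm : ∀ n : ℕ, min ((2 : ℝ) ^ (a * (n - x))) ((2 : ℝ) ^ (-b * (n - x))) ≤
      (2 : ℝ) ^ c * r ^ ((n : ℤ) - ⌊x⌋).natAbs := by
    intro n
    have h1 : (r ^ ((n : ℤ) - ⌊x⌋).natAbs : ℝ) = (2 : ℝ) ^ (-c * |(n : ℝ) - ⌊x⌋|) := by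
      rw [hr, ← Real.rpow_natCast, ← Real.rpow_mul (by norm_num)]
      congr 2
      rw [Nat.cast_natAbs]; push_cast; rfl
    rw [h1, ← Real.rpow_add (by norm_num)]
    have hf1 := Int.floor_le x
    have hf2 := Int.lt_floor_add_one x
    have hca : c ≤ a := min_le_left _ _
    have hcb : c ≤ b := min_le_right _ _
    rcases le_total (n : ℝ) x with h | h
    · refine (min_le_left _ _).trans (Real.rpow_le_rpow_of_exponent_le (by norm_num) ?_)
      have hnx : (n : ℝ) ≤ ⌊x⌋ := by
        have : (n : ℤ) ≤ ⌊x⌋ := Int.le_floor.2 (by exact_mod_cast h)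
        exact_mod_cast this
      rw [abs_of_nonpos (by linarith)]
      nlinarith
    · refine (min_le_right _ _).trans (Real.rpow_le_rpow_of_exponent_le (by norm_num) ?_)
      rw [abs_of_nonneg (by linarith)]
      nlinarith
  calc _ ≤ ∑ n ∈ Finset.range m, (2 : ℝ) ^ c * r ^ ((n : ℤ) - ⌊x⌋).natAbs :=
        Finset.sum_le_sum fun n _ => hterm n
    _ = ∑ n ∈ (Finset.range m).image (fun n : ℕ => (n : ℤ) - ⌊x⌋), (2 : ℝ) ^ c * r ^ n.natAbs := by
        rw [Finset.sum_image]
        intro i _ j _ h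
        simpa using h
    _ ≤ _ := hsum.sum_le_tsum _ fun i _ => by positivity

/-- In the logarithmic scale the two bounds are lines in `n` with slopes `θ` and `-θ'`. They meet at
the real number `x` of the proof, and `hm` says that their common height is `t ^ m`. Away from `x`
the lower line decays geometrically, so the height controls the sum, whether or not `x` lies in the
range of `n`. -/
theorem sum_le_of_two_lines {A A' θ θ' m : ℝ} (hθ : 0 < θ) (hθ' : 0 < θ')
    (hm : A * θ' + A' * θ = m * (θ + θ')) :
    ∃ C : ℝ, 0 < C ∧ ∀ (C₀ t : ℝ) (M : ℕ) (D : ℕ → ℝ), 0 ≤ C₀ → 0 < t →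
      (∀ n < M, D n ≤ C₀ * (t ^ A * ((2 : ℝ) ^ n) ^ θ)) →
      (∀ n < M, D n ≤ C₀ * (t ^ A' * ((2 : ℝ) ^ n) ^ (-θ'))) →
      ∑ n ∈ Finset.range M, D n ≤ C * (C₀ * t ^ m) := by
  obtain ⟨C, hC, h⟩ := sum_min_geometric_le hθ hθ'
  refine ⟨C, hC, fun C₀ t M D hC₀ ht h1 h2 => ?_⟩
  have hl2 : 0 < Real.log 2 := Real.log_pos (by norm_num)
  have hs : θ + θ' ≠ 0 := by positivity
  set x := (A' - A) / (θ + θ') * (Real.log t / Real.log 2) with hx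
  have e1 : ∀ n : ℕ, t ^ A * ((2 : ℝ) ^ n) ^ θ = t ^ m * (2 : ℝ) ^ (θ * (n - x)) := by
    intro n
    rw [Real.rpow_def_of_pos ht, Real.rpow_def_of_pos ht, Real.rpow_def_of_pos (by positivity),
      Real.rpow_def_of_pos (by norm_num : (0 : ℝ) < 2), ← Real.exp_add, ← Real.exp_add,
      Real.log_pow, hx]
    congr 1
    have : m = (A * θ' + A' * θ) / (θ + θ') := by field_simp; linarith
    rw [this]; field_simp; ring
  have e2 : ∀ n : ℕ, t ^ A' * ((2 : ℝ) ^ n) ^ (-θ') = t ^ m * (2 : ℝ) ^ (-θ' * (n - x)) := by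
    intro n
    rw [Real.rpow_def_of_pos ht, Real.rpow_def_of_pos ht, Real.rpow_def_of_pos (by positivity),
      Real.rpow_def_of_pos (by norm_num : (0 : ℝ) < 2), ← Real.exp_add, ← Real.exp_add,
      Real.log_pow, hx]
    congr 1
    have : m = (A * θ' + A' * θ) / (θ + θ') := by field_simp; linarith
    rw [this]; field_simp; ring
  calc ∑ n ∈ Finset.range M, D n
      ≤ ∑ n ∈ Finset.range M, (C₀ * t ^ m) *
          min ((2 : ℝ) ^ (θ * (n - x))) ((2 : ℝ) ^ (-θ' * (n - x))) := by
        apply Finset.sum_le_sum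
        intro n hn
        rw [mul_min_of_nonneg _ _ (by positivity), mul_assoc, mul_assoc, ← e1, ← e2]
        exact le_min (h1 n (Finset.mem_range.1 hn)) (h2 n (Finset.mem_range.1 hn))
    _ = (C₀ * t ^ m) * ∑ n ∈ Finset.range M,
          min ((2 : ℝ) ^ (θ * (n - x))) ((2 : ℝ) ^ (-θ' * (n - x))) := by rw [Finset.mul_sum]
    _ ≤ (C₀ * t ^ m) * C := by
        apply mul_le_mul_of_nonneg_left (h x M) (by positivity)
    _ = _ := by ring

/-! ### Truncated sums at one level -/

/-- The order of magnitude `N^(τ+1) k^(-(τ+1/2))` of a needlet of level `N = 2^j` whose node is the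
`k`-th one counted from the endpoint: `‖ψ‖_q^q` is comparable to its power `q - 2`. -/
def nodeScale (τ N k : ℝ) : ℝ := N ^ (τ + 1) * k ^ (-(τ + 1 / 2))

/-- The sum `∑_k min(y_k, u)^p X_k^{p-2}`, `X_k` being the node scale. -/
def truncSum (τ p N u : ℝ) (S : Finset ℕ) (y : ℕ → ℝ) : ℝ :=
  ∑ k ∈ S, min (y k) u ^ p * nodeScale τ N k ^ (p - 2)

theorem nodeScale_pos {τ N k : ℝ} (hN : 0 < N) (hk : 0 < k) : 0 < nodeScale τ N k := by
  unfold nodeScale; positivity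

theorem nodeScale_rpow {τ N k : ℝ} (hN : 0 < N) (hk : 0 < k) (q : ℝ) :
    nodeScale τ N k ^ q = N ^ (q * (τ + 1)) * k ^ (-(q * (τ + 1 / 2))) := by
  unfold nodeScale
  rw [Real.mul_rpow (by positivity) (by positivity), ← Real.rpow_mul hN.le, ← Real.rpow_mul hk.le]
  congr 2 <;> ring

theorem nodeScale_rpow_sub_two {τ N k : ℝ} (hN : 0 < N) (hk : 0 < k) (q : ℝ) :
    nodeScale τ N k ^ (q - 2) = N ^ ((q - 2) * (τ + 1)) * k ^ (deltaP q τ - 1) := by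
  rw [nodeScale_rpow hN hk, deltaP]; congr 2; ring

theorem min_rpow_le_right {p y u : ℝ} (hp : 0 ≤ p) (hy : 0 ≤ y) (hu : 0 ≤ u) :
    min y u ^ p ≤ u ^ p :=
  Real.rpow_le_rpow (le_min hy hu) (min_le_right _ _) hp

theorem min_rpow_le_left {p y u : ℝ} (hp : 0 ≤ p) (hy : 0 ≤ y) (hu : 0 ≤ u) :
    min y u ^ p ≤ y ^ p :=
  Real.rpow_le_rpow (le_min hy hu) (min_le_left _ _) hp

theorem min_rpow_le_mul {p q y u : ℝ} (hq : 0 ≤ q) (hqp : q < p) (hy : 0 ≤ y) (hu : 0 ≤ u) :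
    min y u ^ p ≤ u ^ (p - q) * y ^ q := by
  have h0 : 0 ≤ min y u := le_min hy hu
  rw [show p = (p - q) + q by ring, Real.rpow_add_of_nonneg h0 (by linarith) hq]
  simp only [add_sub_cancel_right]
  exact mul_le_mul (min_rpow_le_right (by linarith) hy hu) (min_rpow_le_left hq hy hu)
    (by positivity) (by positivity)

theorem truncSum_le_mul_sum {τ p N u : ℝ} {S : Finset ℕ} {y : ℕ → ℝ} (hp : 0 ≤ p) (hN : 0 < N)
    (hu : 0 ≤ u) (hy : ∀ k, 0 ≤ y k) (hS : ∀ k ∈ S, 1 ≤ k) :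
    truncSum τ p N u S y ≤
      u ^ p * N ^ ((p - 2) * (τ + 1)) * ∑ k ∈ S, (k : ℝ) ^ (deltaP p τ - 1) := by
  rw [truncSum, Finset.mul_sum]
  apply Finset.sum_le_sum
  intro k hk
  have hk0 : (0 : ℝ) < k := by exact_mod_cast hS k hk
  rw [nodeScale_rpow_sub_two hN hk0, mul_assoc]
  gcongr
  · exact le_min (hy k) hu
  · exact min_le_right _ _

theorem truncSum_le_of_le {τ p N u K : ℝ} {S : Finset ℕ} {y : ℕ → ℝ} (hp : 0 ≤ p) (hN : 0 < N)
    (hu : 0 ≤ u) (hy : ∀ k, 0 ≤ y k) (hK : 0 < K) (hS : ∀ k ∈ S, 1 ≤ k ∧ (k : ℝ) ≤ K)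
    (hδ : 0 < deltaP p τ) :
    truncSum τ p N u S y ≤
      max 1 (deltaP p τ)⁻¹ * (u ^ p * N ^ ((p - 2) * (τ + 1)) * K ^ deltaP p τ) := by
  refine (truncSum_le_mul_sum hp hN hu hy fun k hk => (hS k hk).1).trans ?_
  calc _ ≤ u ^ p * N ^ ((p - 2) * (τ + 1)) * (max 1 (deltaP p τ)⁻¹ * K ^ deltaP p τ) := by
        gcongr
        exact sum_rpow_le_rpow hδ hK S hS
    _ = _ := by ring

theorem truncSum_le_of_ge {τ p N u K : ℝ} {S : Finset ℕ} {y : ℕ → ℝ} (hp : 0 ≤ p) (hN : 0 < N)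
    (hu : 0 ≤ u) (hy : ∀ k, 0 ≤ y k) (hK : 0 < K) (hS : ∀ k ∈ S, 1 ≤ k ∧ K ≤ (k : ℝ))
    (hδ : deltaP p τ < 0) :
    truncSum τ p N u S y ≤
      (1 + (-deltaP p τ)⁻¹) * (u ^ p * N ^ ((p - 2) * (τ + 1)) * K ^ deltaP p τ) := by
  refine (truncSum_le_mul_sum hp hN hu hy fun k hk => (hS k hk).1).trans ?_
  have := sum_rpow_tail_le (d := -deltaP p τ) (by linarith) hK S hS
  simp only [neg_neg] at this
  calc _ ≤ u ^ p * N ^ ((p - 2) * (τ + 1)) * ((1 + (-deltaP p τ)⁻¹) * K ^ deltaP p τ) := by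
        gcongr
    _ = _ := by ring

theorem truncSum_le_sum {τ p N u : ℝ} {S : Finset ℕ} {y : ℕ → ℝ} (hp : 0 ≤ p) (hN : 0 < N)
    (hu : 0 ≤ u) (hy : ∀ k, 0 ≤ y k) (hS : ∀ k ∈ S, 1 ≤ k) :
    truncSum τ p N u S y ≤ ∑ k ∈ S, y k ^ p * nodeScale τ N k ^ (p - 2) := by
  apply Finset.sum_le_sum
  intro k hk
  have hk0 : (0 : ℝ) < k := by exact_mod_cast hS k hk
  have := nodeScale_pos (τ := τ) hN hk0
  gcongr
  · exact le_min (hy k) hu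
  · exact min_le_left _ _

theorem sum_rpow_le_rpow_sum {ι : Type*} (S : Finset ι) (z : ι → ℝ) (hz : ∀ i ∈ S, 0 ≤ z i) {r : ℝ}
    (hr : 1 ≤ r) : ∑ i ∈ S, z i ^ r ≤ (∑ i ∈ S, z i) ^ r := by
  have h0 : 0 ≤ ∑ i ∈ S, z i := Finset.sum_nonneg hz
  have hr' : ∀ w : ℝ, 0 ≤ w → w ^ r = w * w ^ (r - 1) := fun w hw => by
    conv_lhs => rw [show r = 1 + (r - 1) by ring]
    rw [Real.rpow_add_of_nonneg hw (by norm_num) (by linarith), Real.rpow_one]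
  rw [hr' _ h0, Finset.sum_mul]
  apply Finset.sum_le_sum
  intro i hi
  rw [hr' _ (hz i hi)]
  apply mul_le_mul_of_nonneg_left _ (hz i hi)
  exact Real.rpow_le_rpow (hz i hi) (Finset.single_le_sum hz hi) (by linarith)

theorem nodeScale_le {τ N K k : ℝ} (hτ : -(1 / 2) < τ) (hN : 0 < N) (hK : 0 < K) (hk : K ≤ k) :
    nodeScale τ N k ≤ N ^ (τ + 1) * K ^ (-(τ + 1 / 2)) := by
  unfold nodeScale
  have := Real.rpow_le_rpow_of_nonpos hK hk (z := -(τ + 1 / 2)) (by linarith)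
  gcongr

/-- The embedding of weighted `ℓ_π` into weighted `ℓ_p`, `π ≤ p`. -/
theorem sum_mul_nodeScale_le_of_le {τ p π N : ℝ} {S : Finset ℕ} {y : ℕ → ℝ} (hτ : -(1 / 2) < τ)
    (hπ : 0 < π) (hπp : π ≤ p) (hN : 0 < N) (hy : ∀ k, 0 ≤ y k) (hS : ∀ k ∈ S, 1 ≤ k) :
    ∑ k ∈ S, y k ^ p * nodeScale τ N k ^ (p - 2) ≤
      N ^ ((τ + 1) * (2 * p / π - 2)) *
        (∑ k ∈ S, y k ^ π * nodeScale τ N k ^ (π - 2)) ^ (p / π) := by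
  have hr : 1 ≤ p / π := by rw [le_div_iff₀ hπ]; linarith
  calc ∑ k ∈ S, y k ^ p * nodeScale τ N k ^ (p - 2)
      ≤ ∑ k ∈ S, N ^ ((τ + 1) * (2 * p / π - 2)) *
          (y k ^ π * nodeScale τ N k ^ (π - 2)) ^ (p / π) := by
        apply Finset.sum_le_sum
        intro k hk
        have hk0 : (0 : ℝ) < k := by exact_mod_cast hS k hk
        have hX := nodeScale_pos (τ := τ) hN hk0
        have hX1 : nodeScale τ N k ≤ N ^ (τ + 1) := by
          have := nodeScale_le hτ hN one_pos (k := k) (by exact_mod_cast hS k hk)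
          simpa using this
        rw [Real.mul_rpow (Real.rpow_nonneg (hy k) _) (by positivity), ← Real.rpow_mul (hy k),
          ← Real.rpow_mul hX.le, show π * (p / π) = p by field_simp, Real.rpow_mul hN.le,
          show p - 2 = (2 * p / π - 2) + (π - 2) * (p / π) by field_simp; ring, Real.rpow_add hX]
        -- `y^p X^{p-2} = X^{2p/π-2} (y^π X^{π-2})^{p/π}`; as `π ≤ p`, the spare power of `X` is at
        -- most its value at `k = 1`.
        have : nodeScale τ N k ^ (2 * p / π - 2) ≤ (N ^ (τ + 1)) ^ (2 * p / π - 2) := by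
          apply Real.rpow_le_rpow hX.le hX1
          have : 2 * p / π = 2 * (p / π) := by ring
          linarith
        calc _ = nodeScale τ N k ^ (2 * p / π - 2) *
              (y k ^ p * nodeScale τ N k ^ ((π - 2) * (p / π))) := by ring
          _ ≤ _ := by
            apply mul_le_mul_of_nonneg_right this
            exact mul_nonneg (Real.rpow_nonneg (hy k) _) (by positivity)
    _ ≤ _ := by
        rw [← Finset.mul_sum]
        apply mul_le_mul_of_nonneg_left _ (by positivity)
        apply sum_rpow_le_rpow_sum _ _ _ hr
        intro k hk
        have hk0 : (0 : ℝ) < k := by exact_mod_cast hS k hk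
        have hX := nodeScale_pos (τ := τ) hN hk0
        exact mul_nonneg (Real.rpow_nonneg (hy k) _) (by positivity)

/-- Hölder's inequality between weighted `ℓ_p` and weighted `ℓ_π`, `p < π`, over the first `K`
nodes. -/
theorem sum_mul_nodeScale_le_of_gt {τ p π N K : ℝ} {S : Finset ℕ} {y : ℕ → ℝ} (hτ : -(1 / 2) < τ)
    (hp : 0 < p) (hπp : p < π) (hN : 0 < N) (hy : ∀ k, 0 ≤ y k) (hK : 0 < K)
    (hS : ∀ k ∈ S, 1 ≤ k ∧ (k : ℝ) ≤ K) :
    ∑ k ∈ S, y k ^ p * nodeScale τ N k ^ (p - 2) ≤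
      (max 1 (2 * (τ + 1))⁻¹ * (N ^ (-2 * (τ + 1)) * K ^ (2 * (τ + 1)))) ^ (1 - p / π) *
        (∑ k ∈ S, y k ^ π * nodeScale τ N k ^ (π - 2)) ^ (p / π) := by
  have hπ : 0 < π := by linarith
  have hr : 1 < π / p := by rw [lt_div_iff₀ hp]; linarith
  have hconj := Real.HolderConjugate.conjExponent hr
  have hk0 : ∀ k ∈ S, (0 : ℝ) < k := fun k hk => by exact_mod_cast (hS k hk).1
  have hX : ∀ k ∈ S, 0 < nodeScale τ N k := fun k hk => nodeScale_pos (τ := τ) hN (hk0 k hk)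
  have hw : 0 < 1 - p / π := by rw [sub_pos, div_lt_one hπ]; exact hπp
  have hce : 1 / Real.conjExponent (π / p) = 1 - p / π := by
    have := hconj.inv_add_inv_eq_one
    have h2 : (π / p)⁻¹ = p / π := by rw [inv_div]
    rw [one_div]; linarith
  have hcinv : (1 - p / π) * Real.conjExponent (π / p) = 1 := by
    rw [← hce]; field_simp [hconj.symm.ne_zero]
  have hz : ∀ k ∈ S, 0 ≤ y k ^ π * nodeScale τ N k ^ (π - 2) := fun k hk =>
    mul_nonneg (Real.rpow_nonneg (hy k) _) (Real.rpow_nonneg (hX k hk).le _)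
  -- The weight is split as `X^{p-2} = X^{(π-2)p/π} · X^{-2(1-p/π)}`. In the conjugate exponent the
  -- second factor becomes `X^{-2}`, whose sum over `k ≤ K` is a sum of `k^{2(τ+1)-1}`.
  have := Real.inner_le_Lp_mul_Lq_of_nonneg S hconj
    (f := fun k => (y k ^ π * nodeScale τ N k ^ (π - 2)) ^ (p / π))
    (g := fun k => (nodeScale τ N k ^ (-2 : ℝ)) ^ (1 - p / π))
    (fun k hk => Real.rpow_nonneg (hz k hk) _)
    (fun k hk => Real.rpow_nonneg (Real.rpow_nonneg (hX k hk).le _) _)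
  have e1 : ∑ k ∈ S, ((y k ^ π * nodeScale τ N k ^ (π - 2)) ^ (p / π)) ^ (π / p) =
      ∑ k ∈ S, y k ^ π * nodeScale τ N k ^ (π - 2) := by
    apply Finset.sum_congr rfl
    intro k hk
    rw [← Real.rpow_mul (hz k hk), show p / π * (π / p) = 1 by field_simp, Real.rpow_one]
  have e2 : ∑ k ∈ S, ((nodeScale τ N k ^ (-2 : ℝ)) ^ (1 - p / π)) ^ Real.conjExponent (π / p) =
      ∑ k ∈ S, nodeScale τ N k ^ (-2 : ℝ) := by
    apply Finset.sum_congr rfl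
    intro k hk
    rw [← Real.rpow_mul (Real.rpow_nonneg (hX k hk).le _), hcinv, Real.rpow_one]
  have e3 : ∑ k ∈ S, (y k ^ π * nodeScale τ N k ^ (π - 2)) ^ (p / π) *
      (nodeScale τ N k ^ (-2 : ℝ)) ^ (1 - p / π) =
      ∑ k ∈ S, y k ^ p * nodeScale τ N k ^ (p - 2) := by
    apply Finset.sum_congr rfl
    intro k hk
    rw [Real.mul_rpow (Real.rpow_nonneg (hy k) _) (Real.rpow_nonneg (hX k hk).le _),
      ← Real.rpow_mul (hy k), ← Real.rpow_mul (hX k hk).le, ← Real.rpow_mul (hX k hk).le, mul_assoc,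
      ← Real.rpow_add (hX k hk)]
    congr 2 <;> field_simp
    ring
  have e4 : ∑ k ∈ S, nodeScale τ N k ^ (-2 : ℝ) ≤
      max 1 (2 * (τ + 1))⁻¹ * (N ^ (-2 * (τ + 1)) * K ^ (2 * (τ + 1))) := by
    have hs := sum_rpow_le_rpow (d := 2 * (τ + 1)) (by linarith) hK S hS
    calc ∑ k ∈ S, nodeScale τ N k ^ (-2 : ℝ)
        = N ^ (-2 * (τ + 1)) * ∑ k ∈ S, (k : ℝ) ^ (2 * (τ + 1) - 1) := by
          rw [Finset.mul_sum]
          apply Finset.sum_congr rfl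
          intro k hk
          rw [nodeScale_rpow hN (hk0 k hk)]
          congr 2; ring
      _ ≤ N ^ (-2 * (τ + 1)) * (max 1 (2 * (τ + 1))⁻¹ * K ^ (2 * (τ + 1))) := by gcongr
      _ = _ := by ring
  rw [e1, e2, e3, hce, one_div, inv_div] at this
  refine this.trans ?_
  rw [mul_comm]
  have h0 : 0 ≤ ∑ k ∈ S, nodeScale τ N k ^ (-2 : ℝ) :=
    Finset.sum_nonneg fun k hk => Real.rpow_nonneg (hX k hk).le _
  apply mul_le_mul_of_nonneg_right (Real.rpow_le_rpow h0 e4 hw.le)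
  exact Real.rpow_nonneg (Finset.sum_nonneg hz) _

/-- For `δ_p > 0` the weights `k^{δ_p-1}` have a small sum near the endpoint, so the first nodes are
charged with the noise `u`. Beyond `K` one uses `min(y,u)^p ≤ u^{p-π} y^π` and the fact that the
node scale is at most its value at `K`. -/
theorem truncSum_le_split_of_lt {τ p π N u K : ℝ} {S : Finset ℕ} {y : ℕ → ℝ} (hτ : -(1 / 2) < τ)
    (hπ : 0 < π) (hπp : π < p) (hδ : 0 < deltaP p τ) (hN : 0 < N) (hu : 0 ≤ u)
    (hy : ∀ k, 0 ≤ y k) (hK : 0 < K) (hS : ∀ k ∈ S, 1 ≤ k) :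
    truncSum τ p N u S y ≤
      max 1 (deltaP p τ)⁻¹ * (u ^ p * N ^ ((p - 2) * (τ + 1)) * K ^ deltaP p τ) +
      u ^ (p - π) * (N ^ (τ + 1) * K ^ (-(τ + 1 / 2))) ^ (p - π) *
        ∑ k ∈ S, y k ^ π * nodeScale τ N k ^ (π - 2) := by
  have hk0 : ∀ k ∈ S, (0 : ℝ) < k := fun k hk => by exact_mod_cast hS k hk
  have hX : ∀ k ∈ S, 0 < nodeScale τ N k := fun k hk => nodeScale_pos (τ := τ) hN (hk0 k hk)
  rw [truncSum, ← Finset.sum_filter_add_sum_filter_not S (fun k : ℕ => (k : ℝ) ≤ K)]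
  apply add_le_add
  · exact truncSum_le_of_le (by linarith) hN hu hy hK
      (fun k hk => ⟨hS k (Finset.mem_filter.1 hk).1, (Finset.mem_filter.1 hk).2⟩) hδ
  · rw [Finset.mul_sum]
    refine le_trans ?_ (Finset.sum_le_sum_of_subset_of_nonneg
      (Finset.filter_subset (fun k : ℕ => ¬ (k : ℝ) ≤ K) S) ?_)
    · apply Finset.sum_le_sum
      intro k hk
      obtain ⟨hkS, hkK⟩ := Finset.mem_filter.1 hk
      have h1 := min_rpow_le_mul hπ.le hπp (hy k) hu
      have h2 : nodeScale τ N k ^ (p - 2) ≤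
          (N ^ (τ + 1) * K ^ (-(τ + 1 / 2))) ^ (p - π) * nodeScale τ N k ^ (π - 2) := by
        rw [show p - 2 = (p - π) + (π - 2) by ring, Real.rpow_add (hX k hkS)]
        apply mul_le_mul_of_nonneg_right _ (Real.rpow_nonneg (hX k hkS).le _)
        exact Real.rpow_le_rpow (hX k hkS).le (nodeScale_le hτ hN hK (not_le.1 hkK).le)
          (by linarith)
      calc _ ≤ (u ^ (p - π) * y k ^ π) *
            ((N ^ (τ + 1) * K ^ (-(τ + 1 / 2))) ^ (p - π) * nodeScale τ N k ^ (π - 2)) :=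
            mul_le_mul h1 h2 (Real.rpow_nonneg (hX k hkS).le _)
              (mul_nonneg (by positivity) (Real.rpow_nonneg (hy k) _))
        _ = _ := by ring
    · intro k hk _
      have := hX k hk
      have := Real.rpow_nonneg (hy k) π
      positivity

/-- The mirror image: for `δ_p < 0` the weights are concentrated on the first nodes, so there the
coefficients are used, through Hölder's inequality. The noise bound serves only from `K` on, where
the weights sum to `O(K^{δ_p})`. -/
theorem truncSum_le_split_of_gt {τ p π N u K : ℝ} {S : Finset ℕ} {y : ℕ → ℝ} (hτ : -(1 / 2) < τ)
    (hp : 0 < p) (hπp : p < π) (hδ : deltaP p τ < 0) (hN : 0 < N) (hu : 0 ≤ u)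
    (hy : ∀ k, 0 ≤ y k) (hK : 0 < K) (hS : ∀ k ∈ S, 1 ≤ k) :
    truncSum τ p N u S y ≤
      (max 1 (2 * (τ + 1))⁻¹ * (N ^ (-2 * (τ + 1)) * K ^ (2 * (τ + 1)))) ^ (1 - p / π) *
        (∑ k ∈ S, y k ^ π * nodeScale τ N k ^ (π - 2)) ^ (p / π) +
      (1 + (-deltaP p τ)⁻¹) * (u ^ p * N ^ ((p - 2) * (τ + 1)) * K ^ deltaP p τ) := by
  have hk0 : ∀ k ∈ S, (0 : ℝ) < k := fun k hk => by exact_mod_cast hS k hk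
  have hX : ∀ k ∈ S, 0 < nodeScale τ N k := fun k hk => nodeScale_pos (τ := τ) hN (hk0 k hk)
  have hz : ∀ k ∈ S, 0 ≤ y k ^ π * nodeScale τ N k ^ (π - 2) := fun k hk =>
    mul_nonneg (Real.rpow_nonneg (hy k) _) (Real.rpow_nonneg (hX k hk).le _)
  rw [truncSum, ← Finset.sum_filter_add_sum_filter_not S (fun k : ℕ => (k : ℝ) ≤ K)]
  apply add_le_add
  · refine (truncSum_le_sum hp.le hN hu hy
      fun k hk => hS k (Finset.mem_filter.1 hk).1).trans ?_
    refine (sum_mul_nodeScale_le_of_gt hτ hp hπp hN hy hK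
      (fun k hk => ⟨hS k (Finset.mem_filter.1 hk).1, (Finset.mem_filter.1 hk).2⟩)).trans ?_
    apply mul_le_mul_of_nonneg_left _ (by positivity)
    apply Real.rpow_le_rpow
    · exact Finset.sum_nonneg fun k hk => hz k (Finset.mem_filter.1 hk).1
    · exact Finset.sum_le_sum_of_subset_of_nonneg (Finset.filter_subset _ S) fun k hk _ => hz k hk
    · have : 0 < π := hp.trans hπp
      positivity
  · exact truncSum_le_of_ge hp.le hN hu hy hK
      (fun k hk => ⟨hS k (Finset.mem_filter.1 hk).1, (not_le.1 (Finset.mem_filter.1 hk).2).le⟩) hδ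

/-! ### The truncated sums of all levels -/

/-- The sum of `k^{δ_p-1}` over `k ≤ N` is of order `N^{δ_p}`, `log N` or `1` according to the sign
of `δ_p`. This lemma and the next two record the resulting growth in `N`; only the critical case
loses a factor `1 + n`. -/
theorem truncSum_le_noise_of_pos {τ p ν N t : ℝ} {S : Finset ℕ} {y : ℕ → ℝ} (hp : 0 ≤ p)
    (hN : 0 < N) (ht : 0 < t) (hy : ∀ k, 0 ≤ y k) (hS : ∀ k ∈ S, 1 ≤ k ∧ (k : ℝ) ≤ N)
    (hδ : 0 < deltaP p τ) :
    truncSum τ p N (t * N ^ ν) S y ≤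
      max 1 (deltaP p τ)⁻¹ * (t ^ p * N ^ (p * (ν + 1 / 2))) := by
  refine (truncSum_le_of_le hp hN (by positivity) hy hN hS hδ).trans (le_of_eq ?_)
  rw [Real.mul_rpow ht.le (by positivity), ← Real.rpow_mul hN.le, mul_assoc, mul_assoc,
    ← Real.rpow_add hN, ← Real.rpow_add hN, deltaP]
  congr 3; ring

theorem truncSum_le_noise_of_eq {τ p ν t : ℝ} {n : ℕ} {S : Finset ℕ} {y : ℕ → ℝ} (hp : 0 ≤ p)
    (ht : 0 < t) (hy : ∀ k, 0 ≤ y k) (hS : ∀ k ∈ S, 1 ≤ k ∧ (k : ℝ) ≤ 2 ^ n)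
    (hδ : deltaP p τ = 0) :
    truncSum τ p (2 ^ n) (t * (2 ^ n) ^ ν) S y ≤
      (1 + n) * (t ^ p * ((2 : ℝ) ^ n) ^ (p * (ν + 1 / 2))) := by
  have hN : (0 : ℝ) < 2 ^ n := by positivity
  refine (truncSum_le_mul_sum hp hN (by positivity) hy fun k hk => (hS k hk).1).trans ?_
  have h1 := sum_rpow_le_log_mul 1 n S hS
  simp only [sub_self, Real.rpow_zero, max_self, mul_one] at h1
  rw [hδ, zero_sub]
  have e : (t * ((2 : ℝ) ^ n) ^ ν) ^ p * ((2 : ℝ) ^ n) ^ ((p - 2) * (τ + 1)) =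
      t ^ p * ((2 : ℝ) ^ n) ^ (p * (ν + 1 / 2)) := by
    rw [Real.mul_rpow ht.le (by positivity), ← Real.rpow_mul hN.le, mul_assoc, ← Real.rpow_add hN]
    unfold deltaP at hδ
    congr 2; linarith
  rw [e, mul_comm]
  gcongr

theorem truncSum_le_noise_of_neg {τ p ν N t : ℝ} {S : Finset ℕ} {y : ℕ → ℝ} (hp : 0 ≤ p)
    (hN : 0 < N) (ht : 0 < t) (hy : ∀ k, 0 ≤ y k) (hS : ∀ k ∈ S, 1 ≤ k) (hδ : deltaP p τ < 0) :
    truncSum τ p N (t * N ^ ν) S y ≤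
      (1 + (-deltaP p τ)⁻¹) * (t ^ p * N ^ (p * ν + (p - 2) * (τ + 1))) := by
  refine (truncSum_le_of_ge hp hN (by positivity) hy one_pos
    (fun k hk => ⟨hS k hk, by exact_mod_cast hS k hk⟩) hδ).trans (le_of_eq ?_)
  rw [Real.mul_rpow ht.le (by positivity), ← Real.rpow_mul hN.le, Real.one_rpow, mul_one, mul_assoc,
    ← Real.rpow_add hN]
  congr 3; ring

theorem sum_le_bias_of_le {τ p π s M₀ N : ℝ} {S : Finset ℕ} {y : ℕ → ℝ}
    (hτ : -(1 / 2) < τ) (hπ : 0 < π) (hπp : π ≤ p) (hN : 0 < N) (hM : 0 ≤ M₀) (hy : ∀ k, 0 ≤ y k)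
    (hS : ∀ k ∈ S, 1 ≤ k)
    (hB : ∑ k ∈ S, y k ^ π * nodeScale τ N k ^ (π - 2) ≤ M₀ * N ^ (-(s * π))) :
    ∑ k ∈ S, y k ^ p * nodeScale τ N k ^ (p - 2) ≤
      M₀ ^ (p / π) * N ^ (-(p * (s - 2 * (1 + τ) * (1 / π - 1 / p)))) := by
  have hp : 0 < p := by linarith
  refine (sum_mul_nodeScale_le_of_le hτ hπ hπp hN hy hS).trans ?_
  have h0 : 0 ≤ ∑ k ∈ S, y k ^ π * nodeScale τ N k ^ (π - 2) := Finset.sum_nonneg fun k hk =>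
    mul_nonneg (Real.rpow_nonneg (hy k) _)
      (Real.rpow_nonneg (nodeScale_pos hN (by exact_mod_cast hS k hk)).le _)
  calc _ ≤ N ^ ((τ + 1) * (2 * p / π - 2)) * (M₀ * N ^ (-(s * π))) ^ (p / π) := by
        gcongr
    _ = _ := by
        rw [Real.mul_rpow hM (by positivity), ← Real.rpow_mul hN.le, mul_left_comm,
          ← Real.rpow_add hN]
        congr 2; field_simp; ring

theorem sum_le_bias_of_gt {τ p π s M₀ N : ℝ} {S : Finset ℕ} {y : ℕ → ℝ}
    (hτ : -(1 / 2) < τ) (hp : 0 < p) (hπp : p < π) (hN : 0 < N) (hM : 0 ≤ M₀) (hy : ∀ k, 0 ≤ y k)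
    (hS : ∀ k ∈ S, 1 ≤ k ∧ (k : ℝ) ≤ N)
    (hB : ∑ k ∈ S, y k ^ π * nodeScale τ N k ^ (π - 2) ≤ M₀ * N ^ (-(s * π))) :
    ∑ k ∈ S, y k ^ p * nodeScale τ N k ^ (p - 2) ≤
      (max 1 (2 * (τ + 1))⁻¹) ^ (1 - p / π) * M₀ ^ (p / π) * N ^ (-(p * s)) := by
  have hπ : 0 < π := by linarith
  refine (sum_mul_nodeScale_le_of_gt hτ hp hπp hN hy hN hS).trans ?_
  have h0 : 0 ≤ ∑ k ∈ S, y k ^ π * nodeScale τ N k ^ (π - 2) := Finset.sum_nonneg fun k hk =>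
    mul_nonneg (Real.rpow_nonneg (hy k) _)
      (Real.rpow_nonneg (nodeScale_pos hN (by exact_mod_cast (hS k hk).1)).le _)
  have e : N ^ (-2 * (τ + 1)) * N ^ (2 * (τ + 1)) = 1 := by
    rw [← Real.rpow_add hN, show -2 * (τ + 1) + 2 * (τ + 1) = 0 by ring, Real.rpow_zero]
  rw [e, mul_one]
  calc _ ≤ (max 1 (2 * (τ + 1))⁻¹) ^ (1 - p / π) * (M₀ * N ^ (-(s * π))) ^ (p / π) := by
        gcongr
    _ = _ := by
        rw [Real.mul_rpow hM (by positivity), ← Real.rpow_mul hN.le, mul_assoc]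
        congr 3; field_simp

theorem truncSum_le_middle_of_lt {τ p π s ν M₀ N t : ℝ} {S : Finset ℕ} {y : ℕ → ℝ}
    (hτ : -(1 / 2) < τ) (hπ : 0 < π) (hπp : π < p) (hδ : 0 < deltaP p τ) (hδπ : deltaP π τ ≠ 0)
    (hN : 0 < N) (ht : 0 < t) (hy : ∀ k, 0 ≤ y k)
    (hS : ∀ k ∈ S, 1 ≤ k)
    (hB : ∑ k ∈ S, y k ^ π * nodeScale τ N k ^ (π - 2) ≤ M₀ * N ^ (-(s * π))) :
    truncSum τ p N (t * N ^ ν) S y ≤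
      (max 1 (deltaP p τ)⁻¹ + M₀) * (t ^ (p - π * deltaP p τ / deltaP π τ) *
        N ^ (-(π * deltaS p π ν s τ / deltaP π τ))) := by
  have hp : 0 < p := by linarith
  -- The critical index equates the powers of `t` and `N` in the two terms of the split: `K^{δ_π} =
  -- t^{-π} N^{-(π(ν+s)+(π-2)(τ+1))}`. It is only a positive real number and need not lie between
  -- `1` and `N`.
  set K := t ^ (-(π / deltaP π τ)) *
    N ^ (-((π * (ν + s) + (π - 2) * (τ + 1)) / deltaP π τ)) with hK
  have hK0 : 0 < K := by positivity
  refine (truncSum_le_split_of_lt hτ hπ hπp hδ hN (u := t * N ^ ν) (by positivity) hy hK0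
    hS).trans ?_
  have hB' : (t * N ^ ν) ^ (p - π) * (N ^ (τ + 1) * K ^ (-(τ + 1 / 2))) ^ (p - π) *
        ∑ k ∈ S, y k ^ π * nodeScale τ N k ^ (π - 2) ≤
      (t * N ^ ν) ^ (p - π) * (N ^ (τ + 1) * K ^ (-(τ + 1 / 2))) ^ (p - π) *
        (M₀ * N ^ (-(s * π))) := by gcongr
  refine (add_le_add_right hB' _).trans (le_of_eq ?_)
  -- In exponential coordinates the products of powers become identities between linear forms in
  -- `log t` and `log N`.
  obtain ⟨a, rfl⟩ : ∃ a, t = Real.exp a := ⟨Real.log t, (Real.exp_log ht).symm⟩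
  obtain ⟨b, rfl⟩ : ∃ b, N = Real.exp b := ⟨Real.log N, (Real.exp_log hN).symm⟩
  rw [hK]
  simp only [← Real.exp_mul, ← Real.exp_add]
  have e1 : ∀ x y z w c : ℝ, x = w → y + z = w →
      c * Real.exp x + Real.exp y * (M₀ * Real.exp z) = (c + M₀) * Real.exp w := by
    rintro x y z w c rfl h
    rw [← h, Real.exp_add]; ring
  apply e1
  · rw [show deltaP p τ = 1 - (p - 2) * (τ + 1 / 2) from rfl, deltaS]
    generalize hD : deltaP π τ = D at hδπ
    field_simp
    rw [← hD, deltaP]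
    ring
  · rw [show deltaP p τ = 1 - (p - 2) * (τ + 1 / 2) from rfl, deltaS]
    generalize hD : deltaP π τ = D at hδπ
    field_simp
    rw [← hD, deltaP]
    ring

theorem truncSum_le_middle_of_gt {τ p π s ν M₀ N t : ℝ} {S : Finset ℕ} {y : ℕ → ℝ}
    (hτ : -(1 / 2) < τ) (hp : 0 < p) (hπp : p < π) (hδ : deltaP p τ < 0) (hδπ : deltaP π τ ≠ 0)
    (hN : 0 < N) (ht : 0 < t) (hM : 0 ≤ M₀) (hy : ∀ k, 0 ≤ y k)
    (hS : ∀ k ∈ S, 1 ≤ k)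
    (hB : ∑ k ∈ S, y k ^ π * nodeScale τ N k ^ (π - 2) ≤ M₀ * N ^ (-(s * π))) :
    truncSum τ p N (t * N ^ ν) S y ≤
      ((max 1 (2 * (τ + 1))⁻¹) ^ (1 - p / π) * M₀ ^ (p / π) + (1 + (-deltaP p τ)⁻¹)) *
      (t ^ (p - π * deltaP p τ / deltaP π τ) *
        N ^ (-(π * deltaS p π ν s τ / deltaP π τ))) := by
  have hπ : 0 < π := by linarith
  -- The same index as for `π < p`: the balance equation with the Hölder term is the `p/π`-th power
  -- of the earlier one.
  set K := t ^ (-(π / deltaP π τ)) *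
    N ^ (-((π * (ν + s) + (π - 2) * (τ + 1)) / deltaP π τ)) with hK
  have hK0 : 0 < K := by positivity
  refine (truncSum_le_split_of_gt hτ hp hπp hδ hN (u := t * N ^ ν) (by positivity) hy hK0
    hS).trans ?_
  have h0 : 0 ≤ ∑ k ∈ S, y k ^ π * nodeScale τ N k ^ (π - 2) := Finset.sum_nonneg fun k hk =>
    mul_nonneg (Real.rpow_nonneg (hy k) _)
      (Real.rpow_nonneg (nodeScale_pos hN (by exact_mod_cast hS k hk)).le _)
  have hc : (0 : ℝ) ≤ max 1 (2 * (τ + 1))⁻¹ := by positivity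
  have hB' : (max 1 (2 * (τ + 1))⁻¹ * (N ^ (-2 * (τ + 1)) * K ^ (2 * (τ + 1)))) ^ (1 - p / π) *
        (∑ k ∈ S, y k ^ π * nodeScale τ N k ^ (π - 2)) ^ (p / π) ≤
      (max 1 (2 * (τ + 1))⁻¹ * (N ^ (-2 * (τ + 1)) * K ^ (2 * (τ + 1)))) ^ (1 - p / π) *
        (M₀ * N ^ (-(s * π))) ^ (p / π) := by gcongr
  refine (add_le_add_left hB' _).trans (le_of_eq ?_)
  rw [Real.mul_rpow hc (by positivity), Real.mul_rpow hM (by positivity)]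
  obtain ⟨a, rfl⟩ : ∃ a, t = Real.exp a := ⟨Real.log t, (Real.exp_log ht).symm⟩
  obtain ⟨b, rfl⟩ : ∃ b, N = Real.exp b := ⟨Real.log N, (Real.exp_log hN).symm⟩
  rw [hK]
  simp only [← Real.exp_mul, ← Real.exp_add]
  have e1 : ∀ x y z w c c' d : ℝ, x = w → y + z = w →
      (c * Real.exp y) * (c' * Real.exp z) + d * Real.exp x =
        (c * c' + d) * Real.exp w := by
    rintro x y z w c c' d rfl h
    rw [← h, Real.exp_add]; ring
  apply e1
  · rw [show deltaP p τ = 1 - (p - 2) * (τ + 1 / 2) from rfl, deltaS]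
    generalize hD : deltaP π τ = D at hδπ
    field_simp
    rw [← hD, deltaP]
    ring
  · rw [show deltaP p τ = 1 - (p - 2) * (τ + 1 / 2) from rfl, deltaS]
    generalize hD : deltaP π τ = D at hδπ
    field_simp
    rw [← hD, deltaP]
    ring

/-- `E` carries a factor depending on the number of levels, so that `C` does not depend on it. -/
theorem sum_le_of_two_lines' {A A' θ θ' m c₁ c₂ : ℝ} (hθ : 0 < θ) (hθ' : 0 < θ')
    (hm : A * θ' + A' * θ = m * (θ + θ')) (hc₁ : 0 ≤ c₁) (hc₂ : 0 ≤ c₂) :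
    ∃ C : ℝ, 0 < C ∧ ∀ (E t : ℝ) (M : ℕ) (D : ℕ → ℝ), 0 ≤ E → 0 < t →
      (∀ n < M, D n ≤ E * (c₁ * (t ^ A * ((2 : ℝ) ^ n) ^ θ))) →
      (∀ n < M, D n ≤ E * (c₂ * (t ^ A' * ((2 : ℝ) ^ n) ^ (-θ')))) →
      ∑ n ∈ Finset.range M, D n ≤ C * E * t ^ m := by
  obtain ⟨C, hC, h⟩ := sum_le_of_two_lines hθ hθ' hm
  refine ⟨C * (c₁ + c₂ + 1), by positivity, fun E t M D hE ht h1 h2 => ?_⟩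
  calc _ ≤ C * (E * (c₁ + c₂ + 1) * t ^ m) := by
        apply h _ t M D (by positivity) ht
        · intro n hn
          refine (h1 n hn).trans ?_
          rw [mul_assoc]
          gcongr
          linarith
        · intro n hn
          refine (h2 n hn).trans ?_
          rw [mul_assoc]
          gcongr
          linarith
    _ = _ := by ring

open Classical in
/-- `1` in the cases in which a whole range of levels contributes equally, else `0`. -/
def levelPower (p π ν s τ : ℝ) : ℝ :=
  if (p - π) * deltaP p τ ≤ 0 then if deltaP p τ = 0 then 1 else 0
  else if deltaS p π ν s τ = 0 then 1 else 0

theorem deltaP_add (p π τ : ℝ) : deltaP p τ + (p - π) * (τ + 1 / 2) = deltaP π τ := by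
  unfold deltaP; ring

set_option maxHeartbeats 1000000 in
/-- The sum over all levels of the truncated sums. -/
theorem sum_truncSum_le {τ p π s ν M₀ : ℝ} (hτ : -(1 / 2) < τ) (hν : -(1 / 2) < ν) (hp : 1 < p)
    (hπ : 1 ≤ π) (hs : smoothnessThreshold p π τ < s) (hM : 0 ≤ M₀) :
    ∃ C : ℝ, 0 < C ∧ ∀ (t : ℝ) (M : ℕ) (S : ℕ → Finset ℕ) (y : ℕ → ℕ → ℝ), 0 < t → t < 1 →
      (∀ n < M, ∀ k ∈ S n, 1 ≤ k ∧ (k : ℝ) ≤ 2 ^ n) → (∀ n k, 0 ≤ y n k) →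
      (∀ n < M, ∑ k ∈ S n, y n k ^ π * nodeScale τ (2 ^ n) k ^ (π - 2) ≤
        M₀ * ((2 : ℝ) ^ n) ^ (-(s * π))) →
      ∑ n ∈ Finset.range M, truncSum τ p (2 ^ n) (t * (2 ^ n) ^ ν) (S n) (y n) ≤
        C * ((M : ℝ) + 1) ^ levelPower p π ν s τ *
          t ^ (p * min (rate₀ ν s) (rate₁ p π ν s τ)) := by
  have hp0 : 0 < p := by linarith
  have hπ0 : 0 < π := by linarith
  unfold smoothnessThreshold at hs
  have hs1 : 1 / 2 - 2 * (τ + 1) * (1 / 2 - 1 / π) < s :=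
    ((le_max_left _ _).trans (le_max_left _ _)).trans_lt hs
  have hs2 : 2 * (τ + 1) * (1 / π - 1 / p) < s :=
    ((le_max_right _ _).trans (le_max_left _ _)).trans_lt hs
  have hs0 : 0 < s := (le_max_right _ _).trans_lt hs
  have hd0 : 0 < s + ν + 1 / 2 := by linarith
  have hd1 : 0 < s + ν + 2 * (1 + τ) * (1 / 2 - 1 / π) := by linarith
  have hr0 : rate₀ ν s * (s + ν + 1 / 2) = s := by
    unfold rate₀; rw [div_mul_cancel₀]; linarith
  have hr1 : rate₁ p π ν s τ * (s + ν + 2 * (1 + τ) * (1 / 2 - 1 / π)) =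
      s - 2 * (1 + τ) * (1 / π - 1 / p) := by
    unfold rate₁; rw [div_mul_cancel₀ _ hd1.ne']
  have fin0 : ∀ {C L t : ℝ}, 0 ≤ C * L → 0 < t → t < 1 → C * L * t ^ (p * rate₀ ν s) ≤
      C * L * t ^ (p * min (rate₀ ν s) (rate₁ p π ν s τ)) := by
    intro C L t hC ht ht1
    apply mul_le_mul_of_nonneg_left _ hC
    apply Real.rpow_le_rpow_of_exponent_ge ht ht1.le
    exact mul_le_mul_of_nonneg_left (min_le_left _ _) hp0.le
  have fin1 : ∀ {C L t : ℝ}, 0 ≤ C * L → 0 < t → t < 1 → C * L * t ^ (p * rate₁ p π ν s τ) ≤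
      C * L * t ^ (p * min (rate₀ ν s) (rate₁ p π ν s τ)) := by
    intro C L t hC ht ht1
    apply mul_le_mul_of_nonneg_left _ hC
    apply Real.rpow_le_rpow_of_exponent_ge ht ht1.le
    exact mul_le_mul_of_nonneg_left (min_le_right _ _) hp0.le
  have hN : ∀ n : ℕ, (0 : ℝ) < 2 ^ n := fun n => by positivity
  have hc2 : (0 : ℝ) ≤ (max 1 (2 * (τ + 1))⁻¹) ^ (1 - p / π) * M₀ ^ (p / π) := by positivity
  have hbias_gt : p < π → ∀ (t : ℝ) (n : ℕ) (S : Finset ℕ) (y : ℕ → ℝ), 0 < t →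
      (∀ k ∈ S, 1 ≤ k ∧ (k : ℝ) ≤ 2 ^ n) → (∀ k, 0 ≤ y k) →
      (∑ k ∈ S, y k ^ π * nodeScale τ (2 ^ n) k ^ (π - 2) ≤ M₀ * ((2 : ℝ) ^ n) ^ (-(s * π))) →
      truncSum τ p (2 ^ n) (t * (2 ^ n) ^ ν) S y ≤
        (max 1 (2 * (τ + 1))⁻¹) ^ (1 - p / π) * M₀ ^ (p / π) *
          (t ^ (0 : ℝ) * ((2 : ℝ) ^ n) ^ (-(p * s))) := fun h t n S y ht hS hy hB => by
    rw [Real.rpow_zero, one_mul]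
    exact (truncSum_le_sum hp0.le (hN n) (by positivity) hy fun k hk => (hS k hk).1).trans
      (sum_le_bias_of_gt hτ hp0 h (hN n) hM hy hS hB)
  have hbias_le : π ≤ p → ∀ (t : ℝ) (n : ℕ) (S : Finset ℕ) (y : ℕ → ℝ), 0 < t →
      (∀ k ∈ S, 1 ≤ k ∧ (k : ℝ) ≤ 2 ^ n) → (∀ k, 0 ≤ y k) →
      (∑ k ∈ S, y k ^ π * nodeScale τ (2 ^ n) k ^ (π - 2) ≤ M₀ * ((2 : ℝ) ^ n) ^ (-(s * π))) →
      truncSum τ p (2 ^ n) (t * (2 ^ n) ^ ν) S y ≤ M₀ ^ (p / π) *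
        (t ^ (0 : ℝ) * ((2 : ℝ) ^ n) ^ (-(p * (s - 2 * (1 + τ) * (1 / π - 1 / p))))) :=
    fun h t n S y ht hS hy hB => by
    rw [Real.rpow_zero, one_mul]
    exact (truncSum_le_sum hp0.le (hN n) (by positivity) hy fun k hk => (hS k hk).1).trans
      (sum_le_bias_of_le hτ hπ0 h (hN n) hM hy (fun k hk => (hS k hk).1) hB)
  have h2Δ : 0 < s - 2 * (1 + τ) * (1 / π - 1 / p) := by linarith
  -- In this case the noise line and the bias line cross at the required height. In the other case
  -- the middle line is needed, and the sign of its slope decides which of the two it is paired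
  -- with.
  by_cases hc : (p - π) * deltaP p τ ≤ 0
  · rcases lt_trichotomy (deltaP p τ) 0 with hδ | hδ | hδ
    · have hpπ : π ≤ p := by
        by_contra! h
        have := mul_pos_of_neg_of_neg (sub_neg.2 h) hδ
        linarith
      have hp2 : 0 < (p - 2) * (τ + 1) := by
        have : 0 < (p - 2) * (τ + 1 / 2) := by unfold deltaP at hδ; linarith
        have h2 : 0 < p - 2 := pos_of_mul_pos_left this (by linarith)
        exact mul_pos h2 (by linarith)
      have hpν : 0 < p * ν + (p - 2) * (τ + 1) := by
        have : 1 < (p - 2) * (τ + 1 / 2) := by unfold deltaP at hδ; linarith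
        nlinarith
      obtain ⟨C, hC, h⟩ := sum_le_of_two_lines' (A := p) (A' := 0) (m := p * rate₁ p π ν s τ)
        (c₁ := 1 + (-deltaP p τ)⁻¹) (c₂ := M₀ ^ (p / π)) hpν
        (mul_pos hp0 h2Δ) (by
          have e : p * ν + (p - 2) * (τ + 1) + p * (s - 2 * (1 + τ) * (1 / π - 1 / p)) =
              p * (s + ν + 2 * (1 + τ) * (1 / 2 - 1 / π)) := by field_simp; ring
          rw [e, show p * rate₁ p π ν s τ * (p * (s + ν + 2 * (1 + τ) * (1 / 2 - 1 / π))) =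
            p * p * (rate₁ p π ν s τ * (s + ν + 2 * (1 + τ) * (1 / 2 - 1 / π))) by ring, hr1]
          ring)
        (by have : 0 < (-deltaP p τ)⁻¹ := inv_pos.2 (by linarith)
            linarith) (by positivity)
      refine ⟨C, hC, fun t M S y ht ht1 hS hy hB => ?_⟩
      have hlp : levelPower p π ν s τ = 0 := by
        rw [levelPower, if_pos hc, if_neg hδ.ne]
      rw [hlp, Real.rpow_zero]
      refine (h 1 t M _ zero_le_one ht (fun n hn => ?_) (fun n hn => ?_)).trans
        (fin1 (by positivity) ht ht1)
      · rw [one_mul]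
        exact truncSum_le_noise_of_neg hp0.le (hN n) ht (hy n) (fun k hk => (hS n hn k hk).1) hδ
      · rw [one_mul]
        exact hbias_le hpπ t n _ _ ht (hS n hn) (hy n) (hB n hn)
    -- At `δ_p = 0` the noise slopes `p(ν + 1/2)` and `pν + (p - 2)(τ + 1)` coincide. The factor `1
    -- + n ≤ M + 1` goes into `E`.
    · have hT : (p - 2) * (τ + 1) = p / 2 := by unfold deltaP at hδ; linarith
      have hlp : levelPower p π ν s τ = 1 := by
        rw [levelPower, if_pos hc, if_pos hδ]
      rcases le_or_gt π p with hpπ | hpπ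
      · obtain ⟨C, hC, h⟩ := sum_le_of_two_lines' (A := p) (A' := 0) (m := p * rate₁ p π ν s τ)
          (c₁ := 1) (c₂ := M₀ ^ (p / π)) (mul_pos hp0 (by linarith : 0 < ν + 1 / 2))
          (mul_pos hp0 h2Δ) (by
            have e : p * (ν + 1 / 2) + p * (s - 2 * (1 + τ) * (1 / π - 1 / p)) =
                p * (s + ν + 2 * (1 + τ) * (1 / 2 - 1 / π)) := by
              have e0 : p * (ν + 1 / 2) = p * ν + (p - 2) * (τ + 1) := by rw [hT]; ring
              rw [e0]; field_simp; ring
            rw [e, show p * rate₁ p π ν s τ * (p * (s + ν + 2 * (1 + τ) * (1 / 2 - 1 / π))) =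
              p * p * (rate₁ p π ν s τ * (s + ν + 2 * (1 + τ) * (1 / 2 - 1 / π))) by ring, hr1]
            ring) zero_le_one (by positivity)
        refine ⟨C, hC, fun t M S y ht ht1 hS hy hB => ?_⟩
        rw [hlp, Real.rpow_one]
        refine (h ((M : ℝ) + 1) t M _ (by positivity) ht (fun n hn => ?_) (fun n hn => ?_)).trans
          (fin1 (by positivity) ht ht1)
        · refine (truncSum_le_noise_of_eq hp0.le ht (hy n) (hS n hn) hδ).trans ?_
          rw [one_mul]
          have : (n : ℝ) ≤ M := by exact_mod_cast hn.le
          gcongr ?_ * _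
          linarith
        · refine (hbias_le hpπ t n _ _ ht (hS n hn) (hy n) (hB n hn)).trans ?_
          apply le_mul_of_one_le_left (by positivity)
          linarith [M.cast_nonneg (α := ℝ)]
      · obtain ⟨C, hC, h⟩ := sum_le_of_two_lines' (A := p) (A' := 0) (m := p * rate₀ ν s)
          (c₁ := 1) (c₂ := (max 1 (2 * (τ + 1))⁻¹) ^ (1 - p / π) * M₀ ^ (p / π))
          (mul_pos hp0 (by linarith : 0 < ν + 1 / 2)) (mul_pos hp0 hs0) (by
            rw [show p * rate₀ ν s * (p * (ν + 1 / 2) + p * s) =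
              p * p * (rate₀ ν s * (s + ν + 1 / 2)) by ring, hr0]
            ring) zero_le_one (by positivity)
        refine ⟨C, hC, fun t M S y ht ht1 hS hy hB => ?_⟩
        rw [hlp, Real.rpow_one]
        refine (h ((M : ℝ) + 1) t M _ (by positivity) ht (fun n hn => ?_) (fun n hn => ?_)).trans
          (fin0 (by positivity) ht ht1)
        · refine (truncSum_le_noise_of_eq hp0.le ht (hy n) (hS n hn) hδ).trans ?_
          rw [one_mul]
          have : (n : ℝ) ≤ M := by exact_mod_cast hn.le
          gcongr ?_ * _
          linarith
        · refine (hbias_gt hpπ t n _ _ ht (hS n hn) (hy n) (hB n hn)).trans ?_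
          apply le_mul_of_one_le_left (by positivity)
          linarith [M.cast_nonneg (α := ℝ)]
    · have hpπ : p ≤ π := by
        by_contra! h
        have := mul_pos (sub_pos.2 h) hδ
        linarith
      have hlp : levelPower p π ν s τ = 0 := by
        rw [levelPower, if_pos hc, if_neg hδ.ne']
      have hbias : ∃ c : ℝ, 0 ≤ c ∧ ∀ (t : ℝ) (n : ℕ) (S : Finset ℕ) (y : ℕ → ℝ), 0 < t →
          (∀ k ∈ S, 1 ≤ k ∧ (k : ℝ) ≤ 2 ^ n) → (∀ k, 0 ≤ y k) →
          (∑ k ∈ S, y k ^ π * nodeScale τ (2 ^ n) k ^ (π - 2) ≤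
            M₀ * ((2 : ℝ) ^ n) ^ (-(s * π))) →
          truncSum τ p (2 ^ n) (t * (2 ^ n) ^ ν) S y ≤
            c * (t ^ (0 : ℝ) * ((2 : ℝ) ^ n) ^ (-(p * s))) := by
        rcases hpπ.lt_or_eq with h | h
        · exact ⟨_, hc2, hbias_gt h⟩
        · refine ⟨M₀ ^ (p / π), by positivity, fun t n S y ht hS hy hB => ?_⟩
          have := hbias_le h.ge t n S y ht hS hy hB
          rwa [show 1 / π - 1 / p = 0 by rw [h, sub_self], mul_zero, sub_zero] at this
      obtain ⟨c, hc0, hbias⟩ := hbias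
      obtain ⟨C, hC, h⟩ := sum_le_of_two_lines' (A := p) (A' := 0) (m := p * rate₀ ν s)
        (c₁ := max 1 (deltaP p τ)⁻¹) (c₂ := c)
        (mul_pos hp0 (by linarith : 0 < ν + 1 / 2)) (mul_pos hp0 hs0) (by
          rw [show p * rate₀ ν s * (p * (ν + 1 / 2) + p * s) =
            p * p * (rate₀ ν s * (s + ν + 1 / 2)) by ring, hr0]
          ring) (by positivity) hc0
      refine ⟨C, hC, fun t M S y ht ht1 hS hy hB => ?_⟩
      rw [hlp, Real.rpow_zero]
      refine (h 1 t M _ zero_le_one ht (fun n hn => ?_) (fun n hn => ?_)).trans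
        (fin0 (by positivity) ht ht1)
      · rw [one_mul]
        exact truncSum_le_noise_of_pos hp0.le (hN n) ht (hy n) (hS n hn) hδ
      · rw [one_mul]
        exact hbias t n _ _ ht (hS n hn) (hy n) (hB n hn)
  · push Not at hc
    have hadd := deltaP_add p π τ
    have hH : 0 < τ + 1 / 2 := by linarith
    have hT : 0 < τ + 1 := by linarith
    have hδπ : deltaP π τ ≠ 0 := by
      rcases pos_and_pos_or_neg_and_neg_of_mul_pos hc with ⟨h1, h2⟩ | ⟨h1, h2⟩
      · have := mul_pos h1 hH; linarith
      · have := mul_neg_of_neg_of_pos h1 hH; linarith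
    -- The middle line is `t^{p-v} N^{-w}`. The four identities below are the crossing conditions
    -- for its pairs with a noise or a bias line; the index tells whether the height is given by
    -- `rate₀` or `rate₁`.
    obtain ⟨w, hw⟩ : ∃ w, w = π * deltaS p π ν s τ / deltaP π τ := ⟨_, rfl⟩
    obtain ⟨v, hv⟩ : ∃ v, v = π * deltaP p τ / deltaP π τ := ⟨_, rfl⟩
    have hw' : w * deltaP π τ = π * deltaS p π ν s τ := by rw [hw, div_mul_cancel₀ _ hδπ]
    have hv' : v * deltaP π τ = π * deltaP p τ := by rw [hv, div_mul_cancel₀ _ hδπ]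
    have noise_mid₀ : p * w + (p - v) * (p * (ν + 1 / 2)) =
        p * rate₀ ν s * (p * (ν + 1 / 2) + w) := by
      have hQ : deltaP π τ * (p * (ν + 1 / 2)) + π * deltaS p π ν s τ =
          π * deltaP p τ * (s + ν + 1 / 2) := by
        simp only [deltaP, deltaS]; field_simp; ring
      apply mul_left_cancel₀ hδπ
      linear_combination p * hw' - p * (ν + 1 / 2) * hv' - p * rate₀ ν s * hw' +
        (p - p * rate₀ ν s) * hQ - p * (π * deltaP p τ) * hr0
    have mid_bias₁ : (p - v) * (p * (s - 2 * (1 + τ) * (1 / π - 1 / p))) + 0 * -w =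
        p * rate₁ p π ν s τ * (-w + p * (s - 2 * (1 + τ) * (1 / π - 1 / p))) := by
      have hQ : p * (s - 2 * (1 + τ) * (1 / π - 1 / p)) * deltaP π τ - π * deltaS p π ν s τ =
          (s + ν + 2 * (1 + τ) * (1 / 2 - 1 / π)) * (p * deltaP π τ - π * deltaP p τ) := by
        simp only [deltaP, deltaS]; field_simp; ring
      apply mul_left_cancel₀ hδπ
      rw [← hr1] at hQ ⊢
      linear_combination p * rate₁ p π ν s τ * hw' - p * rate₁ p π ν s τ * hQ -
        p * (rate₁ p π ν s τ * (s + ν + 2 * (1 + τ) * (1 / 2 - 1 / π))) * hv'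
    have mid_bias₀ : (p - v) * (p * s) + 0 * -w = p * rate₀ ν s * (-w + p * s) := by
      have hQ : p * s * deltaP π τ - π * deltaS p π ν s τ =
          (s + ν + 1 / 2) * (p * deltaP π τ - π * deltaP p τ) := by
        simp only [deltaP, deltaS]; field_simp; ring
      apply mul_left_cancel₀ hδπ
      linear_combination p * rate₀ ν s * hw' - p * rate₀ ν s * hQ - p * s * hv' -
        p * (p * deltaP π τ - π * deltaP p τ) * hr0
    have noise_mid₁ : p * w + (p - v) * (p * ν + (p - 2) * (τ + 1)) =
        p * rate₁ p π ν s τ * (p * ν + (p - 2) * (τ + 1) + w) := by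
      have hQ : (p * ν + (p - 2) * (τ + 1)) * deltaP π τ + π * deltaS p π ν s τ =
          (s + ν + 2 * (1 + τ) * (1 / 2 - 1 / π)) * (π * deltaP p τ) := by
        simp only [deltaP, deltaS]; field_simp; ring
      have hR : p * (s + ν + 2 * (1 + τ) * (1 / 2 - 1 / π)) - (p * ν + (p - 2) * (τ + 1)) =
          p * (s - 2 * (1 + τ) * (1 / π - 1 / p)) := by field_simp; ring
      apply mul_left_cancel₀ hδπ
      linear_combination p * hw' - (p * ν + (p - 2) * (τ + 1)) * hv' -
        p * rate₁ p π ν s τ * hw' + (p - p * rate₁ p π ν s τ) * hQ + π * deltaP p τ * hR -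
        p * (π * deltaP p τ) * hr1
    -- if the middle line is flat, every level contributes the same amount
    have flat : deltaS p π ν s τ = 0 → ∀ c : ℝ, 0 ≤ c → (∀ (t : ℝ) (n : ℕ) (S : Finset ℕ)
        (y : ℕ → ℝ), 0 < t → (∀ k ∈ S, 1 ≤ k ∧ (k : ℝ) ≤ 2 ^ n) → (∀ k, 0 ≤ y k) →
        (∑ k ∈ S, y k ^ π * nodeScale τ (2 ^ n) k ^ (π - 2) ≤ M₀ * ((2 : ℝ) ^ n) ^ (-(s * π))) →
        truncSum τ p (2 ^ n) (t * (2 ^ n) ^ ν) S y ≤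
          c * (t ^ (p - v) * ((2 : ℝ) ^ n) ^ (-w))) →
        ∀ (t : ℝ) (M : ℕ) (S : ℕ → Finset ℕ) (y : ℕ → ℕ → ℝ), 0 < t → t < 1 →
        (∀ n < M, ∀ k ∈ S n, 1 ≤ k ∧ (k : ℝ) ≤ 2 ^ n) → (∀ n k, 0 ≤ y n k) →
        (∀ n < M, ∑ k ∈ S n, y n k ^ π * nodeScale τ (2 ^ n) k ^ (π - 2) ≤
          M₀ * ((2 : ℝ) ^ n) ^ (-(s * π))) →
        ∑ n ∈ Finset.range M, truncSum τ p (2 ^ n) (t * (2 ^ n) ^ ν) (S n) (y n) ≤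
          (c + 1) * ((M : ℝ) + 1) ^ levelPower p π ν s τ *
            t ^ (p * min (rate₀ ν s) (rate₁ p π ν s τ)) := by
      intro hδs c hc0 hmid t M S y ht ht1 hS hy hB
      have hw0 : w = 0 := by rw [hw, hδs]; simp
      have hlp : levelPower p π ν s τ = 1 := by
        rw [levelPower, if_neg (not_le.2 hc), if_pos hδs]
      -- For `w = 0` the crossing condition with the noise line fixes the height of the flat line.
      have hpv : p - v = p * rate₀ ν s := by
        rw [hw0] at noise_mid₀
        have h0 : p * (ν + 1 / 2) ≠ 0 := (mul_pos hp0 (by linarith)).ne'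
        apply mul_right_cancel₀ h0
        linarith
      rw [hlp, Real.rpow_one]
      refine le_trans ?_ (fin0 (by positivity) ht ht1)
      calc _ ≤ ∑ n ∈ Finset.range M, c * t ^ (p * rate₀ ν s) := by
            apply Finset.sum_le_sum
            intro n hn
            have hn := Finset.mem_range.1 hn
            have := hmid t n _ _ ht (hS n hn) (hy n) (hB n hn)
            rwa [hw0, neg_zero, Real.rpow_zero, mul_one, hpv] at this
        _ = c * M * t ^ (p * rate₀ ν s) := by
            rw [Finset.sum_const, Finset.card_range, nsmul_eq_mul]; ring
        _ ≤ _ := by gcongr <;> linarith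
    have hlp : deltaS p π ν s τ ≠ 0 → levelPower p π ν s τ = 0 := fun h => by
      rw [levelPower, if_neg (not_le.2 hc), if_neg h]
    rcases pos_and_pos_or_neg_and_neg_of_mul_pos hc with ⟨h1, hδ⟩ | ⟨h1, hδ⟩
    · have hπp : π < p := by linarith
      have hD : 0 < deltaP π τ := by have := mul_pos h1 hH; linarith
      have hc1 : (0 : ℝ) ≤ max 1 (deltaP p τ)⁻¹ := by positivity
      have hmid : ∀ (t : ℝ) (n : ℕ) (S : Finset ℕ) (y : ℕ → ℝ), 0 < t →
          (∀ k ∈ S, 1 ≤ k ∧ (k : ℝ) ≤ 2 ^ n) → (∀ k, 0 ≤ y k) →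
          (∑ k ∈ S, y k ^ π * nodeScale τ (2 ^ n) k ^ (π - 2) ≤
            M₀ * ((2 : ℝ) ^ n) ^ (-(s * π))) →
          truncSum τ p (2 ^ n) (t * (2 ^ n) ^ ν) S y ≤
            (max 1 (deltaP p τ)⁻¹ + M₀) * (t ^ (p - v) * ((2 : ℝ) ^ n) ^ (-w)) :=
        fun t n S y ht hS hy hB => by
          rw [hv, hw]
          exact truncSum_le_middle_of_lt hτ hπ0 hπp hδ hδπ (hN n) ht hy
            (fun k hk => (hS k hk).1) hB
      -- Here `δ_π > 0`, so the slope `-w` has the sign of `-δ_s`: a rising middle line is paired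
      -- with the bias line, a falling one with the noise line.
      rcases lt_trichotomy (deltaS p π ν s τ) 0 with hδs | hδs | hδs
      · have hw0 : 0 < -w := by
          rw [hw, neg_pos]; exact div_neg_of_neg_of_pos (mul_neg_of_pos_of_neg hπ0 hδs) hD
        obtain ⟨C, hC, h⟩ := sum_le_of_two_lines' hw0 (mul_pos hp0 h2Δ) mid_bias₁
          (c₁ := max 1 (deltaP p τ)⁻¹ + M₀) (c₂ := M₀ ^ (p / π)) (by positivity) (by positivity)
        refine ⟨C, hC, fun t M S y ht ht1 hS hy hB => ?_⟩
        rw [hlp hδs.ne, Real.rpow_zero]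
        refine (h 1 t M _ zero_le_one ht (fun n hn => ?_) (fun n hn => ?_)).trans
          (fin1 (by positivity) ht ht1)
        · rw [one_mul]; exact hmid t n _ _ ht (hS n hn) (hy n) (hB n hn)
        · rw [one_mul]; exact hbias_le hπp.le t n _ _ ht (hS n hn) (hy n) (hB n hn)
      · exact ⟨_, by positivity, flat hδs _ (by positivity) hmid⟩
      · have hw0 : 0 < w := by rw [hw]; positivity
        obtain ⟨C, hC, h⟩ := sum_le_of_two_lines'
          (mul_pos hp0 (by linarith : 0 < ν + 1 / 2)) hw0 noise_mid₀
          (c₁ := max 1 (deltaP p τ)⁻¹) (c₂ := max 1 (deltaP p τ)⁻¹ + M₀) hc1 (by positivity)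
        refine ⟨C, hC, fun t M S y ht ht1 hS hy hB => ?_⟩
        rw [hlp hδs.ne', Real.rpow_zero]
        refine (h 1 t M _ zero_le_one ht (fun n hn => ?_) (fun n hn => ?_)).trans
          (fin0 (by positivity) ht ht1)
        · rw [one_mul]
          exact truncSum_le_noise_of_pos hp0.le (hN n) ht (hy n) (hS n hn) hδ
        · rw [one_mul]; exact hmid t n _ _ ht (hS n hn) (hy n) (hB n hn)
    · have hπp : p < π := by linarith
      have hD : deltaP π τ < 0 := by have := mul_neg_of_neg_of_pos h1 hH; linarith
      have hδ' : 0 < (-deltaP p τ)⁻¹ := inv_pos.2 (by linarith)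
      have hc3 : (0 : ℝ) ≤ (max 1 (2 * (τ + 1))⁻¹) ^ (1 - p / π) * M₀ ^ (p / π) +
          (1 + (-deltaP p τ)⁻¹) := by positivity
      have hmid : ∀ (t : ℝ) (n : ℕ) (S : Finset ℕ) (y : ℕ → ℝ), 0 < t →
          (∀ k ∈ S, 1 ≤ k ∧ (k : ℝ) ≤ 2 ^ n) → (∀ k, 0 ≤ y k) →
          (∑ k ∈ S, y k ^ π * nodeScale τ (2 ^ n) k ^ (π - 2) ≤
            M₀ * ((2 : ℝ) ^ n) ^ (-(s * π))) →
          truncSum τ p (2 ^ n) (t * (2 ^ n) ^ ν) S y ≤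
            ((max 1 (2 * (τ + 1))⁻¹) ^ (1 - p / π) * M₀ ^ (p / π) + (1 + (-deltaP p τ)⁻¹)) *
              (t ^ (p - v) * ((2 : ℝ) ^ n) ^ (-w)) :=
        fun t n S y ht hS hy hB => by
          rw [hv, hw]
          exact truncSum_le_middle_of_gt hτ hp0 hπp hδ hδπ (hN n) ht hM hy
            (fun k hk => (hS k hk).1) hB
      have hp2 : 0 < (p - 2) * (τ + 1) := by
        have : 0 < (p - 2) * (τ + 1 / 2) := by unfold deltaP at hδ; linarith
        exact mul_pos (pos_of_mul_pos_left this hH.le) hT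
      have hpν : 0 < p * ν + (p - 2) * (τ + 1) := by
        have : 1 < (p - 2) * (τ + 1 / 2) := by unfold deltaP at hδ; linarith
        nlinarith
      -- Now `δ_π < 0`, so the slope `-w` has the sign of `δ_s` and the pairings are exchanged.
      rcases lt_trichotomy (deltaS p π ν s τ) 0 with hδs | hδs | hδs
      · have hw0 : 0 < w := by
          rw [hw]; exact div_pos_of_neg_of_neg (mul_neg_of_pos_of_neg hπ0 hδs) hD
        obtain ⟨C, hC, h⟩ := sum_le_of_two_lines' hpν hw0 noise_mid₁
          (c₁ := 1 + (-deltaP p τ)⁻¹) (by positivity) hc3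
        refine ⟨C, hC, fun t M S y ht ht1 hS hy hB => ?_⟩
        rw [hlp hδs.ne, Real.rpow_zero]
        refine (h 1 t M _ zero_le_one ht (fun n hn => ?_) (fun n hn => ?_)).trans
          (fin1 (by positivity) ht ht1)
        · rw [one_mul]
          exact truncSum_le_noise_of_neg hp0.le (hN n) ht (hy n) (fun k hk => (hS n hn k hk).1) hδ
        · rw [one_mul]; exact hmid t n _ _ ht (hS n hn) (hy n) (hB n hn)
      · exact ⟨_, by positivity, flat hδs _ hc3 hmid⟩
      · have hw0 : 0 < -w := by
          rw [hw, neg_pos]; exact div_neg_of_pos_of_neg (mul_pos hπ0 hδs) hD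
        obtain ⟨C, hC, h⟩ := sum_le_of_two_lines' hw0 (mul_pos hp0 hs0) mid_bias₀ hc3 hc2
        refine ⟨C, hC, fun t M S y ht ht1 hS hy hB => ?_⟩
        rw [hlp hδs.ne', Real.rpow_zero]
        refine (h 1 t M _ zero_le_one ht (fun n hn => ?_) (fun n hn => ?_)).trans
          (fin0 (by positivity) ht ht1)
        · rw [one_mul]; exact hmid t n _ _ ht (hS n hn) (hy n) (hB n hn)
        · rw [one_mul]; exact hbias_gt hπp t n _ _ ht (hS n hn) (hy n) (hB n hn)

/-! ### Gaussian tails -/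

theorem integrable_one_add_pow_mul_exp {b : ℝ} (hb : 0 < b) (m : ℕ) :
    Integrable fun x : ℝ => (1 + x ^ (2 * m)) * Real.exp (-b * x ^ 2) := by
  have h1 := integrable_exp_neg_mul_sq hb
  have h2 := integrable_rpow_mul_exp_neg_mul_sq hb (s := ((2 * m : ℕ) : ℝ))
    (by have : (0 : ℝ) ≤ ((2 * m : ℕ) : ℝ) := Nat.cast_nonneg _
        linarith)
  simp only [Real.rpow_natCast] at h2
  refine (h1.add h2).congr (Filter.Eventually.of_forall fun x => ?_)
  simp only [Pi.add_apply]
  ring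

/-- Split `exp(-x²/2) = exp(-(1-δ)x²/2) exp(-δx²/2)`. On `|x| > l` the first factor is at most
`exp(-(1-δ)l²/2)`, and the second makes `|x|^p ≤ 1 + x^{2m}` integrable. Giving up `δ` in the
exponent avoids a power of `l` in the bound. -/
theorem lintegral_tail_gaussianReal_le {p δ : ℝ} (hp : 0 ≤ p) (hδ : 0 < δ) (hδ1 : δ < 1) :
    ∃ C : ℝ, 0 < C ∧ ∀ l : ℝ, 0 ≤ l →
      ∫⁻ x, ENNReal.ofReal (if l < |x| then |x| ^ p else 0) ∂(gaussianReal 0 1) ≤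
        ENNReal.ofReal (C * Real.exp (-(1 - δ) * l ^ 2 / 2)) := by
  obtain ⟨m, hm⟩ := exists_nat_ge p
  have hint := integrable_one_add_pow_mul_exp (half_pos hδ) m
  have hg0 : ∀ x : ℝ, 0 ≤ (1 + x ^ (2 * m)) * Real.exp (-(δ / 2) * x ^ 2) := fun x => by
    have : 0 ≤ x ^ (2 * m) := by rw [pow_mul]; positivity
    positivity
  refine ⟨(√(2 * Real.pi * (1 : NNReal)))⁻¹ *
    ((∫ x : ℝ, (1 + x ^ (2 * m)) * Real.exp (-(δ / 2) * x ^ 2)) + 1), ?_, ?_⟩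
  · have : 0 ≤ ∫ x : ℝ, (1 + x ^ (2 * m)) * Real.exp (-(δ / 2) * x ^ 2) :=
      integral_nonneg hg0
    have h2 : 0 < √(2 * Real.pi * (1 : NNReal)) := by
      apply Real.sqrt_pos.2; simp [Real.pi_pos]
    positivity
  intro l hl
  have hm1 : Measurable fun x : ℝ => ENNReal.ofReal (if l < |x| then |x| ^ p else 0) := by
    apply Measurable.ennreal_ofReal
    apply Measurable.ite (measurableSet_lt measurable_const (by fun_prop)) (by fun_prop)
      measurable_const
  rw [gaussianReal_of_var_ne_zero _ one_ne_zero,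
    lintegral_withDensity_eq_lintegral_mul _ (measurable_gaussianPDF _ _) hm1]
  set c := (√(2 * Real.pi * (1 : NNReal)))⁻¹ with hc
  have hc0 : 0 ≤ c := by positivity
  have hpt : ∀ x : ℝ, (gaussianPDF 0 1 * fun x : ℝ => ENNReal.ofReal
      (if l < |x| then |x| ^ p else 0)) x ≤
      ENNReal.ofReal (c * Real.exp (-(1 - δ) * l ^ 2 / 2) *
        ((1 + x ^ (2 * m)) * Real.exp (-(δ / 2) * x ^ 2))) := by
    intro x
    have hx0 : 0 ≤ x ^ (2 * m) := by rw [pow_mul]; positivity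
    rw [Pi.mul_apply, gaussianPDF, ← ENNReal.ofReal_mul (gaussianPDFReal_nonneg _ _ _)]
    apply ENNReal.ofReal_le_ofReal
    split_ifs with h
    · have hxp : |x| ^ p ≤ 1 + x ^ (2 * m) := by
        rcases le_total |x| 1 with h1 | h1
        · have := Real.rpow_le_one (abs_nonneg x) h1 hp
          linarith
        · have h2 : |x| ^ p ≤ |x| ^ ((2 * m : ℕ) : ℝ) := by
            apply Real.rpow_le_rpow_of_exponent_le h1
            push_cast; linarith [m.cast_nonneg (α := ℝ)]
          rw [Real.rpow_natCast, pow_mul, sq_abs, ← pow_mul] at h2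
          linarith
      have he : Real.exp (-(x - 0) ^ 2 / (2 * (1 : NNReal))) ≤
          Real.exp (-(1 - δ) * l ^ 2 / 2) * Real.exp (-(δ / 2) * x ^ 2) := by
        rw [← Real.exp_add]
        apply Real.exp_le_exp.2
        have h2 : l ^ 2 ≤ x ^ 2 := by
          rw [← sq_abs x]; exact pow_le_pow_left₀ hl h.le 2
        have h3 : (1 - δ) * l ^ 2 ≤ (1 - δ) * x ^ 2 :=
          mul_le_mul_of_nonneg_left h2 (by linarith)
        simp only [sub_zero, NNReal.coe_one, mul_one]
        linarith
      rw [gaussianPDFReal, ← hc]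
      calc c * Real.exp (-(x - 0) ^ 2 / (2 * (1 : NNReal))) * |x| ^ p
          ≤ c * (Real.exp (-(1 - δ) * l ^ 2 / 2) * Real.exp (-(δ / 2) * x ^ 2)) *
            (1 + x ^ (2 * m)) := by gcongr
        _ = _ := by ring
    · rw [mul_zero]; positivity
  calc _ ≤ ∫⁻ x : ℝ, ENNReal.ofReal (c * Real.exp (-(1 - δ) * l ^ 2 / 2) *
        ((1 + x ^ (2 * m)) * Real.exp (-(δ / 2) * x ^ 2))) := lintegral_mono hpt
    _ = ENNReal.ofReal (∫ x : ℝ, c * Real.exp (-(1 - δ) * l ^ 2 / 2) *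
        ((1 + x ^ (2 * m)) * Real.exp (-(δ / 2) * x ^ 2))) := by
        rw [ofReal_integral_eq_lintegral_ofReal (hint.const_mul _)]
        exact Filter.Eventually.of_forall fun x => mul_nonneg (by positivity) (hg0 x)
    _ ≤ _ := by
        apply ENNReal.ofReal_le_ofReal
        rw [integral_const_mul]
        have : 0 ≤ c * Real.exp (-(1 - δ) * l ^ 2 / 2) := by positivity
        linarith

/-- Scaling: `X` has the law of `√v` times a standard Gaussian variable, and `√v ≤ s`. The constant
precedes the probability space and the variable, so it serves all coefficients of all levels. -/
theorem lintegral_tail_le {p δ : ℝ} (hp : 0 ≤ p) (hδ : 0 < δ) (hδ1 : δ < 1) :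
    ∃ C : ℝ, 0 < C ∧ ∀ (Ω : Type*) [MeasurableSpace Ω] (P : Measure Ω) (X : Ω → ℝ) (v : NNReal)
      (s l : ℝ), AEMeasurable X P → P.map X = gaussianReal 0 v → 0 ≤ s → (v : ℝ) ≤ s ^ 2 → 0 ≤ l →
      ∫⁻ ω, ENNReal.ofReal (if s * l < |X ω| then |X ω| ^ p else 0) ∂P ≤
        ENNReal.ofReal (C * s ^ p * Real.exp (-(1 - δ) * l ^ 2 / 2)) := by
  obtain ⟨C, hC, h⟩ := lintegral_tail_gaussianReal_le hp hδ hδ1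
  refine ⟨C, hC, fun Ω _ P X v s l hXm hX hs hv hl => ?_⟩
  have hm1 : Measurable fun x : ℝ => ENNReal.ofReal (if s * l < |x| then |x| ^ p else 0) := by
    apply Measurable.ennreal_ofReal
    apply Measurable.ite (measurableSet_lt measurable_const (by fun_prop)) (by fun_prop)
      measurable_const
  have hv' : gaussianReal 0 v = (gaussianReal 0 1).map (√(v : ℝ) * ·) := by
    rw [gaussianReal_map_const_mul, mul_zero, mul_one]
    congr 1
    ext
    simp
  have hsv : √(v : ℝ) ≤ s := Real.sqrt_le_iff.2 ⟨hs, hv⟩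
  calc ∫⁻ ω, ENNReal.ofReal (if s * l < |X ω| then |X ω| ^ p else 0) ∂P
      = ∫⁻ x, ENNReal.ofReal (if s * l < |x| then |x| ^ p else 0) ∂(P.map X) := by
        rw [lintegral_map' hm1.aemeasurable hXm]
    _ = ∫⁻ x, ENNReal.ofReal (if s * l < |√(v : ℝ) * x| then |√(v : ℝ) * x| ^ p else 0)
        ∂(gaussianReal 0 1) := by
        rw [hX, hv', lintegral_map hm1 (by fun_prop)]
    _ ≤ ∫⁻ x, ENNReal.ofReal (s ^ p) * ENNReal.ofReal (if l < |x| then |x| ^ p else 0)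
        ∂(gaussianReal 0 1) := by
        apply lintegral_mono
        intro x
        dsimp only
        rw [← ENNReal.ofReal_mul (by positivity)]
        apply ENNReal.ofReal_le_ofReal
        have hx : |√(v : ℝ) * x| ≤ s * |x| := by
          rw [abs_mul, abs_of_nonneg (Real.sqrt_nonneg _)]
          gcongr
        split_ifs with h1 h2 h2
        · calc |√(v : ℝ) * x| ^ p ≤ (s * |x|) ^ p := by gcongr
            _ = _ := Real.mul_rpow hs (abs_nonneg _)
        · exfalso
          have h3 : s * l < s * |x| := h1.trans_le hx
          have h4 := mul_le_mul_of_nonneg_left (not_lt.1 h2) hs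
          linarith
        · positivity
        · simp
    _ = ENNReal.ofReal (s ^ p) *
        ∫⁻ x, ENNReal.ofReal (if l < |x| then |x| ^ p else 0) ∂(gaussianReal 0 1) := by
        rw [lintegral_const_mul' _ _ ENNReal.ofReal_ne_top]
    _ ≤ ENNReal.ofReal (s ^ p) * ENNReal.ofReal (C * Real.exp (-(1 - δ) * l ^ 2 / 2)) := by
        gcongr
        exact h l hl
    _ = _ := by
        rw [← ENNReal.ofReal_mul (by positivity)]
        congr 1; ring

theorem IsWhiteNoise.hasGaussianLaw_sum {G Ω : Type*} [NormedAddCommGroup G]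
    [InnerProductSpace ℝ G] [MeasurableSpace Ω] {W : G → Ω → ℝ} {P : Measure Ω}
    (hW : IsWhiteNoise W P) (g : ℕ → G) (c : ℕ → ℝ) (F : Finset ℕ) :
    HasGaussianLaw (fun ω => ∑ i ∈ F, c i * W (g i) ω) P := by
  have h := ((hW.gaussian.comp_right g).smul c).hasGaussianLaw_fun_sum (I := F)
  simpa using h

/-- A Gaussian law on the line is fixed by mean and variance; orthonormality reduces the double sum
of covariances to its diagonal. -/
theorem IsWhiteNoise.map_sum {G Ω : Type*} [NormedAddCommGroup G] [InnerProductSpace ℝ G]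
    [MeasurableSpace Ω] {W : G → Ω → ℝ} {P : Measure Ω} (hW : IsWhiteNoise W P) {g : ℕ → G}
    (hg : Orthonormal ℝ g) (c : ℕ → ℝ) (F : Finset ℕ) :
    P.map (fun ω => ∑ i ∈ F, c i * W (g i) ω) = gaussianReal 0 (∑ i ∈ F, c i ^ 2).toNNReal := by
  have hmem : ∀ i, MemLp (W (g i)) 2 P := fun i => (hW.gaussian.hasGaussianLaw_eval (g i)).memLp_two
  have := hW.gaussian.isProbabilityMeasure
  rw [(hW.hasGaussianLaw_sum g c F).map_eq_gaussianReal]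
  congr 2
  · rw [integral_finsetSum _ fun i _ =>
      ((hmem i).integrable (by norm_num)).const_mul (c i)]
    simp [integral_const_mul, hW.centered]
  · rw [← covariance_self (hW.hasGaussianLaw_sum g c F).aemeasurable]
    have := covariance_sum_sum' (μ := P) (s := F) (t := F) (X := fun i ω => c i * W (g i) ω)
      (Y := fun i ω => c i * W (g i) ω) (fun i _ => (hmem i).const_mul (c i))
      (fun i _ => (hmem i).const_mul (c i))
    have e : (fun ω => ∑ i ∈ F, c i * W (g i) ω) = ∑ i ∈ F, fun ω => c i * W (g i) ω := by
      ext ω; simp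
    rw [e, this]
    apply Finset.sum_congr rfl
    intro i hi
    rw [Finset.sum_eq_single_of_mem i hi]
    · rw [covariance_const_mul_left, covariance_const_mul_right, hW.covariance_eq,
        orthonormal_iff_ite.1 hg]
      simp; ring
    · intro j _ hji
      rw [covariance_const_mul_left, covariance_const_mul_right, hW.covariance_eq,
        orthonormal_iff_ite.1 hg, if_neg hji.symm]
      simp

/-! ### The Jacobi measure -/

theorem ae_mem_Icc_jacobiMeasure (α β : ℝ) :
    ∀ᵐ x ∂jacobiMeasure α β, x ∈ Set.Icc (-1 : ℝ) 1 :=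
  (withDensity_absolutelyContinuous _ _).ae_le (ae_restrict_mem measurableSet_Icc)

theorem jacobiWeight_nonneg {α β x : ℝ} (hx : x ∈ Set.Icc (-1 : ℝ) 1) :
    0 ≤ jacobiWeight α β x :=
  mul_nonneg (Real.rpow_nonneg (by linarith [hx.2]) _) (Real.rpow_nonneg (by linarith [hx.1]) _)

theorem NeedletSystem.ne_zero {γ : Measure ℝ} (N : NeedletSystem γ) : γ ≠ 0 := by
  rintro rfl
  have h1 := N.basis.orthonormal.1 0
  have h2 : N.basis 0 = 0 := by
    rw [Lp.eq_zero_iff_ae_eq_zero, ae_zero]; exact Filter.eventually_bot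
  rw [h2, norm_zero] at h1
  exact zero_ne_one h1

/-- Integrability of the weight is read off from `γ ≠ 0`: the integral of a non-integrable function
is `0` by convention, its inverse is `0`, and the density would vanish. A needlet system forces `γ ≠
0`, since `L²(γ)` then contains unit vectors. -/
theorem isProbabilityMeasure_jacobiMeasure {α β : ℝ} (h0 : jacobiMeasure α β ≠ 0) :
    IsProbabilityMeasure (jacobiMeasure α β) := by
  set I := ∫ y in Set.Icc (-1 : ℝ) 1, jacobiWeight α β y with hI
  have hI0 : I ≠ 0 := by
    intro h
    apply h0
    rw [jacobiMeasure, ← hI, h]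
    simp
  have hint : Integrable (jacobiWeight α β) (volume.restrict (Set.Icc (-1 : ℝ) 1)) := by
    by_contra h
    exact hI0 (integral_undef h)
  have hw : 0 ≤ᵐ[volume.restrict (Set.Icc (-1 : ℝ) 1)] jacobiWeight α β := by
    filter_upwards [ae_restrict_mem measurableSet_Icc] with x hx using jacobiWeight_nonneg hx
  have hIpos : 0 < I := lt_of_le_of_ne (integral_nonneg_of_ae hw) hI0.symm
  refine ⟨?_⟩
  rw [jacobiMeasure, ← hI, withDensity_apply _ MeasurableSet.univ, Measure.restrict_univ,
    ← ofReal_integral_eq_lintegral_ofReal (hint.const_mul _), integral_const_mul, ← hI,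
    inv_mul_cancel₀ hI0, ENNReal.ofReal_one]
  filter_upwards [hw] with x hx
  exact mul_nonneg (inv_nonneg.2 hIpos.le) hx

namespace NeedletSystem

variable {γ : Measure ℝ} (N : NeedletSystem γ)

/-! ### The Littlewood-Paley filter -/

/-- `φ_supp` leaves out the endpoint `1`, which continuity supplies. -/
theorem φ_eq_zero {ξ : ℝ} (h : 1 ≤ ξ) : N.φ ξ = 0 := by
  rcases h.eq_or_lt with rfl | h
  · have hc := N.φ_smooth.continuous
    have h1 : Filter.Tendsto N.φ (nhdsWithin 1 (Set.Ioi 1)) (nhds (N.φ 1)) :=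
      hc.continuousAt.tendsto.mono_left nhdsWithin_le_nhds
    have h2 : Filter.Tendsto N.φ (nhdsWithin 1 (Set.Ioi 1)) (nhds 0) := by
      apply tendsto_const_nhds.congr'
      filter_upwards [self_mem_nhdsWithin] with x hx
      exact (N.φ_supp x (by rw [abs_of_pos (by linarith [Set.mem_Ioi.1 hx])]; exact hx)).symm
    exact tendsto_nhds_unique h1 h2
  · exact N.φ_supp ξ (by rwa [abs_of_pos (by linarith)])

/-- The square root does not truncate: `φ(ξ/2) = 1` for `0 ≤ ξ ≤ 1` and `φ(ξ) = 0` for `ξ ≥ 1`.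
Monotonicity of `φ` is not needed. -/
theorem a_sq {ξ : ℝ} (h : 0 ≤ ξ) : N.a ξ ^ 2 = N.φ (ξ / 2) - N.φ ξ := by
  apply Real.sq_sqrt
  rcases le_total ξ 1 with h1 | h1
  · rw [N.φ_one (ξ / 2) (by rw [abs_of_nonneg (by linarith)]; linarith)]
    linarith [(N.φ_mem ξ).2]
  · rw [N.φ_eq_zero h1]; linarith [(N.φ_mem (ξ / 2)).1]

theorem a_eq_zero_of_two_le {ξ : ℝ} (h : 2 ≤ ξ) : N.a ξ = 0 := by
  rw [a, N.φ_eq_zero (by linarith), N.φ_eq_zero (by linarith)]; simp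

theorem a_zero : N.a 0 = 0 := by simp [a]

theorem a_level_eq_zero {n k : ℕ} (h : 2 ^ n ≤ k) : N.a (k / (2 : ℝ) ^ ((n : ℤ) - 1)) = 0 := by
  apply N.a_eq_zero_of_two_le
  rw [le_div_iff₀ (by positivity), zpow_sub_one₀ (by norm_num), zpow_natCast]
  have : ((2 ^ n : ℕ) : ℝ) ≤ k := by exact_mod_cast h
  push_cast at this
  linarith

theorem a_level_sq (n k : ℕ) : N.a (k / (2 : ℝ) ^ ((n : ℤ) - 1)) ^ 2 =
    N.φ (k / 2 ^ n) - N.φ (2 * k / 2 ^ n) := by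
  rw [N.a_sq (by positivity), zpow_sub_one₀ (by norm_num), zpow_natCast]
  congr 2 <;> field_simp

theorem ψ_natCast (n : ℕ) (η x : ℝ) : N.ψ n η x = Real.sqrt (N.weight n η) *
    ∑ k ∈ Finset.range (2 ^ n), N.a (k / (2 : ℝ) ^ ((n : ℤ) - 1)) * N.e k x * N.e k η := by
  rw [ψ, if_neg (by omega)]
  congr 1
  apply tsum_eq_sum
  intro k hk
  rw [N.a_level_eq_zero (by simpa using hk)]
  simp

/-- Only `k = 0` satisfies `k < 2 ^ 0`, and `a 0 = 0`. Level `0` thus contributes nothing, and it is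
harmless that the two-sided norm bounds start at level `1`. -/
theorem ψ_zero (η x : ℝ) : N.ψ 0 η x = 0 := by
  have := N.ψ_natCast 0 η x
  simpa [N.a_zero] using this

/-! ### Coefficients in the basis -/

/-- The coefficient `(f, e_k)`. -/
def basisCoeff (f : Lp ℝ 2 γ) (k : ℕ) : ℝ := ∫ x, f x * N.e k x ∂γ

theorem memLp_e (k : ℕ) : MemLp (N.e k) 2 γ := (Lp.memLp (N.basis k)).ae_eq (N.basis_ae k)

theorem inner_basis (f : Lp ℝ 2 γ) (k : ℕ) : inner ℝ f (N.basis k) = N.basisCoeff f k := by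
  rw [L2.inner_def, basisCoeff]
  apply integral_congr_ae
  filter_upwards [N.basis_ae k] with x hx
  rw [hx]; simp [mul_comm]

theorem integral_e_mul_e (k l : ℕ) : ∫ x, N.e k x * N.e l x ∂γ = if k = l then 1 else 0 := by
  rw [← orthonormal_iff_ite.1 N.basis.orthonormal k l, N.inner_basis, basisCoeff]
  apply integral_congr_ae
  filter_upwards [N.basis_ae k] with x hx
  rw [hx]

theorem integrable_e_mul_e (k l : ℕ) : Integrable (fun x => N.e k x * N.e l x) γ :=
  (N.memLp_e k).integrable_mul (N.memLp_e l)

theorem integrable_mul_e (f : Lp ℝ 2 γ) (k : ℕ) : Integrable (fun x => f x * N.e k x) γ :=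
  (Lp.memLp f).integrable_mul (N.memLp_e k)

theorem ψCoeff_of_expansion (hγ : ∀ᵐ x ∂γ, x ∈ Set.Icc (-1 : ℝ) 1) {j : ℤ} {η : ℝ} {n : ℕ}
    {c : ℕ → ℝ} (h : ∀ x ∈ Set.Icc (-1 : ℝ) 1, N.ψ j η x = ∑ i ∈ Finset.range n, c i * N.e i x)
    (i : ℕ) : N.ψCoeff j η i = if i < n then c i else 0 := by
  have h1 : N.ψCoeff j η i = ∫ x, ∑ k ∈ Finset.range n, c k * (N.e k x * N.e i x) ∂γ := by
    apply integral_congr_ae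
    filter_upwards [hγ] with x hx
    rw [h x hx, Finset.sum_mul]
    exact Finset.sum_congr rfl fun k _ => by ring
  rw [h1, integral_finsetSum _ fun k _ => (N.integrable_e_mul_e k i).const_mul _]
  simp only [integral_const_mul, integral_e_mul_e, mul_ite, mul_one, mul_zero]
  simp

theorem e_zero_sq [IsProbabilityMeasure γ] (hγ : ∀ᵐ x ∂γ, x ∈ Set.Icc (-1 : ℝ) 1) :
    ∃ c : ℝ, c ^ 2 = 1 ∧ ∀ x ∈ Set.Icc (-1 : ℝ) 1, N.e 0 x = c := by
  obtain ⟨c, hc⟩ := N.e_zero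
  refine ⟨c, ?_, hc⟩
  have h := N.integral_e_mul_e 0 0
  rw [if_pos rfl] at h
  rw [← h]
  have : ∫ x, N.e 0 x * N.e 0 x ∂γ = ∫ _, c ^ 2 ∂γ := by
    apply integral_congr_ae
    filter_upwards [hγ] with x hx
    rw [hc x hx, sq]
  rw [this]; simp

/-- Every needlet of level `j ≥ -1` is a combination of `e_i`, `i < 2^j` (`i = 0` if `j = -1`). -/
theorem ψ_expansion [IsProbabilityMeasure γ] (hγ : ∀ᵐ x ∂γ, x ∈ Set.Icc (-1 : ℝ) 1) {j : ℤ}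
    (hj : -1 ≤ j) (η : ℝ) :
    (∀ x ∈ Set.Icc (-1 : ℝ) 1,
      N.ψ j η x = ∑ i ∈ Finset.range (2 ^ j.toNat), N.ψCoeff j η i * N.e i x) ∧
    ∀ i, 2 ^ j.toNat ≤ i → N.ψCoeff j η i = 0 := by
  obtain ⟨c, hc⟩ : ∃ c : ℕ → ℝ, ∀ x ∈ Set.Icc (-1 : ℝ) 1,
      N.ψ j η x = ∑ i ∈ Finset.range (2 ^ j.toNat), c i * N.e i x := by
    -- Since `(-1).toNat = 0`, the range at level `-1` is `{0}`; there `1 = c * e_0` because `e_0 =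
    -- c` with `c ^ 2 = 1`.
    rcases hj.eq_or_lt with rfl | hj
    · obtain ⟨c, hc, he⟩ := N.e_zero_sq hγ
      refine ⟨fun _ => c, fun x hx => ?_⟩
      rw [ψ, if_pos rfl, show (-1 : ℤ).toNat = 0 from rfl, pow_zero, Finset.sum_range_one, he x hx,
        ← sq, hc]
    · obtain ⟨n, rfl⟩ := Int.eq_ofNat_of_zero_le (by omega : 0 ≤ j)
      refine ⟨fun i => Real.sqrt (N.weight n η) *
        (N.a (i / (2 : ℝ) ^ ((n : ℤ) - 1)) * N.e i η), fun x _ => ?_⟩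
      rw [N.ψ_natCast, Int.toNat_natCast, Finset.mul_sum]
      exact Finset.sum_congr rfl fun k _ => by ring
  have h := N.ψCoeff_of_expansion hγ hc
  refine ⟨fun x hx => ?_, fun i hi => ?_⟩
  · rw [hc x hx]
    exact Finset.sum_congr rfl fun i hi => by rw [h i, if_pos (Finset.mem_range.1 hi)]
  · rw [h i, if_neg (not_lt.2 hi)]

theorem ψCoeff_natCast (hγ : ∀ᵐ x ∂γ, x ∈ Set.Icc (-1 : ℝ) 1) (n : ℕ) (η : ℝ) (i : ℕ) :
    N.ψCoeff n η i =
      Real.sqrt (N.weight n η) * (N.a (i / (2 : ℝ) ^ ((n : ℤ) - 1)) * N.e i η) := by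
  rw [N.ψCoeff_of_expansion hγ (n := 2 ^ n) (c := fun i => Real.sqrt (N.weight n η) *
        (N.a (i / (2 : ℝ) ^ ((n : ℤ) - 1)) * N.e i η))]
  · split_ifs with h
    · rfl
    · rw [N.a_level_eq_zero (not_lt.1 h)]; simp
  · intro x _
    rw [N.ψ_natCast, Finset.mul_sum]
    exact Finset.sum_congr rfl fun k _ => by ring

theorem coeff_eq_sum [IsProbabilityMeasure γ] (hγ : ∀ᵐ x ∂γ, x ∈ Set.Icc (-1 : ℝ) 1)
    (f : Lp ℝ 2 γ) {j : ℤ} (hj : -1 ≤ j) (η : ℝ) :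
    N.coeff f j η =
      ∑ i ∈ Finset.range (2 ^ j.toNat), N.ψCoeff j η i * N.basisCoeff f i := by
  have h1 : N.coeff f j η =
      ∫ x, ∑ i ∈ Finset.range (2 ^ j.toNat), N.ψCoeff j η i * (f x * N.e i x) ∂γ := by
    apply integral_congr_ae
    filter_upwards [hγ] with x hx
    rw [(N.ψ_expansion hγ hj η).1 x hx, Finset.mul_sum]
    exact Finset.sum_congr rfl fun k _ => by ring
  rw [h1, integral_finsetSum _ fun k _ => (N.integrable_mul_e f k).const_mul _]
  simp only [integral_const_mul, basisCoeff]

/-! ### The frame identity -/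

theorem integrable_e [IsProbabilityMeasure γ] (k : ℕ) : Integrable (N.e k) γ :=
  (N.memLp_e k).integrable (by norm_num)

/-- The product `e_k e_l` lies in the span of the `e_i` with `i ≤ k + l ≤ 2^{n+1} - 2`, where the
quadrature is exact; so orthonormality persists on the nodes. -/
theorem sum_weight_mul_e_mul_e [IsProbabilityMeasure γ]
    (hγ : ∀ᵐ x ∂γ, x ∈ Set.Icc (-1 : ℝ) 1) {n k l : ℕ} (hk : k < 2 ^ n) (hl : l < 2 ^ n) :
    ∑ η ∈ N.Z n, N.weight n η * (N.e k η * N.e l η) = if k = l then 1 else 0 := by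
  obtain ⟨c, hc⟩ := N.e_mul k l
  have h1 : ∫ x, N.e k x * N.e l x ∂γ =
      ∑ i ∈ Finset.range (k + l + 1), c i * ∑ η ∈ N.Z n, N.weight n η * N.e i η := by
    have : ∫ x, N.e k x * N.e l x ∂γ =
        ∫ x, ∑ i ∈ Finset.range (k + l + 1), c i * N.e i x ∂γ := by
      apply integral_congr_ae
      filter_upwards [hγ] with x hx using hc x hx
    rw [this, integral_finsetSum _ fun i _ => (N.integrable_e i).const_mul _]
    apply Finset.sum_congr rfl
    intro i hi
    rw [integral_const_mul, N.quadrature n (by omega) i]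
    have hi' : i ≤ k + l := by have := Finset.mem_range.1 hi; omega
    have h2 : (i : ℝ) + 2 ≤ 2 ^ (n + 1) := by
      have : i + 2 ≤ 2 ^ (n + 1) := by rw [pow_succ]; omega
      exact_mod_cast this
    have h3 : ((2 : ℝ) ^ ((n : ℤ) + 1)) = 2 ^ (n + 1) := by
      rw [← zpow_natCast]; norm_cast
    rw [h3]; linarith
  rw [← N.integral_e_mul_e k l, h1]
  simp only [Finset.mul_sum]
  rw [Finset.sum_comm]
  apply Finset.sum_congr rfl
  intro η hη
  rw [hc η (N.Z_subset n (by omega) η hη), Finset.mul_sum]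
  exact Finset.sum_congr rfl fun i _ => by ring

/-- Orthonormality on the nodes collapses the double sum over frequencies, and `a²` is a difference
of dilates of `φ`. A level is therefore a difference of consecutive smoothed partial sums; `M` is
free so that all levels can share one range. -/
theorem sum_coeff_mul_ψ_natCast [IsProbabilityMeasure γ] (hγ : ∀ᵐ x ∂γ, x ∈ Set.Icc (-1 : ℝ) 1)
    (f : Lp ℝ 2 γ) (n : ℕ) {M : ℕ} (hM : 2 ^ n ≤ M) (x : ℝ) :
    ∑ η ∈ N.Z n, N.coeff f n η * N.ψ n η x =
      ∑ k ∈ Finset.range M,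
        (N.φ (k / 2 ^ n) - N.φ (2 * k / 2 ^ n)) * (N.basisCoeff f k * N.e k x) := by
  set A : ℕ → ℝ := fun k => N.a (k / (2 : ℝ) ^ ((n : ℤ) - 1)) with hA
  have h1 : ∀ η ∈ N.Z n, N.coeff f n η * N.ψ n η x =
      ∑ l ∈ Finset.range (2 ^ n), ∑ k ∈ Finset.range (2 ^ n),
        (A l * A k * N.basisCoeff f l * N.e k x) *
          (N.weight n η * (N.e l η * N.e k η)) := by
    intro η hη
    have hw := Real.mul_self_sqrt (N.weight_pos n (by omega) η hη).le
    rw [N.coeff_eq_sum hγ f (by omega), N.ψ_natCast, Int.toNat_natCast, Finset.mul_sum,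
      Finset.sum_mul_sum]
    apply Finset.sum_congr rfl
    intro l _
    apply Finset.sum_congr rfl
    intro k _
    rw [N.ψCoeff_natCast hγ]
    simp only [hA]
    linear_combination (N.a (l / (2 : ℝ) ^ ((n : ℤ) - 1)) * N.e l η * N.basisCoeff f l *
      (N.a (k / (2 : ℝ) ^ ((n : ℤ) - 1)) * N.e k x * N.e k η)) * hw
  rw [Finset.sum_congr rfl h1, Finset.sum_comm]
  have h2 : ∀ l ∈ Finset.range (2 ^ n), ∑ η ∈ N.Z n, ∑ k ∈ Finset.range (2 ^ n),
        (A l * A k * N.basisCoeff f l * N.e k x) * (N.weight n η * (N.e l η * N.e k η)) =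
      (N.φ (l / 2 ^ n) - N.φ (2 * l / 2 ^ n)) * (N.basisCoeff f l * N.e l x) := by
    intro l hl
    rw [Finset.sum_comm]
    simp only [← Finset.mul_sum]
    rw [Finset.sum_congr rfl fun k hk => by
      rw [N.sum_weight_mul_e_mul_e hγ (Finset.mem_range.1 hl) (Finset.mem_range.1 hk)]]
    rw [← N.a_level_sq]
    simp only [mul_ite, mul_one, mul_zero]
    rw [Finset.sum_ite_eq, if_pos hl]
    simp only [hA]
    ring
  rw [Finset.sum_congr rfl h2]
  apply Finset.sum_subset
  · intro k hk
    exact Finset.mem_range.2 ((Finset.mem_range.1 hk).trans_le hM)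
  · intro k _ hk
    rw [← N.a_level_sq, N.a_level_eq_zero (by simpa using hk)]
    simp

/-- The contribution of the levels up to `J` to the needlet expansion of `f`. -/
def partialSum (f : Lp ℝ 2 γ) (J : ℤ) (x : ℝ) : ℝ :=
  ∑ j ∈ Finset.Icc (-1 : ℤ) J, ∑ η ∈ N.Z j, N.coeff f j η * N.ψ j η x

theorem partialSum_succ (f : Lp ℝ 2 γ) {J : ℤ} (hJ : -1 ≤ J) (x : ℝ) :
    N.partialSum f (J + 1) x =
      N.partialSum f J x + ∑ η ∈ N.Z (J + 1), N.coeff f (J + 1) η * N.ψ (J + 1) η x := by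
  have : Finset.Icc (-1 : ℤ) (J + 1) = insert (J + 1) (Finset.Icc (-1 : ℤ) J) := by
    ext i; simp only [Finset.mem_Icc, Finset.mem_insert]; omega
  rw [partialSum, partialSum, this, Finset.sum_insert (by simp), add_comm]

theorem partialSum_natCast [IsProbabilityMeasure γ] (hγ : ∀ᵐ x ∂γ, x ∈ Set.Icc (-1 : ℝ) 1)
    (f : Lp ℝ 2 γ) (J : ℕ) {M : ℕ} (hM : 2 ^ J ≤ M) {x : ℝ} (hx : x ∈ Set.Icc (-1 : ℝ) 1) :
    N.partialSum f J x =
      ∑ k ∈ Finset.range M, N.φ (k / 2 ^ J) * (N.basisCoeff f k * N.e k x) := by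
  -- The multipliers `φ(2k)` select the frequency `0`, which is exactly the contribution of level
  -- `-1`; this starts the telescoping.
  have hφ : ∀ k : ℕ, N.φ (2 * k) = if k = 0 then 1 else 0 := by
    intro k
    split_ifs with h
    · rw [h]; simpa using N.φ_one 0 (by norm_num)
    · apply N.φ_eq_zero
      have : (1 : ℝ) ≤ k := by exact_mod_cast Nat.one_le_iff_ne_zero.2 h
      linarith
  have h0 : ∀ M : ℕ, 1 ≤ M → N.partialSum f (-1) x =
      ∑ k ∈ Finset.range M, N.φ (2 * k) * (N.basisCoeff f k * N.e k x) := by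
    intro M hM
    obtain ⟨c, hc, he⟩ := N.e_zero_sq hγ
    obtain ⟨η, hη⟩ := Finset.card_eq_one.1 N.card_Z_neg_one
    rw [partialSum, Finset.Icc_self, Finset.sum_singleton, hη, Finset.sum_singleton]
    simp only [hφ, ite_mul, one_mul, zero_mul]
    rw [Finset.sum_ite_eq', if_pos (Finset.mem_range.2 (by omega)), he x hx]
    have e1 : N.ψ (-1) η x = 1 := by simp [ψ]
    have e2 : N.coeff f (-1) η = N.basisCoeff f 0 * c := by
      rw [basisCoeff, ← integral_mul_const]
      apply integral_congr_ae
      filter_upwards [hγ] with y hy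
      rw [he y hy, mul_assoc, ← sq, hc]
      simp [ψ]
    rw [e1, e2, mul_one]
  induction J generalizing M with
  | zero =>
    have h1 := N.partialSum_succ f le_rfl x
    have h2 := N.sum_coeff_mul_ψ_natCast hγ f 0 hM x
    simp only [Int.reduceNeg, Int.reduceAdd, Nat.cast_zero, pow_zero, div_one] at h1 h2 ⊢
    rw [h1, h2, h0 M (by simpa using hM), ← Finset.sum_add_distrib]
    exact Finset.sum_congr rfl fun k _ => by ring
  | succ J ih =>
    have h1 := N.partialSum_succ f (J := J) (by omega) x
    have h2 := N.sum_coeff_mul_ψ_natCast hγ f (J + 1) hM x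
    push_cast at h1 h2 ⊢
    rw [h1, h2, ih ((Nat.pow_le_pow_right (by norm_num) (by omega)).trans hM),
      ← Finset.sum_add_distrib]
    apply Finset.sum_congr rfl
    intro k _
    have : (2 * (k : ℝ)) / 2 ^ (J + 1) = k / 2 ^ J := by rw [pow_succ]; field_simp
    rw [this]; ring

end NeedletSystem

namespace NeedletSystem

variable {γ : Measure ℝ} (N : NeedletSystem γ)

/-! ### Convergence of the needlet expansion -/

/-- The smoothed partial sums of the expansion of `f` in the basis. -/
def smoothSum (f : Lp ℝ 2 γ) (J : ℕ) : Lp ℝ 2 γ :=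
  ∑ k ∈ Finset.range (2 ^ J), (N.φ (k / 2 ^ J) * N.basisCoeff f k) • N.basis k

theorem coeFn_sum_smul_basis (c : ℕ → ℝ) (F : Finset ℕ) :
    ⇑(∑ k ∈ F, c k • N.basis k) =ᵐ[γ] fun x => ∑ k ∈ F, c k * N.e k x := by
  have h1 := Lp.coeFn_fun_finsetSum F (fun k => c k • N.basis k)
  have h2 : ∀ᵐ x ∂γ, ∀ k : ℕ, (c k • N.basis k : Lp ℝ 2 γ) x = c k * N.e k x := by
    rw [ae_all_iff]
    intro k
    filter_upwards [Lp.coeFn_smul (c k) (N.basis k), N.basis_ae k] with x hx hx2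
    rw [hx, Pi.smul_apply, hx2, smul_eq_mul]
  filter_upwards [h1, h2] with x hx hx2
  rw [hx]
  exact Finset.sum_congr rfl fun k _ => hx2 k

theorem coeFn_smoothSum [IsProbabilityMeasure γ] (hγ : ∀ᵐ x ∂γ, x ∈ Set.Icc (-1 : ℝ) 1)
    (f : Lp ℝ 2 γ) (J : ℕ) : ⇑(N.smoothSum f J) =ᵐ[γ] N.partialSum f J := by
  filter_upwards [N.coeFn_sum_smul_basis (fun k => N.φ (k / 2 ^ J) * N.basisCoeff f k)
    (Finset.range (2 ^ J)), hγ] with x hx hx2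
  rw [smoothSum, hx, N.partialSum_natCast hγ f J le_rfl hx2]
  exact Finset.sum_congr rfl fun k _ => by ring

theorem inner_smoothSum (f : Lp ℝ 2 γ) (J k : ℕ) :
    inner ℝ (N.smoothSum f J) (N.basis k) = N.φ (k / 2 ^ J) * N.basisCoeff f k := by
  rw [smoothSum, sum_inner]
  simp only [inner_smul_left, orthonormal_iff_ite.1 N.basis.orthonormal]
  simp only [mul_ite, mul_one, mul_zero]
  rw [Finset.sum_ite_eq']
  split_ifs with h
  · simp
  · rw [N.φ_eq_zero, zero_mul]
    rw [le_div_iff₀ (by positivity), one_mul]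
    have : 2 ^ J ≤ k := by simpa using h
    exact_mod_cast this

/-- Parseval's identity and dominated convergence: each multiplier `φ(k/2^J)` is eventually `1`, and
`|φ - 1| ≤ 1` throughout. -/
theorem tendsto_smoothSum (f : Lp ℝ 2 γ) :
    Filter.Tendsto (N.smoothSum f) Filter.atTop (nhds f) := by
  rw [tendsto_iff_norm_sub_tendsto_zero]
  have h1 : ∀ J, ‖N.smoothSum f J - f‖ ^ 2 =
      ∑' k : ℕ, ((N.φ (k / 2 ^ J) - 1) * N.basisCoeff f k) ^ 2 := by
    intro J
    rw [← real_inner_self_eq_norm_sq, ← N.basis.tsum_inner_mul_inner]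
    apply tsum_congr
    intro k
    rw [real_inner_comm (N.smoothSum f J - f), inner_sub_left, N.inner_smoothSum, N.inner_basis]
    ring
  have h2 : Summable fun k : ℕ => N.basisCoeff f k ^ 2 := by
    have := (N.basis.hasSum_inner_mul_inner f f).summable
    refine this.congr fun k => ?_
    rw [real_inner_comm f, N.inner_basis, sq]
  have h3 : Filter.Tendsto (fun J : ℕ => ‖N.smoothSum f J - f‖ ^ 2) Filter.atTop (nhds 0) := by
    simp only [h1]
    rw [show (0 : ℝ) = ∑' _ : ℕ, (0 : ℝ) from tsum_zero.symm]
    apply tendsto_tsum_of_dominated_convergence h2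
    · intro k
      apply tendsto_const_nhds.congr'
      have : Filter.Tendsto (fun J : ℕ => (k : ℝ) * (1 / 2) ^ J) Filter.atTop (nhds (k * 0)) :=
        (tendsto_pow_atTop_nhds_zero_of_lt_one (by norm_num) (by norm_num)).const_mul _
      rw [mul_zero] at this
      filter_upwards [this.eventually_lt_const (by norm_num : (0 : ℝ) < 1 / 2)] with J hJ
      rw [N.φ_one, sub_self, zero_mul]
      · simp
      · rw [abs_of_nonneg (by positivity), div_eq_mul_inv, ← inv_pow]
        rw [one_div] at hJ
        simpa using hJ.le
    · refine Filter.Eventually.of_forall fun J k => ?_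
      rw [Real.norm_eq_abs, abs_of_nonneg (sq_nonneg _), mul_pow]
      have := N.φ_mem (k / 2 ^ J)
      have h4 : (N.φ (k / 2 ^ J) - 1) ^ 2 ≤ 1 := by
        rw [sq_le_one_iff_abs_le_one, abs_le]
        constructor <;> linarith [this.1, this.2]
      exact mul_le_of_le_one_left (sq_nonneg _) h4
  have h4 := h3.sqrt
  simpa using h4

theorem aestronglyMeasurable_ψ [IsProbabilityMeasure γ] (hγ : ∀ᵐ x ∂γ, x ∈ Set.Icc (-1 : ℝ) 1)
    {j : ℤ} (hj : -1 ≤ j) (η : ℝ) : AEStronglyMeasurable (N.ψ j η) γ := by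
  have h : AEStronglyMeasurable
      (fun x => ∑ i ∈ Finset.range (2 ^ j.toNat), N.ψCoeff j η i * N.e i x) γ :=
    Finset.aestronglyMeasurable_fun_sum _ fun i _ => (N.memLp_e i).1.const_mul _
  apply h.congr
  filter_upwards [hγ] with x hx
  exact ((N.ψ_expansion hγ hj η).1 x hx).symm

/-- The `L_p` distance of `f` to a partial sum is bounded by that of the later partial sums. -/
theorem eLpNorm_sub_partialSum_le [IsProbabilityMeasure γ]
    (hγ : ∀ᵐ x ∂γ, x ∈ Set.Icc (-1 : ℝ) 1) (f : Lp ℝ 2 γ) (J : ℕ) (q B : ℝ≥0∞)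
    (hB : ∀ n : ℕ, J ≤ n → eLpNorm (fun x => N.partialSum f n x - N.partialSum f J x) q γ ≤ B) :
    eLpNorm (fun x => N.partialSum f J x - f x) q γ ≤ B := by
  have hm : ∀ n : ℕ, AEStronglyMeasurable (N.partialSum f n) γ := fun n =>
    (Lp.aestronglyMeasurable (N.smoothSum f n)).congr (N.coeFn_smoothSum hγ f n)
  -- Convergence in `L²` gives an almost everywhere convergent subsequence, and Fatou's lemma along
  -- it yields the bound in `L_q`, although `f` is not known to lie in `L_q`.
  obtain ⟨ns, hns, hlim⟩ :=
    (tendstoInMeasure_of_tendsto_Lp (N.tendsto_smoothSum f)).exists_seq_tendsto_ae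
  have hae : ∀ᵐ x ∂γ, ∀ n : ℕ, (N.smoothSum f n) x = N.partialSum f n x := by
    rw [ae_all_iff]
    exact fun n => N.coeFn_smoothSum hγ f n
  have hlim' : ∀ᵐ x ∂γ, Filter.Tendsto
      (fun i => N.partialSum f (ns i : ℕ) x - N.partialSum f J x) Filter.atTop
      (nhds (f x - N.partialSum f J x)) := by
    filter_upwards [hlim, hae] with x hx hx2
    simp only [hx2] at hx
    exact hx.sub_const _
  have h1 := Lp.eLpNorm_lim_le_liminf_eLpNorm (p := q) (fun i => (hm (ns i)).sub (hm J))
    (fun x => f x - N.partialSum f J x) hlim'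
  have h2 : eLpNorm (fun x => N.partialSum f J x - f x) q γ =
      eLpNorm (fun x => f x - N.partialSum f J x) q γ := by
    rw [← eLpNorm_neg]; congr 1; ext x; simp
  rw [h2]
  refine h1.trans ?_
  apply Filter.liminf_le_of_frequently_le'
  apply Filter.Eventually.frequently
  filter_upwards [hns.tendsto_atTop.eventually_ge_atTop J] with i hi
  exact hB _ hi

/-! ### Noise levels -/

theorem sum_ψCoeff_sq_le [IsProbabilityMeasure γ] (hγ : ∀ᵐ x ∂γ, x ∈ Set.Icc (-1 : ℝ) 1)
    {j : ℤ} (hj : -1 ≤ j) (η : ℝ) :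
    ENNReal.ofReal (∑ i ∈ Finset.range (2 ^ j.toNat), N.ψCoeff j η i ^ 2) ≤
      N.ψNormPow 2 j η := by
  set u : Lp ℝ 2 γ := ∑ k ∈ Finset.range (2 ^ j.toNat), N.ψCoeff j η k • N.basis k with hu
  have h1 : ⇑u =ᵐ[γ] N.ψ j η := by
    filter_upwards [N.coeFn_sum_smul_basis (N.ψCoeff j η) (Finset.range (2 ^ j.toNat)), hγ]
      with x hx hx2
    rw [hx, (N.ψ_expansion hγ hj η).1 x hx2]
  have h2 : ‖u‖ ^ 2 = ∑ i ∈ Finset.range (2 ^ j.toNat), N.ψCoeff j η i ^ 2 := by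
    rw [← real_inner_self_eq_norm_sq, hu, N.basis.orthonormal.inner_sum]
    exact Finset.sum_congr rfl fun i _ => by simp [sq]
  rw [← h2, ψNormPow, ← eLpNorm_congr_ae h1, ENNReal.ofReal_ofNat, ← Lp.enorm_def,
    ENNReal.rpow_ofNat, ENNReal.ofReal_pow (norm_nonneg _), ofReal_norm]

theorem tsum_ψCoeff_div [IsProbabilityMeasure γ] (hγ : ∀ᵐ x ∂γ, x ∈ Set.Icc (-1 : ℝ) 1)
    (b : ℕ → ℝ) {j : ℤ} (hj : -1 ≤ j) (η : ℝ) :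
    ∑' i : ℕ, (N.ψCoeff j η i / b i) ^ 2 =
      ∑ i ∈ Finset.range (2 ^ j.toNat), (N.ψCoeff j η i / b i) ^ 2 := by
  apply tsum_eq_sum
  intro i hi
  rw [(N.ψ_expansion hγ hj η).2 i (by simpa using hi)]
  simp

theorem sum_ψCoeff_div_le_σ_sq [IsProbabilityMeasure γ]
    (hγ : ∀ᵐ x ∂γ, x ∈ Set.Icc (-1 : ℝ) 1) (b : ℕ → ℝ) {j : ℤ} (hj : -1 ≤ j) {η : ℝ}
    (hη : η ∈ N.Z j) :
    ∑ i ∈ Finset.range (2 ^ j.toNat), (N.ψCoeff j η i / b i) ^ 2 ≤ N.σ b j ^ 2 := by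
  rw [σ, Real.sq_sqrt, ← N.tsum_ψCoeff_div hγ b hj]
  · exact le_ciSup (f := fun η : {η // η ∈ N.Z j} => ∑' i : ℕ, (N.ψCoeff j η i / b i) ^ 2)
      (Set.finite_range _).bddAbove ⟨η, hη⟩
  · exact Real.iSup_nonneg fun η => tsum_nonneg fun i => sq_nonneg _

/-- Only the frequencies `1 ≤ i < 2 ^ n` enter: the coefficient at `i = 0` vanishes, so no lower
bound on `b 0` is needed. For the others `1 / b i ≤ c⁻¹ (2 ^ n) ^ ν`, by `ν ≥ 0`. -/
theorem σ_le [IsProbabilityMeasure γ] (hγ : ∀ᵐ x ∂γ, x ∈ Set.Icc (-1 : ℝ) 1) {b : ℕ → ℝ}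
    {ν c C : ℝ} (hν : 0 ≤ ν) (hc : 0 < c) (hC : 0 ≤ C)
    (hb : ∀ i : ℕ, 1 ≤ i → c * (i : ℝ) ^ (-ν) ≤ b i) {n : ℕ}
    (hψ : ∀ η ∈ N.Z n, N.ψNormPow 2 n η ≤ ENNReal.ofReal C) :
    N.σ b n ≤ Real.sqrt C / c * ((2 : ℝ) ^ n) ^ ν := by
  apply Real.sqrt_le_iff.2 ⟨by positivity, ?_⟩
  apply Real.iSup_le _ (by positivity)
  rintro ⟨η, hη⟩
  rw [N.tsum_ψCoeff_div hγ b (by omega), Int.toNat_natCast]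
  have h1 : ∑ i ∈ Finset.range (2 ^ n), N.ψCoeff n η i ^ 2 ≤ C := by
    have := (N.sum_ψCoeff_sq_le hγ (by omega : -1 ≤ (n : ℤ)) η).trans (hψ η hη)
    exact (ENNReal.ofReal_le_ofReal_iff hC).1 this
  have h2 : ∀ i ∈ Finset.range (2 ^ n), (N.ψCoeff n η i / b i) ^ 2 ≤
      N.ψCoeff n η i ^ 2 * (c⁻¹ * ((2 : ℝ) ^ n) ^ ν) ^ 2 := by
    intro i hi
    rcases Nat.eq_zero_or_pos i with rfl | hi0
    · rw [N.ψCoeff_natCast hγ]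
      simp [N.a_zero]
    · have hir : (0 : ℝ) < i := by exact_mod_cast hi0
      have hi2 : (i : ℝ) ≤ 2 ^ n := by exact_mod_cast (Finset.mem_range.1 hi).le
      have hbi := hb i hi0
      have hbi0 : 0 < c * (i : ℝ) ^ (-ν) := by positivity
      rw [div_eq_mul_inv, mul_pow]
      apply mul_le_mul_of_nonneg_left _ (sq_nonneg _)
      apply pow_le_pow_left₀ (inv_nonneg.2 (hbi0.le.trans hbi))
      calc (b i)⁻¹ ≤ (c * (i : ℝ) ^ (-ν))⁻¹ := inv_anti₀ hbi0 hbi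
        _ = c⁻¹ * (i : ℝ) ^ ν := by rw [mul_inv, Real.rpow_neg hir.le, inv_inv]
        _ ≤ _ := by gcongr
  calc _ ≤ ∑ i ∈ Finset.range (2 ^ n), N.ψCoeff n η i ^ 2 * (c⁻¹ * ((2 : ℝ) ^ n) ^ ν) ^ 2 :=
        Finset.sum_le_sum h2
    _ = (∑ i ∈ Finset.range (2 ^ n), N.ψCoeff n η i ^ 2) * (c⁻¹ * ((2 : ℝ) ^ n) ^ ν) ^ 2 := by
        rw [Finset.sum_mul]
    _ ≤ C * (c⁻¹ * ((2 : ℝ) ^ n) ^ ν) ^ 2 := by gcongr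
    _ = _ := by
        rw [mul_pow, mul_pow, div_pow, Real.sq_sqrt hC]
        field_simp

/-! ### The empirical coefficients -/

/-- `⟨K f, g_i⟩ = ⟨f, K^* g_i⟩ = b_i ⟨f, e_i⟩`, so dividing by `b_i` inverts the operator exactly
and leaves a finite linear form in the white noise. -/
theorem empCoeff_observation [IsProbabilityMeasure γ] (hγ : ∀ᵐ x ∂γ, x ∈ Set.Icc (-1 : ℝ) 1)
    {G Ω : Type*} [NormedAddCommGroup G] [InnerProductSpace ℝ G] [CompleteSpace G]
    {K : Lp ℝ 2 γ →L[ℝ] G} {g : ℕ → G} {b : ℕ → ℝ} (hK : IsSVD K N.basis g b)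
    (hb : ∀ i, b i ≠ 0) (W : G → Ω → ℝ) (ε : ℝ) (f : Lp ℝ 2 γ) (ω : Ω) {j : ℤ} (hj : -1 ≤ j)
    (η : ℝ) :
    N.empCoeff b (observation K g W ε f ω) j η = N.coeff f j η +
      ∑ i ∈ Finset.range (2 ^ j.toNat), ε * (N.ψCoeff j η i / b i) * W (g i) ω := by
  rw [empCoeff, tsum_eq_sum (s := Finset.range (2 ^ j.toNat)), N.coeff_eq_sum hγ f hj,
    ← Finset.sum_add_distrib]
  · apply Finset.sum_congr rfl
    intro i _
    have h1 : inner ℝ (K f) (g i) = b i * N.basisCoeff f i := by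
      rw [← ContinuousLinearMap.adjoint_inner_right, hK.adjoint_g, inner_smul_right, N.inner_basis]
    rw [observation, h1]
    have := hb i
    field_simp
  · intro i hi
    rw [(N.ψ_expansion hγ hj η).2 i (by simpa using hi)]
    simp

end NeedletSystem

/-- `|b_i| = ‖K e_i‖ ≤ ‖K‖`, whereas a negative `ν` would make `b_i` unbounded. The monotonicity of
`x ^ ν` used later rests on this. -/
theorem IsSVD.nonneg_of_isRegular {H G : Type*} [NormedAddCommGroup H] [InnerProductSpace ℝ H]
    [CompleteSpace H] [NormedAddCommGroup G] [InnerProductSpace ℝ G] [CompleteSpace G]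
    {K : H →L[ℝ] G} {e : HilbertBasis ℕ ℝ H} {g : ℕ → G} {b : ℕ → ℝ} (hK : IsSVD K e g b)
    {ν : ℝ} (hb : IsRegular b ν) : 0 ≤ ν := by
  obtain ⟨-, c, C, hc, -, h⟩ := hb
  by_contra! hν
  have hbound : ∀ i : ℕ, 1 ≤ i → (i : ℝ) ^ (-ν) ≤ ‖K‖ / c := by
    intro i hi
    rw [le_div_iff₀ hc, mul_comm]
    refine (h i hi).1.trans ?_
    have h1 : ‖K (e i)‖ ≤ ‖K‖ := by
      simpa [e.orthonormal.1 i] using K.le_opNorm (e i)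
    rw [hK.map_e, norm_smul, hK.orthonormal.1 i, mul_one] at h1
    exact (le_abs_self _).trans h1
  have ht : Filter.Tendsto (fun i : ℕ => (i : ℝ) ^ (-ν)) Filter.atTop Filter.atTop :=
    (tendsto_rpow_atTop (by linarith)).comp tendsto_natCast_atTop_atTop
  obtain ⟨i, hi1, hi2⟩ :=
    ((Filter.eventually_ge_atTop 1).and (ht.eventually_gt_atTop (‖K‖ / c))).exists
  exact absurd (hbound i hi1) (not_le.2 hi2)

namespace NeedletSystem

variable {γ : Measure ℝ} (N : NeedletSystem γ)

/-! ### The two halves of the interval -/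

/-- A family `S n ⊆ Z_n` of nodes, numbered by `k n`, on which `‖ψ‖_q^q` is comparable to the power
`q - 2` of the node scale with parameter `τ`. -/
structure HalfBound (τ : ℝ) (S : ℕ → Finset ℝ) (k : ℕ → ℝ → ℕ) : Prop where
  range : ∀ n, 1 ≤ n → ∀ η ∈ S n, 1 ≤ k n η ∧ (k n η : ℝ) ≤ 2 ^ n
  injOn : ∀ n, 1 ≤ n → Set.InjOn (k n) (S n)
  subset : ∀ n, S n ⊆ N.Z n
  bounds : ∀ q : ℝ, 1 ≤ q → ∃ c C : ℝ, 0 < c ∧ 0 < C ∧ ∀ n, 1 ≤ n → ∀ η ∈ S n,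
    ENNReal.ofReal (c * nodeScale τ (2 ^ n) (k n η) ^ (q - 2)) ≤ N.ψNormPow q n η ∧
    N.ψNormPow q n η ≤ ENNReal.ofReal (C * nodeScale τ (2 ^ n) (k n η) ^ (q - 2))

/-- The nodes of the right half. -/
def rightNodes (n : ℕ) : Finset ℝ :=
  (N.Z n).filter fun η => (N.position n η : ℝ) ≤ (2 : ℝ) ^ ((n : ℤ) - 1)

/-- The nodes of the left half. -/
def leftNodes (n : ℕ) : Finset ℝ :=
  (N.Z n).filter fun η => ¬ (N.position n η : ℝ) ≤ (2 : ℝ) ^ ((n : ℤ) - 1)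

theorem one_le_position {j : ℤ} {η : ℝ} (h : η ∈ N.Z j) : 1 ≤ N.position j η :=
  Finset.card_pos.2 ⟨η, Finset.mem_filter.2 ⟨h, le_rfl⟩⟩

theorem position_le_card (j : ℤ) (η : ℝ) : N.position j η ≤ (N.Z j).card :=
  Finset.card_filter_le _ _

theorem position_lt {j : ℤ} {η η' : ℝ} (h : η ∈ N.Z j) (hlt : η < η') :
    N.position j η' < N.position j η := by
  apply Finset.card_lt_card
  rw [Finset.ssubset_iff_of_subset]
  · exact ⟨η, Finset.mem_filter.2 ⟨h, le_rfl⟩, fun h' => by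
      have := (Finset.mem_filter.1 h').2; linarith⟩
  · intro x hx
    obtain ⟨h1, h2⟩ := Finset.mem_filter.1 hx
    exact Finset.mem_filter.2 ⟨h1, by linarith⟩

theorem position_injOn (j : ℤ) : Set.InjOn (N.position j) (N.Z j) := by
  intro η hη η' hη' h
  rcases lt_trichotomy η η' with hlt | rfl | hlt
  · exact absurd h (N.position_lt hη hlt).ne'
  · rfl
  · exact absurd h (N.position_lt hη' hlt).ne

variable {N}

theorem CardBound.position_le (h : N.CardBound) (n : ℕ) (η : ℝ) : N.position n η ≤ 2 ^ n := by
  have h1 := h n (by omega)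
  rw [zpow_natCast] at h1
  exact (N.position_le_card n η).trans (by exact_mod_cast h1)

theorem two_rpow_mul_mul (n : ℕ) (q τ : ℝ) :
    (2 : ℝ) ^ (((n : ℤ) : ℝ) * (q - 2) * (τ + 1)) = ((2 : ℝ) ^ n) ^ ((q - 2) * (τ + 1)) := by
  rw [Int.cast_natCast, mul_assoc, Real.rpow_mul (by norm_num), Real.rpow_natCast]

theorem halfBound_right {α : ℝ} (hcard : N.CardBound) (h : N.RightNormBounds α) :
    N.HalfBound α N.rightNodes (fun n => N.position n) where
  range n _ η hη := ⟨N.one_le_position (Finset.mem_filter.1 hη).1, by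
    exact_mod_cast hcard.position_le n η⟩
  injOn n _ := (N.position_injOn n).mono (by
    intro η hη; exact (Finset.mem_filter.1 hη).1)
  subset n := Finset.filter_subset _ _
  bounds q hq := by
    obtain ⟨c, C, hc, hC, h⟩ := h q hq
    refine ⟨c, C, hc, hC, fun n hn η hη => ?_⟩
    obtain ⟨h1, h2⟩ := Finset.mem_filter.1 hη
    have := h n (by omega) η h1 h2
    have hk : (0 : ℝ) < N.position n η := by exact_mod_cast N.one_le_position h1
    rw [nodeScale_rpow (by positivity) hk]
    rw [two_rpow_mul_mul, neg_mul] at this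
    simpa only [mul_assoc] using this

/-- Positions on the left are counted from `2 ^ n`, not from the last node; `CardBound` keeps the
subtraction in `ℕ` from truncating. -/
theorem halfBound_left {β : ℝ} (hcard : N.CardBound) (h : N.LeftNormBounds β) :
    N.HalfBound β N.leftNodes (fun n η => 2 ^ n + 1 - N.position n η) where
  range n _ η hη := by
    have h1 := hcard.position_le n η
    have h2 := N.one_le_position (Finset.mem_filter.1 hη).1
    refine ⟨by omega, ?_⟩
    have : 2 ^ n + 1 - N.position n η ≤ 2 ^ n := by omega
    exact_mod_cast this
  injOn n _ := by
    intro η hη η' hη' h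
    apply N.position_injOn n (Finset.mem_filter.1 hη).1 (Finset.mem_filter.1 hη').1
    have h1 := hcard.position_le n η
    have h2 := hcard.position_le n η'
    dsimp only at h
    omega
  subset n := Finset.filter_subset _ _
  bounds q hq := by
    obtain ⟨c, C, hc, hC, h⟩ := h q hq
    refine ⟨c, C, hc, hC, fun n hn η hη => ?_⟩
    obtain ⟨h1, h2⟩ := Finset.mem_filter.1 hη
    have := h n (by omega) η h1 (not_le.1 h2)
    have h3 := hcard.position_le n η
    have h4 : ((2 ^ n + 1 - N.position n η : ℕ) : ℝ) = (2 : ℝ) ^ n - N.position n η + 1 := by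
      rw [Nat.cast_sub (by omega)]; push_cast; ring
    have hk : (0 : ℝ) < ((2 ^ n + 1 - N.position n η : ℕ) : ℝ) := by
      exact_mod_cast (by omega : 0 < 2 ^ n + 1 - N.position n η)
    rw [nodeScale_rpow (by positivity) hk, h4]
    rw [two_rpow_mul_mul, neg_mul, zpow_natCast] at this
    simpa only [mul_assoc] using this

/-! ### The Besov ball -/

/-- A single term of the sum or supremum already gives this, for `r < 1` as well. It is all that is
used of the `ℓ_r` norm, which is why `r` does not affect the rate. -/
theorem apply_le_eLpNorm_count (u : ℕ → ℝ≥0∞) {r : ℝ≥0∞} (hr : r ≠ 0) (m : ℕ) :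
    u m ≤ eLpNorm u r Measure.count := by
  rcases eq_or_ne r ⊤ with rfl | hr'
  · rw [eLpNorm_exponent_top]
    simpa using Measure.ae_count_iff.1 (enorm_ae_le_eLpNormEssSup u Measure.count) m
  · rw [eLpNorm_eq_lintegral_rpow_enorm_toReal hr hr', lintegral_count]
    have hr0 : 0 < r.toReal := ENNReal.toReal_pos hr hr'
    calc u m = (‖u m‖ₑ ^ r.toReal) ^ (1 / r.toReal) := by
          rw [← ENNReal.rpow_mul, mul_one_div_cancel hr0.ne', ENNReal.rpow_one]; simp
      _ ≤ _ := by
          gcongr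
          exact ENNReal.le_tsum (f := fun a => ‖u a‖ₑ ^ r.toReal) m

theorem sum_coeff_rpow_le_of_mem_besovBall {s π M : ℝ} {r : ℝ≥0∞} (hr : 0 < r) (hπ : 0 < π)
    (hM : 0 ≤ M) {f : Lp ℝ 2 γ} (hf : f ∈ N.besovBall s π r M) (n : ℕ) :
    ∑ η ∈ N.Z n, ‖N.coeff f n η‖ₑ ^ π * N.ψNormPow π n η ≤
      ENNReal.ofReal (M ^ π * ((2 : ℝ) ^ n) ^ (-(s * π))) := by
  have h1 : N.besovLevel s π f n ≤ ENNReal.ofReal M := by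
    refine le_trans ?_ hf
    -- The sequence starts at level `-1`, so level `n` is its term `n + 1`.
    have := apply_le_eLpNorm_count (fun m : ℕ => N.besovLevel s π f ((m : ℤ) - 1)) hr.ne' (n + 1)
    rw [besovNorm]
    simpa using this
  rw [besovLevel] at h1
  set A := ∑ η ∈ N.Z n, ‖N.coeff f n η‖ₑ ^ π * N.ψNormPow π n η with hA
  have e2 : (2 : ℝ) ^ (((n : ℤ) : ℝ) * s) = ((2 : ℝ) ^ n) ^ s := by
    rw [Int.cast_natCast, Real.rpow_mul (by norm_num), Real.rpow_natCast]
  rw [e2] at h1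
  have hpos : (0 : ℝ) < ((2 : ℝ) ^ n) ^ s := by positivity
  have h2 : A ^ (1 / π) ≤ ENNReal.ofReal (M * ((2 : ℝ) ^ n) ^ (-s)) := by
    calc A ^ (1 / π) = ENNReal.ofReal (((2 : ℝ) ^ n) ^ (-s)) *
          (ENNReal.ofReal (((2 : ℝ) ^ n) ^ s) * A ^ (1 / π)) := by
          rw [← mul_assoc, ← ENNReal.ofReal_mul (by positivity), ← Real.rpow_add (by positivity)]
          simp
      _ ≤ ENNReal.ofReal (((2 : ℝ) ^ n) ^ (-s)) * ENNReal.ofReal M := by gcongr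
      _ = _ := by rw [← ENNReal.ofReal_mul (by positivity), mul_comm]
  calc A = (A ^ (1 / π)) ^ π := by
        rw [← ENNReal.rpow_mul, one_div_mul_cancel hπ.ne', ENNReal.rpow_one]
    _ ≤ ENNReal.ofReal (M * ((2 : ℝ) ^ n) ^ (-s)) ^ π := by gcongr
    _ = _ := by
        rw [ENNReal.ofReal_rpow_of_nonneg (by positivity) hπ.le, Real.mul_rpow hM (by positivity),
          ← Real.rpow_mul (by positivity), neg_mul]

theorem enorm_rpow_mul_ofReal (x : ℝ) {q y : ℝ} (hq : 0 ≤ q) :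
    ‖x‖ₑ ^ q * ENNReal.ofReal y = ENNReal.ofReal (|x| ^ q * y) := by
  rw [ENNReal.ofReal_mul (by positivity), ← ENNReal.ofReal_rpow_of_nonneg (abs_nonneg _) hq,
    ← Real.norm_eq_abs, ofReal_norm]

variable {τ : ℝ} {S : ℕ → Finset ℝ} {k : ℕ → ℝ → ℕ}

theorem HalfBound.nodeScale_pos (h : N.HalfBound τ S k) {n : ℕ} (hn : 1 ≤ n) {η : ℝ}
    (hη : η ∈ S n) : 0 < nodeScale τ (2 ^ n) (k n η) :=
  Needlet.nodeScale_pos (by positivity) (by exact_mod_cast (h.range n hn η hη).1)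

/-- The absolute values of the coefficients at level `n`, numbered by the positions of the nodes. -/
def sortedCoeff (N : NeedletSystem γ) (S : ℕ → Finset ℝ) (k : ℕ → ℝ → ℕ) (f : Lp ℝ 2 γ) (n i : ℕ) :
    ℝ := |N.coeff f n (Function.invFunOn (k n) (S n) i)|

/-- This carries sums over nodes to sums over integers, the setting of `truncSum`. Outside the image
of `k n` the values of `sortedCoeff` are meaningless, and no sum reaches them. -/
theorem HalfBound.sum_image (h : N.HalfBound τ S k) {n : ℕ} (hn : 1 ≤ n) (f : Lp ℝ 2 γ)
    (F : ℕ → ℝ → ℝ) :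
    ∑ i ∈ (S n).image (k n), F i (N.sortedCoeff S k f n i) =
      ∑ η ∈ S n, F (k n η) |N.coeff f n η| := by
  rw [Finset.sum_image (h.injOn n hn)]
  apply Finset.sum_congr rfl
  intro η hη
  rw [sortedCoeff, (h.injOn n hn).leftInvOn_invFunOn hη]

theorem HalfBound.sum_besov_le (h : N.HalfBound τ S k) {s π M : ℝ} {r : ℝ≥0∞} (hr : 0 < r)
    (hπ : 1 ≤ π) (hM : 0 ≤ M) :
    ∃ M₀ : ℝ, 0 ≤ M₀ ∧ ∀ f ∈ N.besovBall s π r M, ∀ n, 1 ≤ n →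
      ∑ i ∈ (S n).image (k n),
        N.sortedCoeff S k f n i ^ π * nodeScale τ (2 ^ n) i ^ (π - 2) ≤
        M₀ * ((2 : ℝ) ^ n) ^ (-(s * π)) := by
  obtain ⟨c, C, hc, hC, hb⟩ := h.bounds π hπ
  refine ⟨M ^ π / c, by positivity, fun f hf n hn => ?_⟩
  rw [h.sum_image hn f fun i y => y ^ π * nodeScale τ (2 ^ n) i ^ (π - 2)]
  have h1 := sum_coeff_rpow_le_of_mem_besovBall hr (by linarith) hM hf n
  have hX : ∀ η ∈ S n, 0 ≤ nodeScale τ (2 ^ n) (k n η) ^ (π - 2) := fun η hη =>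
    Real.rpow_nonneg (h.nodeScale_pos hn hη).le _
  have h2 : ENNReal.ofReal (∑ η ∈ S n, |N.coeff f n η| ^ π *
      (c * nodeScale τ (2 ^ n) (k n η) ^ (π - 2))) ≤
      ENNReal.ofReal (M ^ π * ((2 : ℝ) ^ n) ^ (-(s * π))) := by
    refine le_trans ?_ h1
    rw [ENNReal.ofReal_sum_of_nonneg fun η hη => by have := hX η hη; positivity]
    refine le_trans ?_ (Finset.sum_le_sum_of_subset (h.subset n))
    apply Finset.sum_le_sum
    intro η hη
    rw [← enorm_rpow_mul_ofReal _ (by linarith)]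
    gcongr
    exact (hb n hn η hη).1
  rw [ENNReal.ofReal_le_ofReal_iff (by positivity)] at h2
  rw [div_mul_eq_mul_div, le_div_iff₀ hc]
  refine le_trans (le_of_eq ?_) h2
  rw [Finset.sum_mul]
  exact Finset.sum_congr rfl fun η _ => by ring

theorem HalfBound.range_image (h : N.HalfBound τ S k) {n : ℕ} (hn : 1 ≤ n) :
    ∀ i ∈ (S n).image (k n), 1 ≤ i ∧ (i : ℝ) ≤ 2 ^ n := by
  intro i hi
  obtain ⟨η, hη, rfl⟩ := Finset.mem_image.1 hi
  exact h.range n hn η hη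

/-- The truncated sums of the levels `1, …, m`. -/
theorem HalfBound.sum_min_le (h : N.HalfBound τ S k) {p π s ν M : ℝ} {r : ℝ≥0∞}
    (hτ : -(1 / 2) < τ) (hν : -(1 / 2) < ν) (hp : 1 < p) (hπ : 1 ≤ π)
    (hs : smoothnessThreshold p π τ < s) (hr : 0 < r) (hM : 0 ≤ M) :
    ∃ C : ℝ, 0 < C ∧ ∀ f ∈ N.besovBall s π r M, ∀ (t : ℝ) (m : ℕ), 0 < t → t < 1 →
      ∑ n ∈ Finset.Icc 1 m, ∑ η ∈ S n,
        ENNReal.ofReal (min |N.coeff f n η| (t * (2 ^ n) ^ ν) ^ p) * N.ψNormPow p n η ≤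
      ENNReal.ofReal (C * ((m : ℝ) + 2) ^ levelPower p π ν s τ *
          t ^ (p * min (rate₀ ν s) (rate₁ p π ν s τ))) := by
  obtain ⟨M₀, hM₀, hB⟩ := h.sum_besov_le (s := s) hr hπ hM
  obtain ⟨c, C, hc, hC, hb⟩ := h.bounds p hp.le
  obtain ⟨C', hC', hD⟩ := sum_truncSum_le hτ hν hp hπ hs hM₀
  refine ⟨C * C', by positivity, fun f hf t m ht ht1 => ?_⟩
  have hX : ∀ n, 1 ≤ n → ∀ η ∈ S n, 0 ≤ nodeScale τ (2 ^ n) (k n η) ^ (p - 2) := fun n hn η hη =>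
    Real.rpow_nonneg (h.nodeScale_pos hn hη).le _
  have hmin : ∀ (n : ℕ) (η : ℝ), 0 ≤ min |N.coeff f n η| (t * ((2 : ℝ) ^ n) ^ ν) ^ p := fun n η =>
    Real.rpow_nonneg (le_min (abs_nonneg _) (by positivity)) _
  -- Level `0` is replaced by the empty set, the node bounds being available from level `1` on. With
  -- `m + 1` levels the factor becomes `m + 2`.
  have h1 := hD t (m + 1) (fun n => if n = 0 then ∅ else (S n).image (k n))
    (fun n => N.sortedCoeff S k f n) ht ht1
    (fun n _ => by
      split_ifs with h0
      · simp
      · exact h.range_image (by omega))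
    (fun n i => abs_nonneg _)
    (fun n _ => by
      split_ifs with h0
      · rw [Finset.sum_empty]; positivity
      · exact hB f hf n (by omega))
  have hlvl : ∀ n ∈ Finset.Icc 1 m, ∑ η ∈ S n,
      ENNReal.ofReal (min |N.coeff f n η| (t * (2 ^ n) ^ ν) ^ p) * N.ψNormPow p n η ≤
      ENNReal.ofReal (C * truncSum τ p (2 ^ n) (t * (2 ^ n) ^ ν) ((S n).image (k n))
        (N.sortedCoeff S k f n)) := by
    intro n hn
    have hn1 : 1 ≤ n := (Finset.mem_Icc.1 hn).1
    rw [truncSum, h.sum_image hn1 f fun i y =>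
      min y (t * (2 ^ n) ^ ν) ^ p * nodeScale τ (2 ^ n) i ^ (p - 2), Finset.mul_sum,
      ENNReal.ofReal_sum_of_nonneg fun η hη =>
        mul_nonneg hC.le (mul_nonneg (hmin n η) (hX n hn1 η hη))]
    apply Finset.sum_le_sum
    intro η hη
    calc _ ≤ ENNReal.ofReal (min |N.coeff f n η| (t * (2 ^ n) ^ ν) ^ p) *
          ENNReal.ofReal (C * nodeScale τ (2 ^ n) (k n η) ^ (p - 2)) := by
          gcongr
          exact (hb n hn1 η hη).2
      _ = _ := by
          rw [← ENNReal.ofReal_mul (hmin n η)]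
          congr 1; ring
  refine (Finset.sum_le_sum hlvl).trans ?_
  have hT : ∀ n ∈ Finset.Icc 1 m, 0 ≤ C * truncSum τ p (2 ^ n) (t * (2 ^ n) ^ ν)
      ((S n).image (k n)) (N.sortedCoeff S k f n) := by
    intro n hn
    have hn1 : 1 ≤ n := (Finset.mem_Icc.1 hn).1
    rw [truncSum, h.sum_image hn1 f fun i y =>
      min y (t * (2 ^ n) ^ ν) ^ p * nodeScale τ (2 ^ n) i ^ (p - 2)]
    exact mul_nonneg hC.le (Finset.sum_nonneg fun η hη =>
      (mul_nonneg (hmin n η) (hX n hn1 η hη)))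
  rw [← ENNReal.ofReal_sum_of_nonneg hT, ← Finset.mul_sum]
  apply ENNReal.ofReal_le_ofReal
  rw [mul_assoc, mul_assoc]
  apply mul_le_mul_of_nonneg_left _ hC.le
  have h2 : ∑ n ∈ Finset.range (m + 1), truncSum τ p (2 ^ n) (t * (2 ^ n) ^ ν)
      (if n = 0 then ∅ else (S n).image (k n)) (N.sortedCoeff S k f n) =
      ∑ n ∈ Finset.Icc 1 m, truncSum τ p (2 ^ n) (t * (2 ^ n) ^ ν) ((S n).image (k n))
        (N.sortedCoeff S k f n) := by
    rw [Finset.range_eq_Ico, Finset.sum_eq_sum_Ico_succ_bot (by omega)]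
    have h0 : truncSum τ p (2 ^ 0) (t * (2 ^ 0) ^ ν)
        (if 0 = 0 then ∅ else (S 0).image (k 0)) (N.sortedCoeff S k f 0) = 0 := by
      simp [truncSum]
    rw [h0, zero_add]
    apply Finset.sum_congr
    · ext i; simp only [Finset.mem_Ico, Finset.mem_Icc]; omega
    · intro n hn
      rw [if_neg (by have := (Finset.mem_Icc.1 hn).1; omega)]
  rw [← h2]
  refine h1.trans (le_of_eq ?_)
  push_cast
  rw [mul_assoc, show (m : ℝ) + 1 + 1 = m + 2 by ring]

/-- The exponent of the decay of the levels of `f` in `L_p`. -/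
def biasExponent (p π s τ : ℝ) : ℝ := s - 2 * (1 + τ) * max (1 / π - 1 / p) 0

theorem HalfBound.sum_coeff_le (h : N.HalfBound τ S k) {p π s M : ℝ} {r : ℝ≥0∞}
    (hτ : -(1 / 2) < τ) (hp : 1 < p) (hπ : 1 ≤ π) (hr : 0 < r) (hM : 0 ≤ M) :
    ∃ C : ℝ, 0 < C ∧ ∀ f ∈ N.besovBall s π r M, ∀ n, 1 ≤ n →
      ∑ η ∈ S n, ‖N.coeff f n η‖ₑ ^ p * N.ψNormPow p n η ≤
        ENNReal.ofReal (C * ((2 : ℝ) ^ n) ^ (-(p * biasExponent p π s τ))) := by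
  have hp0 : 0 < p := by linarith
  obtain ⟨M₀, hM₀, hB⟩ := h.sum_besov_le (s := s) hr hπ hM
  obtain ⟨c, C, hc, hC, hb⟩ := h.bounds p hp.le
  obtain ⟨C', hC', hD⟩ : ∃ C' : ℝ, 0 ≤ C' ∧ ∀ f ∈ N.besovBall s π r M, ∀ n, 1 ≤ n →
      ∑ i ∈ (S n).image (k n), N.sortedCoeff S k f n i ^ p * nodeScale τ (2 ^ n) i ^ (p - 2) ≤
        C' * ((2 : ℝ) ^ n) ^ (-(p * biasExponent p π s τ)) := by
    rcases le_or_gt π p with hπp | hπp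
    · refine ⟨M₀ ^ (p / π), by positivity, fun f hf n hn => ?_⟩
      rw [biasExponent, max_eq_left]
      · exact sum_le_bias_of_le hτ (by linarith) hπp (by positivity) hM₀ (fun i => abs_nonneg _)
          (fun i hi => (h.range_image hn i hi).1) (hB f hf n hn)
      · exact sub_nonneg.2 (one_div_le_one_div_of_le (by linarith) hπp)
    · refine ⟨(max 1 (2 * (τ + 1))⁻¹) ^ (1 - p / π) * M₀ ^ (p / π), by positivity,
        fun f hf n hn => ?_⟩
      rw [biasExponent, max_eq_right (a := 1 / π - 1 / p), mul_zero, sub_zero]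
      · exact sum_le_bias_of_gt hτ hp0 hπp (by positivity) hM₀ (fun i => abs_nonneg _)
          (fun i hi => h.range_image hn i hi) (hB f hf n hn)
      · exact sub_nonpos.2 (one_div_le_one_div_of_le hp0 hπp.le)
  refine ⟨C * (C' + 1), by positivity, fun f hf n hn => ?_⟩
  have hX : ∀ η ∈ S n, 0 ≤ nodeScale τ (2 ^ n) (k n η) ^ (p - 2) := fun η hη =>
    Real.rpow_nonneg (h.nodeScale_pos hn hη).le _
  calc _ ≤ ∑ η ∈ S n, ENNReal.ofReal (|N.coeff f n η| ^ p *
        (C * nodeScale τ (2 ^ n) (k n η) ^ (p - 2))) := by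
        apply Finset.sum_le_sum
        intro η hη
        rw [← enorm_rpow_mul_ofReal _ hp0.le]
        gcongr
        exact (hb n hn η hη).2
    _ = ENNReal.ofReal (C * ∑ i ∈ (S n).image (k n),
        N.sortedCoeff S k f n i ^ p * nodeScale τ (2 ^ n) i ^ (p - 2)) := by
        rw [h.sum_image hn f fun i y => y ^ p * nodeScale τ (2 ^ n) i ^ (p - 2), Finset.mul_sum,
          ENNReal.ofReal_sum_of_nonneg fun η hη => by have := hX η hη; positivity]
        exact Finset.sum_congr rfl fun η _ => by congr 1; ring
    _ ≤ _ := by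
        apply ENNReal.ofReal_le_ofReal
        rw [mul_assoc]
        apply mul_le_mul_of_nonneg_left _ hC.le
        refine (hD f hf n hn).trans ?_
        gcongr
        linarith

/-- The factor `1 + n` lets one bound serve every `p`, the critical exponent included. It does no
harm: the bound only multiplies Gaussian tails, which leave a spare power of `ε`. -/
theorem HalfBound.sum_ψNormPow_le (h : N.HalfBound τ S k) {p : ℝ} (hp : 1 < p) :
    ∃ C : ℝ, 0 < C ∧ ∀ n, 1 ≤ n → ∑ η ∈ S n, N.ψNormPow p n η ≤
      ENNReal.ofReal (C * ((1 + n) *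
        max (((2 : ℝ) ^ n) ^ ((p - 2) * (τ + 1))) (((2 : ℝ) ^ n) ^ (p / 2)))) := by
  obtain ⟨c, C, hc, hC, hb⟩ := h.bounds p hp.le
  refine ⟨C, hC, fun n hn => ?_⟩
  have hX : ∀ η ∈ S n, 0 ≤ nodeScale τ (2 ^ n) (k n η) ^ (p - 2) := fun η hη =>
    Real.rpow_nonneg (h.nodeScale_pos hn hη).le _
  refine (Finset.sum_le_sum fun η hη => (hb n hn η hη).2).trans ?_
  rw [← ENNReal.ofReal_sum_of_nonneg fun η hη => mul_nonneg hC.le (hX η hη), ← Finset.mul_sum]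
  apply ENNReal.ofReal_le_ofReal
  apply mul_le_mul_of_nonneg_left _ hC.le
  have h1 := sum_rpow_le_log_mul (1 - deltaP p τ) n ((S n).image (k n)) (h.range_image hn)
  rw [Finset.sum_image (h.injOn n hn)] at h1
  calc ∑ η ∈ S n, nodeScale τ (2 ^ n) (k n η) ^ (p - 2)
      = ((2 : ℝ) ^ n) ^ ((p - 2) * (τ + 1)) *
          ∑ η ∈ S n, (k n η : ℝ) ^ (-(1 - deltaP p τ)) := by
        rw [Finset.mul_sum]
        apply Finset.sum_congr rfl
        intro η hη
        rw [nodeScale_rpow_sub_two (by positivity) (by exact_mod_cast (h.range n hn η hη).1),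
          neg_sub]
    _ ≤ ((2 : ℝ) ^ n) ^ ((p - 2) * (τ + 1)) *
          ((1 + n) * max 1 (((2 : ℝ) ^ n) ^ (1 - (1 - deltaP p τ)))) := by gcongr
    _ = _ := by
        rw [mul_left_comm, mul_max_of_nonneg _ _ (by positivity), mul_one,
          ← Real.rpow_add (by positivity)]
        congr 3
        rw [deltaP]; ring

end NeedletSystem

/-! ### Hard thresholding -/

/-- Let `|d| ≤ T/2`: a kept coefficient has `|b| ≥ T/2`, so its error `|d|` is at most `min |b| T`;
a discarded one has `|b| < 3T/2`, hence `|b| ≤ 2 min |b| T`. Let `|d| > T/2`: the error is `|d|`, or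
it is `|b| < T + |d|`. -/
theorem abs_hardThreshold_sub_le {T : ℝ} (hT : 0 ≤ T) (b d : ℝ) :
    |hardThreshold T (b + d) - b| ≤ 2 * min |b| T + 2 * (if T / 2 < |d| then |d| else 0) := by
  have htri : |b + d| ≤ |b| + |d| := abs_add_le b d
  have htri2 : |b| ≤ |b + d| + |d| := by
    have := abs_sub (b + d) d
    rwa [add_sub_cancel_right] at this
  have hb := abs_nonneg b
  have hd := abs_nonneg d
  unfold hardThreshold
  split_ifs with h1 h2 h2
  · rw [add_sub_cancel_left]
    have : 0 ≤ min |b| T := le_min hb hT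
    linarith
  · rw [add_sub_cancel_left]
    rcases min_cases |b| T with ⟨h, _⟩ | ⟨h, _⟩ <;> rw [h] <;> linarith
  · rw [zero_sub, abs_neg]
    rcases min_cases |b| T with ⟨h, _⟩ | ⟨h, _⟩ <;> rw [h] <;> linarith
  · rw [zero_sub, abs_neg]
    rcases min_cases |b| T with ⟨h, _⟩ | ⟨h, _⟩ <;> rw [h] <;> linarith

theorem enorm_hardThreshold_sub_rpow_le {p T : ℝ} (hp : 1 ≤ p) (hT : 0 ≤ T) (b d : ℝ) :
    ‖hardThreshold T (b + d) - b‖ₑ ^ p ≤ ENNReal.ofReal (4 ^ p) *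
      (ENNReal.ofReal (min |b| T ^ p) + ENNReal.ofReal (if T / 2 < |d| then |d| ^ p else 0)) := by
  have hm : 0 ≤ min |b| T := le_min (abs_nonneg b) hT
  have hi : (0 : ℝ) ≤ if T / 2 < |d| then |d| else 0 := by split_ifs <;> positivity
  have hi' : (if T / 2 < |d| then |d| else 0) ^ p = if T / 2 < |d| then |d| ^ p else 0 := by
    split_ifs
    · rfl
    · exact Real.zero_rpow (by linarith)
  have hi2 : (0 : ℝ) ≤ if T / 2 < |d| then |d| ^ p else 0 := by split_ifs <;> positivity
  rw [← ofReal_norm, ENNReal.ofReal_rpow_of_nonneg (norm_nonneg _) (by linarith),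
    ← ENNReal.ofReal_add (by positivity) hi2, ← ENNReal.ofReal_mul (by positivity)]
  apply ENNReal.ofReal_le_ofReal
  rw [Real.norm_eq_abs]
  set x := min |b| T
  set y : ℝ := if T / 2 < |d| then |d| else 0
  calc _ ≤ (2 * x + 2 * y) ^ p := by gcongr; exact abs_hardThreshold_sub_le hT b d
    _ ≤ (4 * max x y) ^ p := by
        gcongr
        linarith [le_max_left x y, le_max_right x y]
    _ = 4 ^ p * max x y ^ p := Real.mul_rpow (by norm_num) (by positivity)
    _ ≤ 4 ^ p * (x ^ p + y ^ p) := by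
        gcongr
        rcases max_cases x y with ⟨h, _⟩ | ⟨h, _⟩ <;> rw [h]
        · have := Real.rpow_nonneg hi p; linarith
        · have := Real.rpow_nonneg hm p; linarith
    _ = _ := by rw [← hi']

/-! ### The noise level and the finest level -/

theorem log_two_le_log_inv {ε : ℝ} (h0 : 0 < ε) (h1 : ε ≤ 1 / 2) : Real.log 2 ≤ Real.log (1 / ε) := by
  apply Real.log_le_log (by norm_num)
  rw [le_div_iff₀ h0]; linarith

theorem log_inv_pos {ε : ℝ} (h0 : 0 < ε) (h1 : ε ≤ 1 / 2) : 0 < Real.log (1 / ε) :=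
  (Real.log_pos (by norm_num)).trans_le (log_two_le_log_inv h0 h1)

theorem tEps_pos {ε : ℝ} (h0 : 0 < ε) (h1 : ε ≤ 1 / 2) : 0 < tEps ε :=
  mul_pos h0 (Real.sqrt_pos.2 (log_inv_pos h0 h1))

theorem tEps_lt_one {ε : ℝ} (h0 : 0 < ε) (h1 : ε ≤ 1 / 2) : tEps ε < 1 := by
  have hl : Real.log (1 / ε) ≤ 1 / ε := (Real.log_le_sub_one_of_pos (by positivity)).trans (by linarith)
  have h2 : Real.sqrt (Real.log (1 / ε)) ≤ Real.sqrt (1 / ε) := Real.sqrt_le_sqrt hl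
  have h3 : Real.sqrt (1 / ε) < 1 / ε := by
    rw [Real.sqrt_lt' (by positivity)]
    have : 1 < 1 / ε := by rw [lt_div_iff₀ h0]; linarith
    nlinarith
  calc tEps ε < ε * (1 / ε) := by unfold tEps; gcongr; linarith
    _ = 1 := by field_simp

theorem mul_le_tEps {ε : ℝ} (h0 : 0 < ε) (h1 : ε ≤ 1 / 2) :
    Real.sqrt (Real.log 2) * ε ≤ tEps ε := by
  rw [tEps, mul_comm]
  gcongr
  rw [le_div_iff₀ h0]; linarith

theorem sqrt_log_two_pos : 0 < Real.sqrt (Real.log 2) :=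
  Real.sqrt_pos.2 (Real.log_pos (by norm_num))

theorem exists_maxLevel_eq {ν ε : ℝ} (hν : -(1 / 2) < ν) (h0 : 0 < ε) (h1 : ε ≤ 1 / 2) :
    ∃ J : ℕ, maxLevel ν ε = J ∧ (2 : ℝ) ^ J ≤ tEps ε ^ (-2 / (1 + 2 * ν)) ∧
      tEps ε ^ (-2 / (1 + 2 * ν)) ≤ (2 : ℝ) ^ (J + 1) := by
  have ht := tEps_pos h0 h1
  have ht1 := tEps_lt_one h0 h1
  set Q := tEps ε ^ (-2 / (1 + 2 * ν)) with hQ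
  have hQ1 : 1 ≤ Q := Real.one_le_rpow_of_pos_of_le_one_of_nonpos ht ht1.le
    (div_nonpos_of_nonpos_of_nonneg (by norm_num) (by linarith))
  have hQ0 : 0 < Q := by linarith
  have hl : 0 ≤ Real.logb 2 Q := Real.logb_nonneg (by norm_num) hQ1
  obtain ⟨J, hJ⟩ := Int.eq_ofNat_of_zero_le (Int.floor_nonneg.2 hl)
  refine ⟨J, hJ, ?_, ?_⟩
  · have := Int.floor_le (Real.logb 2 Q)
    rw [hJ, Int.cast_natCast, Real.le_logb_iff_rpow_le (by norm_num) hQ0,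
      Real.rpow_natCast] at this
    exact this
  · have := (Int.lt_floor_add_one (Real.logb 2 Q)).le
    rw [hJ, Int.cast_natCast, Real.logb_le_iff_le_rpow (by norm_num) hQ0] at this
    exact_mod_cast this

/-- `n` is at most a multiple of `-log t_ε`, and `t_ε ≥ √(log 2) ε`; additive constants are absorbed
because `log(1/ε) ≥ log 2`. The quantity `n + 2` counts the levels `-1, …, n`. -/
theorem level_add_two_le {ν : ℝ} (hν : -(1 / 2) < ν) :
    ∃ C : ℝ, 0 < C ∧ ∀ (ε : ℝ) (n : ℕ), 0 < ε → ε ≤ 1 / 2 →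
      (2 : ℝ) ^ n ≤ tEps ε ^ (-2 / (1 + 2 * ν)) → (n : ℝ) + 2 ≤ C * Real.log (1 / ε) := by
  have hl2 : 0 < Real.log 2 := Real.log_pos (by norm_num)
  have hν' : 0 < 2 / (1 + 2 * ν) := by apply div_pos <;> linarith
  set c := |Real.log (Real.sqrt (Real.log 2))| with hc
  refine ⟨2 / (1 + 2 * ν) / Real.log 2 * (1 + c / Real.log 2) + 2 / Real.log 2, by positivity,
    fun ε n h0 h1 hn => ?_⟩
  have ht := tEps_pos h0 h1
  have hL := log_two_le_log_inv h0 h1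
  have h2 : (n : ℝ) * Real.log 2 ≤ 2 / (1 + 2 * ν) * (-Real.log (tEps ε)) := by
    have := Real.log_le_log (by positivity) hn
    rw [Real.log_pow, Real.log_rpow ht] at this
    calc _ ≤ _ := this
      _ = _ := by ring
  have h3 : -Real.log (tEps ε) ≤ Real.log (1 / ε) + c := by
    have := Real.log_le_log (mul_pos sqrt_log_two_pos h0) (mul_le_tEps h0 h1)
    rw [Real.log_mul sqrt_log_two_pos.ne' h0.ne'] at this
    rw [one_div, Real.log_inv]
    have := neg_abs_le (Real.log (Real.sqrt (Real.log 2)))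
    linarith
  have h4 : c ≤ c / Real.log 2 * Real.log (1 / ε) := by
    rw [div_mul_eq_mul_div, le_div_iff₀ hl2]
    exact mul_le_mul_of_nonneg_left hL (abs_nonneg _)
  have h5 : (n : ℝ) * Real.log 2 ≤
      2 / (1 + 2 * ν) * ((1 + c / Real.log 2) * Real.log (1 / ε)) := by
    refine h2.trans (mul_le_mul_of_nonneg_left ?_ hν'.le)
    linarith
  have h6 : (n : ℝ) ≤ 2 / (1 + 2 * ν) / Real.log 2 * (1 + c / Real.log 2) * Real.log (1 / ε) := by
    rw [← mul_le_mul_iff_of_pos_right hl2]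
    refine h5.trans (le_of_eq ?_)
    field_simp
  have h7 : 2 ≤ 2 / Real.log 2 * Real.log (1 / ε) := by
    rw [div_mul_eq_mul_div, le_div_iff₀ hl2]
    linarith
  linarith

/-- The contribution of the coefficients with a large error, at one level. -/
theorem large_error_level_le {p ν κ e δ : ℝ} (hp : 1 < p) (hν : 0 ≤ ν) (he : 0 ≤ e)
    (hκ : 16 * p * (1 + 4 * e) ≤ κ ^ 2) (hδ : 0 < δ) (hδ1 : δ ≤ 1 / 2) :
    ∃ C : ℝ, 0 < C ∧ ∀ (ε : ℝ) (n : ℕ), 0 < ε → ε ≤ 1 / 2 →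
      (2 : ℝ) ^ n ≤ tEps ε ^ (-2 / (1 + 2 * ν)) →
      (ε * ((2 : ℝ) ^ n) ^ ν) ^ p *
          Real.exp (-(1 - δ) * (κ * Real.sqrt (Real.log (1 / ε)) / 2) ^ 2 / 2) *
          ((2 : ℝ) ^ n) ^ (p * (1 + 2 * e)) ≤ C * ε ^ (p * (1 - 2 * δ)) := by
  have hp0 : 0 < p := by linarith
  set c := Real.sqrt (Real.log 2) with hc
  have hc0 : 0 < c := sqrt_log_two_pos
  refine ⟨c ^ (-(2 * p + 4 * p * e)), by positivity, fun ε n h0 h1 hn => ?_⟩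
  have ht := tEps_pos h0 h1
  have ht1 := tEps_lt_one h0 h1
  have hL := log_inv_pos h0 h1
  set N : ℝ := (2 : ℝ) ^ n with hN
  have hN0 : 0 < N := by positivity
  -- The bound on `N` reduces this to `2(ν + 1 + 2e) ≤ (1 + 2ν)(2 + 4e)`.
  have hNN : (N ^ ν) ^ p * N ^ (p * (1 + 2 * e)) ≤ tEps ε ^ (-(2 * p + 4 * p * e)) := by
    have hq : 0 < 1 + 2 * ν := by linarith
    calc (N ^ ν) ^ p * N ^ (p * (1 + 2 * e)) = N ^ (p * (ν + 1 + 2 * e)) := by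
          rw [← Real.rpow_mul hN0.le, ← Real.rpow_add hN0]; congr 1; ring
      _ ≤ (tEps ε ^ (-2 / (1 + 2 * ν))) ^ (p * (ν + 1 + 2 * e)) := by gcongr
      _ = tEps ε ^ (-2 / (1 + 2 * ν) * (p * (ν + 1 + 2 * e))) := by rw [← Real.rpow_mul ht.le]
      _ ≤ _ := by
          apply Real.rpow_le_rpow_of_exponent_ge ht ht1.le
          rw [div_mul_eq_mul_div, le_div_iff₀ hq]
          have h1 : 0 ≤ p * ν := by positivity
          have h2 : 0 ≤ p * e * ν := by positivity
          nlinarith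
  -- The tuning condition enters here, as `κ²/8 ≥ 2p(1 + 4e)`. The total power of `ε` is then `p(1 +
  -- 4e)(1 - 2δ)`.
  have hexp : Real.exp (-(1 - δ) * (κ * Real.sqrt (Real.log (1 / ε)) / 2) ^ 2 / 2) ≤
      ε ^ ((1 - δ) * (2 * p * (1 + 4 * e))) := by
    rw [Real.rpow_def_of_pos h0]
    apply Real.exp_le_exp.2
    rw [div_pow, mul_pow, Real.sq_sqrt hL.le]
    have h3 : (1 - δ) * Real.log (1 / ε) * (16 * p * (1 + 4 * e)) ≤
        (1 - δ) * Real.log (1 / ε) * κ ^ 2 :=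
      mul_le_mul_of_nonneg_left hκ (mul_nonneg (by linarith) hL.le)
    have h4 : Real.log ε = -Real.log (1 / ε) := by rw [one_div, Real.log_inv, neg_neg]
    rw [h4]
    linarith
  have htc : tEps ε ^ (-(2 * p + 4 * p * e)) ≤ (c * ε) ^ (-(2 * p + 4 * p * e)) :=
    Real.rpow_le_rpow_of_nonpos (mul_pos hc0 h0) (mul_le_tEps h0 h1)
      (by have : 0 ≤ p * e := by positivity
          linarith)
  calc (ε * N ^ ν) ^ p * Real.exp (-(1 - δ) * (κ * Real.sqrt (Real.log (1 / ε)) / 2) ^ 2 / 2) *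
        N ^ (p * (1 + 2 * e))
      = ε ^ p * Real.exp (-(1 - δ) * (κ * Real.sqrt (Real.log (1 / ε)) / 2) ^ 2 / 2) *
        ((N ^ ν) ^ p * N ^ (p * (1 + 2 * e))) := by
        rw [Real.mul_rpow h0.le (by positivity)]; ring
    _ ≤ ε ^ p * ε ^ ((1 - δ) * (2 * p * (1 + 4 * e))) * (c * ε) ^ (-(2 * p + 4 * p * e)) := by
        gcongr
        exact hNN.trans htc
    _ = c ^ (-(2 * p + 4 * p * e)) *
        ε ^ (p + (1 - δ) * (2 * p * (1 + 4 * e)) + -(2 * p + 4 * p * e)) := by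
        rw [Real.mul_rpow hc0.le h0.le, Real.rpow_add h0, Real.rpow_add h0]; ring
    _ ≤ _ := by
        gcongr ?_ * ?_
        apply Real.rpow_le_rpow_of_exponent_ge h0 (by linarith)
        have : 0 ≤ p * e * (1 - 2 * δ) := mul_nonneg (by positivity) (by linarith)
        nlinarith

theorem log_sq_mul_rpow_le {x : ℝ} (hx : 0 < x) :
    ∃ C : ℝ, 0 < C ∧ ∀ ε : ℝ, 0 < ε → ε ≤ 1 / 2 → Real.log (1 / ε) ^ 2 * ε ^ x ≤ C := by
  refine ⟨(2 / x) ^ 2, by positivity, fun ε h0 h1 => ?_⟩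
  have h2 := Real.log_le_rpow_div (by positivity : 0 ≤ 1 / ε) (half_pos hx)
  have hL := log_inv_pos h0 h1
  calc Real.log (1 / ε) ^ 2 * ε ^ x ≤ ((1 / ε) ^ (x / 2) / (x / 2)) ^ 2 * ε ^ x := by gcongr
    _ = (2 / x) ^ 2 * (((1 / ε) ^ (x / 2)) ^ 2 * ε ^ x) := by field_simp
    _ = (2 / x) ^ 2 := by
        rw [← Real.rpow_natCast ((1 / ε) ^ (x / 2)), ← Real.rpow_mul (by positivity), one_div,
          Real.inv_rpow h0.le]
        have : x / 2 * ((2 : ℕ) : ℝ) = x := by push_cast; ring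
        rw [this, inv_mul_cancel₀ (by positivity), mul_one]

/-! ### The exponents -/

theorem levelPower_nonneg (p π ν s τ : ℝ) : 0 ≤ levelPower p π ν s τ := by
  unfold levelPower; split_ifs <;> norm_num

/-- The fraction in `a` equals `(p - π)(τ + 1/2) / δ_π`, and `δ_π` is the sum of this numerator and
`δ_p`. These have the same sign, so the fraction lies in `[0, 1]`. -/
theorem levelPower_le_and_le_two {p π ν s τ : ℝ} (hτ : -(1 / 2) < τ) :
    levelPower p π ν s τ ≤ logPower₁ p π ν s τ ∧ logPower₁ p π ν s τ ≤ 2 := by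
  unfold levelPower logPower₁
  have hd : 1 - (p - 2) * (τ + 1 / 2) = deltaP p τ := rfl
  rw [hd]
  by_cases hc : (p - π) * deltaP p τ ≤ 0
  · rw [if_pos hc, if_pos hc]
    refine ⟨le_rfl, ?_⟩
    split_ifs <;> norm_num
  · rw [if_neg hc, if_neg hc]
    push Not at hc
    have hH : 0 < τ + 1 / 2 := by linarith
    have hadd := deltaP_add p π τ
    have hfrac : 0 ≤ (τ + 1 / 2) * (π - p) / ((π - 2) * (τ + 1 / 2) - 1) ∧
        (τ + 1 / 2) * (π - p) / ((π - 2) * (τ + 1 / 2) - 1) ≤ 1 := by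
      have e : (τ + 1 / 2) * (π - p) / ((π - 2) * (τ + 1 / 2) - 1) =
          (p - π) * (τ + 1 / 2) / deltaP π τ := by
        rw [← neg_div_neg_eq, deltaP]; congr 1 <;> ring
      rw [e]
      rcases pos_and_pos_or_neg_and_neg_of_mul_pos hc with ⟨h1, h2⟩ | ⟨h1, h2⟩
      · have h3 := mul_pos h1 hH
        have h4 : 0 < deltaP π τ := by linarith
        exact ⟨by positivity, by rw [div_le_one h4]; linarith⟩
      · have h3 := mul_neg_of_neg_of_pos h1 hH
        have h4 : deltaP π τ < 0 := by linarith
        exact ⟨(div_pos_of_neg_of_neg h3 h4).le, by rw [div_le_one_of_neg h4]; linarith⟩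
    split_ifs <;> constructor <;> linarith [hfrac.1, hfrac.2]

/-- The fourth part says that the finest level is fine enough: with `2^J` of order `t^{-1/(ν+1/2)}`
the bias is `O(t^μ)`. For `rate₁` it means that the denominator is at least `ν + 1/2`, which is what
the first term of `smoothnessThreshold` provides. -/
theorem rate_bounds {p π ν s τ : ℝ} (hν : -(1 / 2) < ν)
    (hs : smoothnessThreshold p π τ < s) :
    0 < rate₀ ν s ∧ rate₀ ν s < 1 ∧ 0 < rate₁ p π ν s τ ∧
      min (rate₀ ν s) (rate₁ p π ν s τ) * (ν + 1 / 2) ≤ NeedletSystem.biasExponent p π s τ ∧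
      0 < NeedletSystem.biasExponent p π s τ := by
  unfold smoothnessThreshold at hs
  have hs1 : 1 / 2 - 2 * (τ + 1) * (1 / 2 - 1 / π) < s :=
    ((le_max_left _ _).trans (le_max_left _ _)).trans_lt hs
  have hs2 : 2 * (τ + 1) * (1 / π - 1 / p) < s :=
    ((le_max_right _ _).trans (le_max_left _ _)).trans_lt hs
  have hs0 : 0 < s := (le_max_right _ _).trans_lt hs
  have hd0 : 0 < s + ν + 1 / 2 := by linarith
  have hd1 : 0 < s + ν + 2 * (1 + τ) * (1 / 2 - 1 / π) := by linarith
  have hn1 : 0 < s - 2 * (1 + τ) * (1 / π - 1 / p) := by linarith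
  have hν' : 0 < ν + 1 / 2 := by linarith
  refine ⟨div_pos hs0 hd0, (div_lt_one hd0).2 (by linarith), div_pos hn1 hd1, ?_, ?_⟩
  · rw [NeedletSystem.biasExponent]
    rcases le_total (1 / π - 1 / p) 0 with h | h
    · rw [max_eq_right h, mul_zero, sub_zero]
      calc _ ≤ rate₀ ν s * (ν + 1 / 2) := by gcongr; exact min_le_left _ _
        _ ≤ s := by
          rw [rate₀, div_mul_eq_mul_div, div_le_iff₀ hd0]
          nlinarith
    · rw [max_eq_left h]
      calc _ ≤ rate₁ p π ν s τ * (ν + 1 / 2) := by gcongr; exact min_le_right _ _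
        _ ≤ s - 2 * (1 + τ) * (1 / π - 1 / p) := by
          rw [rate₁, div_mul_eq_mul_div, div_le_iff₀ hd1]
          apply mul_le_mul_of_nonneg_left _ hn1.le
          linarith
  · rw [NeedletSystem.biasExponent]
    rcases le_total (1 / π - 1 / p) 0 with h | h
    · rw [max_eq_right h, mul_zero, sub_zero]; exact hs0
    · rw [max_eq_left h]; exact hn1

namespace NeedletSystem

variable {γ : Measure ℝ} {N : NeedletSystem γ}

/-! ### The loss at one level -/

theorem SynthesisBound.rpow_le (h : N.SynthesisBound) {p : ℝ} (hp : 1 ≤ p) :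
    ∃ C : ℝ, 0 < C ∧ ∀ j : ℤ, -1 ≤ j → ∀ u : ℝ → ℝ,
      eLpNorm (fun x => ∑ η ∈ N.Z j, u η * N.ψ j η x) (ENNReal.ofReal p) γ ^ p ≤
        ENNReal.ofReal C * ∑ η ∈ N.Z j, ‖u η‖ₑ ^ p * N.ψNormPow p j η := by
  obtain ⟨C, hC, h⟩ := h p hp
  have hp0 : 0 < p := by linarith
  refine ⟨max (C ^ p) 1, by positivity, fun j hj u => ?_⟩
  rcases hj.eq_or_lt with rfl | hj
  · obtain ⟨z, hz⟩ := Finset.card_eq_one.1 N.card_Z_neg_one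
    simp only [hz, Finset.sum_singleton]
    have : (fun x => u z * N.ψ (-1) z x) = u z • N.ψ (-1) z := rfl
    rw [this, eLpNorm_const_smul, ENNReal.mul_rpow_of_nonneg _ _ hp0.le]
    calc ‖u z‖ₑ ^ p * eLpNorm (N.ψ (-1) z) (ENNReal.ofReal p) γ ^ p
        = ENNReal.ofReal 1 * (‖u z‖ₑ ^ p * N.ψNormPow p (-1) z) := by
          rw [ENNReal.ofReal_one, one_mul]; rfl
      _ ≤ _ := by gcongr; exact le_max_right _ _
  · calc _ ≤ (ENNReal.ofReal C * (∑ η ∈ N.Z j, ‖u η‖ₑ ^ p * N.ψNormPow p j η) ^ (1 / p)) ^ p := by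
          gcongr; exact h j (by omega) u
      _ = ENNReal.ofReal (C ^ p) * ∑ η ∈ N.Z j, ‖u η‖ₑ ^ p * N.ψNormPow p j η := by
          rw [ENNReal.mul_rpow_of_nonneg _ _ hp0.le, ← ENNReal.rpow_mul,
            one_div_mul_cancel hp0.ne', ENNReal.rpow_one, ENNReal.ofReal_rpow_of_pos hC]
      _ ≤ _ := by gcongr; exact le_max_left _ _

theorem eLpNorm_level_le [IsProbabilityMeasure γ] (hsynth : N.SynthesisBound)
    {S S' : ℕ → Finset ℝ} {k k' : ℕ → ℝ → ℕ} {τ τ' : ℝ}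
    (h : N.HalfBound τ S k) (h' : N.HalfBound τ' S' k')
    (hSS' : ∀ n, ∀ F : ℝ → ℝ≥0∞, ∑ η ∈ S n, F η + ∑ η ∈ S' n, F η = ∑ η ∈ N.Z n, F η)
    {p π s M x : ℝ} {r : ℝ≥0∞} (hτ : -(1 / 2) < τ) (hτ' : -(1 / 2) < τ') (hp : 1 < p)
    (hπ : 1 ≤ π) (hr : 0 < r) (hM : 0 ≤ M) (hx : x ≤ biasExponent p π s τ)
    (hx' : x ≤ biasExponent p π s τ') :
    ∃ C : ℝ, 0 < C ∧ ∀ f ∈ N.besovBall s π r M, ∀ n : ℕ, 1 ≤ n →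
      eLpNorm (fun x => ∑ η ∈ N.Z n, N.coeff f n η * N.ψ n η x) (ENNReal.ofReal p) γ ≤
        ENNReal.ofReal (C * ((2 : ℝ) ^ n) ^ (-x)) := by
  obtain ⟨A, hA, HA⟩ := hsynth.rpow_le hp.le
  obtain ⟨B, hB, HB⟩ := h.sum_coeff_le (s := s) hτ hp hπ hr hM
  obtain ⟨B', hB', HB'⟩ := h'.sum_coeff_le (s := s) hτ' hp hπ hr hM
  have hp0 : 0 < p := by linarith
  refine ⟨(A * (B + B')) ^ (1 / p), by positivity, fun f hf n hn => ?_⟩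
  have h2 : (1 : ℝ) ≤ 2 ^ n := one_le_pow₀ (by norm_num)
  have key : eLpNorm (fun x => ∑ η ∈ N.Z n, N.coeff f n η * N.ψ n η x) (ENNReal.ofReal p) γ ^ p ≤
      ENNReal.ofReal (A * (B + B') * ((2 : ℝ) ^ n) ^ (-(p * x))) := by
    calc _ ≤ ENNReal.ofReal A * ∑ η ∈ N.Z n, ‖N.coeff f n η‖ₑ ^ p * N.ψNormPow p n η :=
          HA n (by omega) _
      _ ≤ ENNReal.ofReal A * (ENNReal.ofReal (B * ((2 : ℝ) ^ n) ^ (-(p * x))) +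
            ENNReal.ofReal (B' * ((2 : ℝ) ^ n) ^ (-(p * x)))) := by
          rw [← hSS']
          gcongr
          · refine (HB f hf n hn).trans ?_
            gcongr
          · refine (HB' f hf n hn).trans ?_
            gcongr
      _ = _ := by
          rw [← ENNReal.ofReal_add (by positivity) (by positivity),
            ← ENNReal.ofReal_mul hA.le]
          congr 1; ring
  have := ENNReal.rpow_le_rpow key (z := 1 / p) (by positivity)
  rw [← ENNReal.rpow_mul, mul_one_div_cancel hp0.ne', ENNReal.rpow_one,
    ENNReal.ofReal_rpow_of_pos (by positivity), Real.mul_rpow (by positivity) (by positivity),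
    ← Real.rpow_mul (by positivity)] at this
  convert this using 4
  field_simp

theorem aestronglyMeasurable_level [IsProbabilityMeasure γ] (hγ : ∀ᵐ x ∂γ, x ∈ Set.Icc (-1 : ℝ) 1)
    {j : ℤ} (hj : -1 ≤ j) (u : ℝ → ℝ) :
    AEStronglyMeasurable (fun x => ∑ η ∈ N.Z j, u η * N.ψ j η x) γ :=
  Finset.aestronglyMeasurable_fun_sum _ fun η _ =>
    (N.aestronglyMeasurable_ψ hγ hj η).const_mul _

theorem aestronglyMeasurable_partialSum [IsProbabilityMeasure γ]
    (hγ : ∀ᵐ x ∂γ, x ∈ Set.Icc (-1 : ℝ) 1) (f : Lp ℝ 2 γ) (J : ℤ) :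
    AEStronglyMeasurable (fun x => N.partialSum f J x) γ :=
  Finset.aestronglyMeasurable_fun_sum _ fun _ hj =>
    aestronglyMeasurable_level hγ (Finset.mem_Icc.1 hj).1 _

/-- Triangle inequality and geometric series. In `key` the difference of two powers is the exact
value of the finite geometric sum, so the induction closes. -/
theorem eLpNorm_partialSum_sub_le [IsProbabilityMeasure γ]
    (hγ : ∀ᵐ x ∂γ, x ∈ Set.Icc (-1 : ℝ) 1) {f : Lp ℝ 2 γ} {q : ℝ≥0∞} (hq : 1 ≤ q) {C x : ℝ}
    (hC : 0 ≤ C) (hx : 0 < x)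
    (h : ∀ n : ℕ, 1 ≤ n → eLpNorm (fun x => ∑ η ∈ N.Z n, N.coeff f n η * N.ψ n η x) q γ ≤
      ENNReal.ofReal (C * ((2 : ℝ) ^ n) ^ (-x))) (J : ℕ) :
    eLpNorm (fun x => N.partialSum f J x - f x) q γ ≤
      ENNReal.ofReal (C / (2 ^ x - 1) * ((2 : ℝ) ^ J) ^ (-x)) := by
  have h2x : (1 : ℝ) < 2 ^ x := Real.one_lt_rpow (by norm_num) hx
  have hD : 0 ≤ C / (2 ^ x - 1) := div_nonneg hC (by linarith)
  refine N.eLpNorm_sub_partialSum_le hγ f J q _ fun n hn => ?_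
  have key : eLpNorm (fun x => N.partialSum f n x - N.partialSum f J x) q γ ≤
      ENNReal.ofReal (C / (2 ^ x - 1) * (((2 : ℝ) ^ J) ^ (-x) - ((2 : ℝ) ^ n) ^ (-x))) := by
    induction n, hn using Nat.le_induction with
    | base => simp
    | succ n hn ih =>
      have hmono : ((2 : ℝ) ^ n) ^ (-x) ≤ ((2 : ℝ) ^ J) ^ (-x) :=
        Real.rpow_le_rpow_of_nonpos (by positivity)
          (pow_le_pow_right₀ (by norm_num) hn) (by linarith)
      have hstep : ((2 : ℝ) ^ n) ^ (-x) = 2 ^ x * ((2 : ℝ) ^ (n + 1)) ^ (-x) := by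
        rw [pow_succ, Real.mul_rpow (by positivity) (by norm_num), mul_left_comm,
          ← Real.rpow_add (by norm_num), add_neg_cancel, Real.rpow_zero, mul_one]
      have e : (fun x => N.partialSum f ((n + 1 : ℕ) : ℤ) x - N.partialSum f J x) =
          (fun x => N.partialSum f n x - N.partialSum f J x) +
            fun x => ∑ η ∈ N.Z ((n + 1 : ℕ) : ℤ), N.coeff f ((n + 1 : ℕ) : ℤ) η *
              N.ψ ((n + 1 : ℕ) : ℤ) η x := by
        ext y
        simp only [Pi.add_apply]
        push_cast
        rw [N.partialSum_succ f (by omega)]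
        ring
      rw [e]
      calc _ ≤ _ := eLpNorm_add_le ((aestronglyMeasurable_partialSum hγ f n).sub
              (aestronglyMeasurable_partialSum hγ f J))
              (aestronglyMeasurable_level hγ (by omega) _) hq
        _ ≤ _ := add_le_add ih (h (n + 1) (by omega))
        _ = _ := by
            rw [← ENNReal.ofReal_add (mul_nonneg hD (by linarith)) (by positivity)]
            congr 1
            rw [hstep]
            have : (2 : ℝ) ^ x - 1 ≠ 0 := by linarith
            field_simp
            ring
  refine key.trans (ENNReal.ofReal_le_ofReal ?_)
  gcongr
  have : 0 ≤ ((2 : ℝ) ^ n) ^ (-x) := by positivity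
  linarith

/-- The stochastic error of one level is controlled by truncated coefficients and a Gaussian
tail. -/
theorem exists_level_majorant [IsProbabilityMeasure γ] (hγ : ∀ᵐ x ∂γ, x ∈ Set.Icc (-1 : ℝ) 1)
    (hsynth : N.SynthesisBound) {G : Type*} [NormedAddCommGroup G] [InnerProductSpace ℝ G]
    [CompleteSpace G] {K : Lp ℝ 2 γ →L[ℝ] G} {g : ℕ → G} {b : ℕ → ℝ}
    (hK : IsSVD K N.basis g b) (hb : ∀ i, b i ≠ 0) {p δ : ℝ} (hp : 1 ≤ p) (hδ : 0 < δ)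
    (hδ1 : δ < 1) :
    ∃ C : ℝ, 0 < C ∧ ∀ (Ω : Type*) [MeasurableSpace Ω] (P : Measure Ω) [IsProbabilityMeasure P]
      (W : G → Ω → ℝ), IsWhiteNoise W P → ∀ (ε l : ℝ), 0 ≤ ε → 0 ≤ l → ∀ (f : Lp ℝ 2 γ) (j : ℤ),
      -1 ≤ j → ∃ U : Ω → ℝ≥0∞, AEMeasurable U P ∧
      (∀ ω, eLpNorm (fun x => ∑ η ∈ N.Z j,
          (hardThreshold (2 * (ε * N.σ b j * l)) (N.empCoeff b (observation K g W ε f ω) j η) -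
            N.coeff f j η) * N.ψ j η x) (ENNReal.ofReal p) γ ^ p ≤ U ω) ∧
      ∫⁻ ω, U ω ∂P ≤
        ENNReal.ofReal C * ∑ η ∈ N.Z j,
          (ENNReal.ofReal (min |N.coeff f j η| (2 * (ε * N.σ b j * l)) ^ p) +
            ENNReal.ofReal ((ε * N.σ b j) ^ p * Real.exp (-(1 - δ) * l ^ 2 / 2))) *
              N.ψNormPow p j η := by
  obtain ⟨A, hA, HA⟩ := hsynth.rpow_le hp
  obtain ⟨B, hB, HB⟩ := lintegral_tail_le (p := p) (δ := δ) (by linarith) hδ hδ1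
  have h4 : (0 : ℝ) < 4 ^ p := by positivity
  refine ⟨A * 4 ^ p * max B 1, by positivity, fun Ω _ P _ W hW ε l hε hl f j hj => ?_⟩
  have hσ : 0 ≤ N.σ b j := Real.sqrt_nonneg _
  set s := ε * N.σ b j with hs
  have hs0 : 0 ≤ s := by positivity
  set T := 2 * (s * l) with hT
  have hT0 : 0 ≤ T := by positivity
  have hT2 : T / 2 = s * l := by rw [hT]; ring
  set D : ℝ → Ω → ℝ := fun η ω => ∑ i ∈ Finset.range (2 ^ j.toNat),
    ε * (N.ψCoeff j η i / b i) * W (g i) ω with hD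
  have hDm : ∀ η, AEMeasurable (D η) P := fun η =>
    (hW.hasGaussianLaw_sum g (fun i => ε * (N.ψCoeff j η i / b i)) _).aemeasurable
  set tail : ℝ → Ω → ℝ≥0∞ := fun η ω =>
    ENNReal.ofReal (if T / 2 < |D η ω| then |D η ω| ^ p else 0) with htail
  have htm : ∀ η, AEMeasurable (tail η) P := by
    intro η
    have : Measurable fun y : ℝ => ENNReal.ofReal (if T / 2 < |y| then |y| ^ p else 0) := by
      refine ENNReal.measurable_ofReal.comp (Measurable.ite ?_ (by fun_prop) measurable_const)
      exact measurableSet_lt measurable_const (by fun_prop)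
    exact this.comp_aemeasurable (hDm η)
  have htail_le : ∀ η ∈ N.Z j, ∫⁻ ω, tail η ω ∂P ≤
      ENNReal.ofReal (max B 1 * (s ^ p * Real.exp (-(1 - δ) * l ^ 2 / 2))) := by
    intro η hη
    have := HB Ω P (D η) _ s l (hDm η) (hW.map_sum hK.orthonormal _ _) hs0 ?_ hl
    · simp only [htail, hT2]
      refine this.trans (ENNReal.ofReal_le_ofReal ?_)
      rw [mul_assoc]
      gcongr
      exact le_max_left _ _
    · rw [Real.coe_toNNReal _ (Finset.sum_nonneg fun _ _ => sq_nonneg _)]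
      calc ∑ i ∈ Finset.range (2 ^ j.toNat), (ε * (N.ψCoeff j η i / b i)) ^ 2
          = ε ^ 2 * ∑ i ∈ Finset.range (2 ^ j.toNat), (N.ψCoeff j η i / b i) ^ 2 := by
            rw [Finset.mul_sum]
            exact Finset.sum_congr rfl fun i _ => mul_pow _ _ 2
        _ ≤ ε ^ 2 * N.σ b j ^ 2 :=
            mul_le_mul_of_nonneg_left (N.sum_ψCoeff_div_le_σ_sq hγ b hj hη) (sq_nonneg _)
        _ = s ^ 2 := (mul_pow _ _ 2).symm
  set m : ℝ → ℝ≥0∞ := fun η => ENNReal.ofReal (min |N.coeff f j η| T ^ p) with hm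
  have hUm : ∀ η ∈ N.Z j, AEMeasurable (fun ω => (m η + tail η ω) * N.ψNormPow p j η) P :=
    fun η _ => ((htm η).const_add _).mul_const _
  -- The majorant is visibly measurable in `ω`, so measurability of the loss itself is never
  -- required.
  refine ⟨fun ω => ENNReal.ofReal (A * 4 ^ p) * ∑ η ∈ N.Z j,
    (m η + tail η ω) * N.ψNormPow p j η, (Finset.aemeasurable_fun_sum _ hUm).const_mul _,
    fun ω => ?_, ?_⟩
  · refine (HA j hj _).trans ?_
    beta_reduce
    rw [ENNReal.ofReal_mul hA.le, mul_assoc (ENNReal.ofReal A),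
      Finset.mul_sum _ _ (ENNReal.ofReal (4 ^ p))]
    refine mul_le_mul' le_rfl (Finset.sum_le_sum fun η hη => ?_)
    rw [← mul_assoc]
    refine mul_le_mul' ?_ le_rfl
    rw [N.empCoeff_observation hγ hK hb W ε f ω hj η]
    exact enorm_hardThreshold_sub_rpow_le hp hT0 _ _
  calc _ = ENNReal.ofReal (A * 4 ^ p) * ∑ η ∈ N.Z j,
          (m η + ∫⁻ ω, tail η ω ∂P) * N.ψNormPow p j η := by
        rw [lintegral_const_mul' _ _ ENNReal.ofReal_ne_top, lintegral_finsetSum' _ hUm]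
        · congr 1
          refine Finset.sum_congr rfl fun η _ => ?_
          rw [lintegral_mul_const'' _ ((htm η).const_add _), lintegral_add_left measurable_const]
          simp
    _ ≤ ENNReal.ofReal (A * 4 ^ p) * ∑ η ∈ N.Z j, ENNReal.ofReal (max B 1) *
          ((m η + ENNReal.ofReal (s ^ p * Real.exp (-(1 - δ) * l ^ 2 / 2))) *
            N.ψNormPow p j η) := by
        refine mul_le_mul' le_rfl (Finset.sum_le_sum fun η hη => ?_)
        rw [← mul_assoc]
        refine mul_le_mul' ?_ le_rfl
        rw [mul_add]
        refine add_le_add ?_ ((htail_le η hη).trans_eq (ENNReal.ofReal_mul (by positivity)))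
        refine le_mul_of_one_le_left' ?_
        exact ENNReal.one_le_ofReal.2 (le_max_right _ _)
    _ = _ := by
        rw [← Finset.mul_sum, ← mul_assoc, ← ENNReal.ofReal_mul (by positivity)]

theorem HalfBound.sum_min_threshold_le {τ : ℝ} {S : ℕ → Finset ℝ} {k : ℕ → ℝ → ℕ}
    (h : N.HalfBound τ S k) {p π s ν M A : ℝ} {r : ℝ≥0∞}
    (hτ : -(1 / 2) < τ) (hν : -(1 / 2) < ν) (hp : 1 < p) (hπ : 1 ≤ π)
    (hs : smoothnessThreshold p π τ < s) (hr : 0 < r) (hM : 0 ≤ M) (hA : 1 ≤ A) :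
    ∃ C : ℝ, 0 < C ∧ ∀ f ∈ N.besovBall s π r M, ∀ (t : ℝ) (m : ℕ) (T : ℕ → ℝ), 0 < t → t < 1 →
      (∀ n, 1 ≤ n → 0 ≤ T n ∧ T n ≤ A * (t * ((2 : ℝ) ^ n) ^ ν)) →
      ∑ n ∈ Finset.Icc 1 m, ∑ η ∈ S n,
          ENNReal.ofReal (min |N.coeff f n η| (T n) ^ p) * N.ψNormPow p n η ≤
        ENNReal.ofReal (C * ((m : ℝ) + 2) ^ levelPower p π ν s τ *
          t ^ (p * min (rate₀ ν s) (rate₁ p π ν s τ))) := by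
  obtain ⟨C, hC, H⟩ := h.sum_min_le hτ hν hp hπ hs hr hM
  refine ⟨A ^ p * C, by positivity, fun f hf t m T ht ht1 hT => ?_⟩
  have hp0 : 0 ≤ p := by linarith
  calc _ ≤ ∑ n ∈ Finset.Icc 1 m, ∑ η ∈ S n, ENNReal.ofReal (A ^ p) *
        (ENNReal.ofReal (min |N.coeff f n η| (t * ((2 : ℝ) ^ n) ^ ν) ^ p) *
          N.ψNormPow p n η) := by
        refine Finset.sum_le_sum fun n hn => Finset.sum_le_sum fun η _ => ?_
        obtain ⟨h1, h2⟩ := hT n (Finset.mem_Icc.1 hn).1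
        rw [← mul_assoc, ← ENNReal.ofReal_mul (by positivity),
          ← Real.mul_rpow (by positivity) (le_min (abs_nonneg _) (by positivity))]
        refine mul_le_mul' (ENNReal.ofReal_le_ofReal (Real.rpow_le_rpow
          (le_min (abs_nonneg _) h1) ?_ hp0)) le_rfl
        rw [mul_min_of_nonneg _ _ (by positivity)]
        exact min_le_min (le_mul_of_one_le_left (abs_nonneg _) hA) h2
    _ = ENNReal.ofReal (A ^ p) * ∑ n ∈ Finset.Icc 1 m, ∑ η ∈ S n,
        (ENNReal.ofReal (min |N.coeff f n η| (t * ((2 : ℝ) ^ n) ^ ν) ^ p) *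
          N.ψNormPow p n η) := by
        simp only [Finset.mul_sum]
    _ ≤ _ := mul_le_mul' le_rfl (H f hf t m ht ht1)
    _ = _ := by
        rw [← ENNReal.ofReal_mul (by positivity)]
        congr 1; ring

/-- With `δ = (1 - ρ)/4` a level contributes `O((m + 2) ε^{p(1+ρ)/2})`. The spare factor
`ε^{p(1-ρ)/2}` absorbs `m(m + 2) = O(log²(1/ε))`. -/
theorem HalfBound.sum_tail_le {τ : ℝ} {S : ℕ → Finset ℝ} {k : ℕ → ℝ → ℕ}
    (h : N.HalfBound τ S k) {p ν κ e ρ A : ℝ} (hp : 1 < p) (hν : 0 ≤ ν) (he : excess p τ ≤ e)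
    (hκ : 16 * p * (1 + 4 * e) ≤ κ ^ 2) (hρ0 : 0 < ρ) (hρ : ρ < 1) (hA : 0 < A) :
    ∃ C : ℝ, 0 < C ∧ ∀ (ε : ℝ) (m : ℕ) (v : ℕ → ℝ), 0 < ε → ε ≤ 1 / 2 →
      (2 : ℝ) ^ m ≤ tEps ε ^ (-2 / (1 + 2 * ν)) →
      (∀ n, 1 ≤ n → 0 ≤ v n ∧ v n ≤ A * ((2 : ℝ) ^ n) ^ ν) →
      ∑ n ∈ Finset.Icc 1 m, ∑ η ∈ S n, ENNReal.ofReal ((ε * v n) ^ p *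
          Real.exp (-(1 - (1 - ρ) / 4) * (κ * Real.sqrt (Real.log (1 / ε)) / 2) ^ 2 / 2)) *
            N.ψNormPow p n η ≤
        ENNReal.ofReal (C * ε ^ (p * ρ)) := by
  have he0 : 0 ≤ e := (le_max_right _ _).trans he
  have hp0 : 0 < p := by linarith
  obtain ⟨B, hB, HB⟩ := h.sum_ψNormPow_le hp
  obtain ⟨D, hD, HD⟩ := large_error_level_le (κ := κ) (δ := (1 - ρ) / 4) hp hν he0 hκ
    (by linarith) (by linarith)
  obtain ⟨E, hE, HE⟩ := level_add_two_le (ν := ν) (by linarith)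
  obtain ⟨F, hF, HF⟩ := log_sq_mul_rpow_le (x := p * ((1 - ρ) / 2))
    (mul_pos hp0 (by linarith))
  refine ⟨A ^ p * B * D * E ^ 2 * F, by positivity, fun ε m v h0 h1 hm hv => ?_⟩
  set Q := Real.exp (-(1 - (1 - ρ) / 4) * (κ * Real.sqrt (Real.log (1 / ε)) / 2) ^ 2 / 2) with hQ
  have hQ0 : 0 < Q := Real.exp_pos _
  have hlevel : ∀ n ∈ Finset.Icc 1 m, ∑ η ∈ S n, ENNReal.ofReal ((ε * v n) ^ p * Q) *
      N.ψNormPow p n η ≤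
        ENNReal.ofReal (A ^ p * B * D * ((m : ℝ) + 2) * ε ^ (p * (1 - 2 * ((1 - ρ) / 4)))) := by
    intro n hn
    obtain ⟨hn1, hnm⟩ := Finset.mem_Icc.1 hn
    obtain ⟨hv0, hv1⟩ := hv n hn1
    have h2 : (1 : ℝ) ≤ 2 ^ n := one_le_pow₀ (by norm_num)
    have hn' : (n : ℝ) ≤ m := by exact_mod_cast hnm
    have hmax : max (((2 : ℝ) ^ n) ^ ((p - 2) * (τ + 1))) (((2 : ℝ) ^ n) ^ (p / 2)) ≤
        ((2 : ℝ) ^ n) ^ (p * (1 + 2 * e)) := by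
      refine max_le ?_ ?_
      · refine Real.rpow_le_rpow_of_exponent_le h2 ?_
        have : τ / 2 - (τ + 1) / p ≤ e := (le_max_left _ _).trans he
        -- `excess` is defined so that, before truncation at `0`, `p (1 + 2 excess)` is the exponent
        -- `(p - 2)(τ + 1)` of the sum of the norms.
        have h3 : p * (1 + 2 * (τ / 2 - (τ + 1) / p)) = (p - 2) * (τ + 1) := by
          field_simp; ring
        rw [← h3]; gcongr
      · refine Real.rpow_le_rpow_of_exponent_le h2 ?_
        nlinarith
    rw [← Finset.mul_sum]
    calc _ ≤ _ := mul_le_mul' le_rfl (HB n hn1)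
      _ = ENNReal.ofReal ((ε * v n) ^ p * Q * (B * ((1 + (n : ℝ)) *
            max (((2 : ℝ) ^ n) ^ ((p - 2) * (τ + 1))) (((2 : ℝ) ^ n) ^ (p / 2))))) := by
          rw [← ENNReal.ofReal_mul (by positivity)]
      _ ≤ ENNReal.ofReal ((ε * (A * ((2 : ℝ) ^ n) ^ ν)) ^ p * Q * (B * (((m : ℝ) + 2) *
            ((2 : ℝ) ^ n) ^ (p * (1 + 2 * e))))) := by
          refine ENNReal.ofReal_le_ofReal (mul_le_mul ?_ ?_ (by positivity) (by positivity))
          · gcongr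
          · refine mul_le_mul_of_nonneg_left ?_ hB.le
            exact mul_le_mul (by linarith) hmax (by positivity) (by positivity)
      _ = ENNReal.ofReal (A ^ p * B * ((m : ℝ) + 2) * ((ε * ((2 : ℝ) ^ n) ^ ν) ^ p * Q *
            ((2 : ℝ) ^ n) ^ (p * (1 + 2 * e)))) := by
          rw [show ε * (A * ((2 : ℝ) ^ n) ^ ν) = A * (ε * ((2 : ℝ) ^ n) ^ ν) by ring,
            Real.mul_rpow hA.le (by positivity)]
          congr 1; ring
      _ ≤ ENNReal.ofReal (A ^ p * B * ((m : ℝ) + 2) *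
            (D * ε ^ (p * (1 - 2 * ((1 - ρ) / 4))))) := by
          refine ENNReal.ofReal_le_ofReal (mul_le_mul_of_nonneg_left ?_ (by positivity))
          refine HD ε n h0 h1 (le_trans ?_ hm)
          exact pow_le_pow_right₀ (by norm_num) hnm
      _ = _ := by congr 1; ring
  calc _ ≤ ∑ n ∈ Finset.Icc 1 m, ENNReal.ofReal
          (A ^ p * B * D * ((m : ℝ) + 2) * ε ^ (p * (1 - 2 * ((1 - ρ) / 4)))) :=
        Finset.sum_le_sum hlevel
    _ = ENNReal.ofReal (m * (A ^ p * B * D * ((m : ℝ) + 2) *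
          ε ^ (p * (1 - 2 * ((1 - ρ) / 4))))) := by
        rw [Finset.sum_const, Nat.card_Icc, Nat.add_sub_cancel, nsmul_eq_mul,
          ENNReal.ofReal_mul (Nat.cast_nonneg _), ENNReal.ofReal_natCast]
    _ ≤ ENNReal.ofReal (A ^ p * B * D * E ^ 2 * F * ε ^ (p * ρ)) := by
        refine ENNReal.ofReal_le_ofReal ?_
        have hL := log_inv_pos h0 h1
        have hE2 := HE ε m h0 h1 hm
        have hF2 := HF ε h0 h1
        have hm0 : (0 : ℝ) ≤ m := Nat.cast_nonneg _
        have hsq : (m : ℝ) * (m + 2) ≤ (E * Real.log (1 / ε)) ^ 2 := by nlinarith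
        have hsplit : ε ^ (p * (1 - 2 * ((1 - ρ) / 4))) =
            ε ^ (p * ((1 - ρ) / 2)) * ε ^ (p * ρ) := by
          rw [← Real.rpow_add h0]; congr 1; ring
        rw [hsplit]
        calc _ = A ^ p * B * D * (m * (m + 2)) * ε ^ (p * ((1 - ρ) / 2)) * ε ^ (p * ρ) := by ring
          _ ≤ A ^ p * B * D * (E * Real.log (1 / ε)) ^ 2 * ε ^ (p * ((1 - ρ) / 2)) *
              ε ^ (p * ρ) := by gcongr
          _ = A ^ p * B * D * E ^ 2 * (Real.log (1 / ε) ^ 2 * ε ^ (p * ((1 - ρ) / 2))) *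
              ε ^ (p * ρ) := by ring
          _ ≤ _ := by gcongr

end NeedletSystem

/-! ### The total of the levels -/

theorem log_inv_rpow_le {x y : ℝ} (hxy : x ≤ y) {ε : ℝ} (h0 : 0 < ε) (h1 : ε ≤ 1 / 2) :
    Real.log (1 / ε) ^ x ≤ Real.log 2 ^ (x - y) * Real.log (1 / ε) ^ y := by
  have hL := log_inv_pos h0 h1
  have h2 : 0 < Real.log 2 := Real.log_pos (by norm_num)
  calc Real.log (1 / ε) ^ x = Real.log (1 / ε) ^ (x - y) * Real.log (1 / ε) ^ y := by
        rw [← Real.rpow_add hL, sub_add_cancel]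
    _ ≤ _ := by
        gcongr ?_ * _
        exact Real.rpow_le_rpow_of_nonpos h2 (log_two_le_log_inv h0 h1) (by linarith)

theorem rpow_le_tEps_rpow {x : ℝ} (hx : 0 ≤ x) {ε : ℝ} (h0 : 0 < ε) (h1 : ε ≤ 1 / 2) :
    ε ^ x ≤ (Real.sqrt (Real.log 2))⁻¹ ^ x * tEps ε ^ x := by
  have h2 := sqrt_log_two_pos
  rw [← Real.mul_rpow (by positivity) (tEps_pos h0 h1).le]
  gcongr
  rw [inv_mul_eq_div, le_div_iff₀ h2, mul_comm]
  exact mul_le_tEps h0 h1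

theorem two_pow_rpow_neg_le {ν x ρ : ℝ} (hν : 0 ≤ ν) (hx : 0 ≤ x) (hρ : ρ * (ν + 1 / 2) ≤ x)
    {ε : ℝ} (h0 : 0 < ε) (h1 : ε ≤ 1 / 2) {J : ℕ}
    (hJ : tEps ε ^ (-2 / (1 + 2 * ν)) ≤ (2 : ℝ) ^ (J + 1)) :
    ((2 : ℝ) ^ J) ^ (-x) ≤ 2 ^ x * tEps ε ^ ρ := by
  have ht := tEps_pos h0 h1
  have ht1 := tEps_lt_one h0 h1
  calc ((2 : ℝ) ^ J) ^ (-x) = 2 ^ x * ((2 : ℝ) ^ (J + 1)) ^ (-x) := by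
        rw [pow_succ, Real.mul_rpow (by positivity) (by norm_num), mul_left_comm,
          ← Real.rpow_add (by norm_num), add_neg_cancel, Real.rpow_zero, mul_one]
    _ ≤ 2 ^ x * (tEps ε ^ (-2 / (1 + 2 * ν))) ^ (-x) := by
        gcongr 2 ^ x * ?_
        exact Real.rpow_le_rpow_of_nonpos (by positivity) hJ (by linarith)
    _ ≤ 2 ^ x * tEps ε ^ ρ := by
        gcongr 2 ^ x * ?_
        rw [← Real.rpow_mul ht.le]
        refine Real.rpow_le_rpow_of_exponent_ge ht ht1.le ?_
        rw [div_mul_eq_mul_div, le_div_iff₀ (by linarith)]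
        linarith

theorem sum_Icc_neg_one_natCast {A : Type*} [AddCommMonoid A] (F : ℤ → A) (J : ℕ) :
    ∑ j ∈ Finset.Icc (-1 : ℤ) J, F j = F (-1) + F 0 + ∑ n ∈ Finset.Icc 1 J, F n := by
  induction J with
  | zero =>
    have : Finset.Icc (-1 : ℤ) ((0 : ℕ) : ℤ) = {-1, 0} := by decide
    rw [this, Finset.sum_pair (by decide)]
    simp
  | succ J ih =>
    have : Finset.Icc (-1 : ℤ) ((J + 1 : ℕ) : ℤ) =
        insert ((J + 1 : ℕ) : ℤ) (Finset.Icc (-1 : ℤ) J) := by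
      ext i; simp only [Finset.mem_Icc, Finset.mem_insert]; omega
    rw [this, Finset.sum_insert (by simp), ih, Finset.sum_Icc_succ_top (by omega), add_comm,
      add_assoc]

namespace NeedletSystem

variable {γ : Measure ℝ} {N : NeedletSystem γ}

theorem ψNormPow_zero {p : ℝ} (hp : 0 < p) (η : ℝ) : N.ψNormPow p 0 η = 0 := by
  have : N.ψ 0 η = 0 := funext fun x => N.ψ_zero η x
  simp [ψNormPow, this, hp]

theorem ψNormPow_neg_one [IsProbabilityMeasure γ] {p : ℝ} (hp : 0 < p) (η : ℝ) :
    N.ψNormPow p (-1) η = 1 := by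
  have : N.ψ (-1) η = fun _ => (1 : ℝ) := funext fun x => by simp [ψ]
  rw [ψNormPow, this, eLpNorm_const _ (by simpa using hp) (NeZero.ne γ)]
  simp

set_option maxHeartbeats 1000000 in
/-- The total over the levels `-1 ≤ j ≤ J` of the truncated coefficients and of the Gaussian
tails. -/
theorem sum_levels_le [IsProbabilityMeasure γ]
    {S S' : ℕ → Finset ℝ} {k k' : ℕ → ℝ → ℕ} {τ τ' : ℝ}
    (h : N.HalfBound τ S k) (h' : N.HalfBound τ' S' k')
    (hSS' : ∀ n, ∀ F : ℝ → ℝ≥0∞, ∑ η ∈ S n, F η + ∑ η ∈ S' n, F η = ∑ η ∈ N.Z n, F η)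
    {p π s ν κ e M a ρ A : ℝ} {b : ℕ → ℝ} {r : ℝ≥0∞} (hτ : -(1 / 2) < τ) (hτ' : -(1 / 2) < τ')
    (hp : 1 < p) (hν : 0 ≤ ν) (hπ : 1 ≤ π) (hr : 0 < r) (hM : 0 ≤ M) (hκ0 : 0 < κ)
    (hs : smoothnessThreshold p π τ < s) (hs' : smoothnessThreshold p π τ' < s)
    (he : excess p τ ≤ e) (he' : excess p τ' ≤ e) (hκ : 16 * p * (1 + 4 * e) ≤ κ ^ 2)
    (ha : levelPower p π ν s τ ≤ a) (ha' : levelPower p π ν s τ' ≤ a)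
    (hρ : 0 < ρ) (hρ1 : ρ ≤ rate₀ ν s) (hρ2 : ρ ≤ rate₁ p π ν s τ)
    (hρ3 : ρ ≤ rate₁ p π ν s τ') (hA : 0 < A)
    (hσ : ∀ n : ℕ, 1 ≤ n → N.σ b n ≤ A * ((2 : ℝ) ^ n) ^ ν) :
    ∃ C : ℝ, 0 < C ∧ ∀ f ∈ N.besovBall s π r M, ∀ (ε : ℝ) (J : ℕ), 0 < ε → ε ≤ 1 / 2 →
      (2 : ℝ) ^ J ≤ tEps ε ^ (-2 / (1 + 2 * ν)) →
      ∑ j ∈ Finset.Icc (-1 : ℤ) J, ∑ η ∈ N.Z j,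
          (ENNReal.ofReal (min |N.coeff f j η|
              (2 * (ε * N.σ b j * (κ * Real.sqrt (Real.log (1 / ε)) / 2))) ^ p) +
            ENNReal.ofReal ((ε * N.σ b j) ^ p * Real.exp (-(1 - (1 - rate₀ ν s) / 4) *
              (κ * Real.sqrt (Real.log (1 / ε)) / 2) ^ 2 / 2))) * N.ψNormPow p j η ≤
        ENNReal.ofReal (C * (Real.log (1 / ε) ^ a * tEps ε ^ (p * ρ))) := by
  have hp0 : 0 < p := by linarith
  have hν' : -(1 / 2) < ν := by linarith
  obtain ⟨hR0, hR1, -⟩ := rate_bounds hν' hs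
  have ha0 : 0 ≤ a := (levelPower_nonneg _ _ _ _ _).trans ha
  have hl2 : 0 < Real.log 2 := Real.log_pos (by norm_num)
  have hsl2 := sqrt_log_two_pos
  have hκA : (1 : ℝ) ≤ max (κ * A) 1 := le_max_right _ _
  obtain ⟨C₁, hC₁, H₁⟩ := h.sum_min_threshold_le hτ hν' hp hπ hs hr hM hκA
  obtain ⟨C₂, hC₂, H₂⟩ := h'.sum_min_threshold_le hτ' hν' hp hπ hs' hr hM hκA
  obtain ⟨C₃, hC₃, H₃⟩ := h.sum_tail_le hp hν he hκ hR0 hR1 hA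
  obtain ⟨C₄, hC₄, H₄⟩ := h'.sum_tail_le hp hν he' hκ hR0 hR1 hA
  obtain ⟨E, hE, HE⟩ := level_add_two_le hν'
  set B := N.σ b (-1) with hB
  have hB0 : 0 ≤ B := Real.sqrt_nonneg _
  -- `log(1/ε)` may be smaller than `1`; `c₀` makes `c₀ log(1/ε)^a ≥ 1`, so terms without a
  -- logarithm fit the bound.
  set c₀ := Real.log 2 ^ (0 - a) with hc₀
  set c₁ := (Real.sqrt (Real.log 2))⁻¹ with hc₁
  have hmin : ∀ {C τ : ℝ} (ε : ℝ) (J : ℕ), 0 < C → levelPower p π ν s τ ≤ a →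
      ρ ≤ rate₁ p π ν s τ → 0 < ε → ε ≤ 1 / 2 →
      (2 : ℝ) ^ J ≤ tEps ε ^ (-2 / (1 + 2 * ν)) →
      C * ((J : ℝ) + 2) ^ levelPower p π ν s τ *
          tEps ε ^ (p * min (rate₀ ν s) (rate₁ p π ν s τ)) ≤
        C * E ^ levelPower p π ν s τ * Real.log 2 ^ (levelPower p π ν s τ - a) *
          (Real.log (1 / ε) ^ a * tEps ε ^ (p * ρ)) := by
    intro C τ ε J hC hτa hτρ h0 h1 hJ
    have hL := log_inv_pos h0 h1
    have ht := tEps_pos h0 h1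
    have hlp := levelPower_nonneg p π ν s τ
    calc _ ≤ C * (E * Real.log (1 / ε)) ^ levelPower p π ν s τ * tEps ε ^ (p * ρ) := by
          gcongr ?_ * ?_
          · gcongr
            exact HE ε J h0 h1 hJ
          · refine Real.rpow_le_rpow_of_exponent_ge ht (tEps_lt_one h0 h1).le ?_
            gcongr
            exact le_min hρ1 hτρ
      _ = C * E ^ levelPower p π ν s τ * Real.log (1 / ε) ^ levelPower p π ν s τ *
          tEps ε ^ (p * ρ) := by rw [Real.mul_rpow hE.le hL.le]; ring
      _ ≤ C * E ^ levelPower p π ν s τ *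
          (Real.log 2 ^ (levelPower p π ν s τ - a) * Real.log (1 / ε) ^ a) *
          tEps ε ^ (p * ρ) := by
          gcongr
          exact log_inv_rpow_le hτa h0 h1
      _ = _ := by ring
  have hone : ∀ {ε : ℝ}, 0 < ε → ε ≤ 1 / 2 → 1 ≤ c₀ * Real.log (1 / ε) ^ a := by
    intro ε h0 h1
    have := log_inv_rpow_le ha0 h0 h1
    rwa [Real.rpow_zero] at this
  have htail : ∀ {C ε : ℝ}, 0 < C → 0 < ε → ε ≤ 1 / 2 → C * ε ^ (p * rate₀ ν s) ≤
      C * c₁ ^ (p * rate₀ ν s) * c₀ * (Real.log (1 / ε) ^ a * tEps ε ^ (p * ρ)) := by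
    intro C ε hC h0 h1
    have ht := tEps_pos h0 h1
    have hL := log_inv_pos h0 h1
    calc C * ε ^ (p * rate₀ ν s) ≤
          C * (c₁ ^ (p * rate₀ ν s) * tEps ε ^ (p * rate₀ ν s)) := by
          gcongr
          exact rpow_le_tEps_rpow (by positivity) h0 h1
      _ ≤ C * (c₁ ^ (p * rate₀ ν s) * tEps ε ^ (p * ρ)) := by
          gcongr C * (_ * ?_)
          exact Real.rpow_le_rpow_of_exponent_ge ht (tEps_lt_one h0 h1).le (by gcongr)
      _ = C * (c₁ ^ (p * rate₀ ν s) * tEps ε ^ (p * ρ)) * 1 := by ring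
      _ ≤ C * (c₁ ^ (p * rate₀ ν s) * tEps ε ^ (p * ρ)) * (c₀ * Real.log (1 / ε) ^ a) := by
          gcongr
          exact hone h0 h1
      _ = _ := by ring
  set K₁ := C₁ * E ^ levelPower p π ν s τ * Real.log 2 ^ (levelPower p π ν s τ - a) with hK₁
  set K₂ := C₂ * E ^ levelPower p π ν s τ' * Real.log 2 ^ (levelPower p π ν s τ' - a) with hK₂
  set K₃ := C₃ * c₁ ^ (p * rate₀ ν s) * c₀ with hK₃
  set K₄ := C₄ * c₁ ^ (p * rate₀ ν s) * c₀ with hK₄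
  set K₅ := ((κ * B) ^ p + (c₁ * B) ^ p) * c₀ with hK₅
  have hK₁0 : 0 < K₁ := by positivity
  have hK₂0 : 0 < K₂ := by positivity
  have hK₃0 : 0 < K₃ := by positivity
  have hK₄0 : 0 < K₄ := by positivity
  have hK₅0 : 0 ≤ K₅ := by positivity
  refine ⟨K₁ + K₂ + K₃ + K₄ + K₅, by positivity, fun f hf ε J h0 h1 hJ => ?_⟩
  have ht := tEps_pos h0 h1
  have ht1 := tEps_lt_one h0 h1
  have hL := log_inv_pos h0 h1
  set Φ := Real.log (1 / ε) ^ a * tEps ε ^ (p * ρ) with hΦ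
  have hΦ0 : 0 < Φ := by positivity
  -- The tail level `l = κ √(log(1/ε)) / 2` is half the threshold in units of `ε σ_j`.
  have hT : ∀ j, 2 * (ε * N.σ b j * (κ * Real.sqrt (Real.log (1 / ε)) / 2)) =
      κ * N.σ b j * tEps ε := fun j => by rw [tEps]; ring
  simp only [hT]
  set Q := Real.exp (-(1 - (1 - rate₀ ν s) / 4) *
    (κ * Real.sqrt (Real.log (1 / ε)) / 2) ^ 2 / 2) with hQ
  have hTn : ∀ n : ℕ, 1 ≤ n → 0 ≤ κ * N.σ b n * tEps ε ∧ κ * N.σ b n * tEps ε ≤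
      max (κ * A) 1 * (tEps ε * ((2 : ℝ) ^ n) ^ ν) := by
    intro n hn
    have hσ0 : 0 ≤ N.σ b n := Real.sqrt_nonneg _
    refine ⟨by positivity, ?_⟩
    calc κ * N.σ b n * tEps ε ≤ κ * (A * ((2 : ℝ) ^ n) ^ ν) * tEps ε := by
          gcongr; exact hσ n hn
      _ = (κ * A) * (tEps ε * ((2 : ℝ) ^ n) ^ ν) := by ring
      _ ≤ _ := by gcongr; exact le_max_left _ _
  have hvn : ∀ n : ℕ, 1 ≤ n → 0 ≤ N.σ b n ∧ N.σ b n ≤ A * ((2 : ℝ) ^ n) ^ ν :=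
    fun n hn => ⟨Real.sqrt_nonneg _, hσ n hn⟩
  have hpos : ∑ n ∈ Finset.Icc 1 J, ∑ η ∈ N.Z n,
      (ENNReal.ofReal (min |N.coeff f n η| (κ * N.σ b n * tEps ε) ^ p) +
        ENNReal.ofReal ((ε * N.σ b n) ^ p * Q)) * N.ψNormPow p n η ≤
      ENNReal.ofReal (K₁ * Φ) + ENNReal.ofReal (K₃ * Φ) +
        (ENNReal.ofReal (K₂ * Φ) + ENNReal.ofReal (K₄ * Φ)) := by
    simp only [← hSS', add_mul, Finset.sum_add_distrib]
    refine add_le_add (add_le_add ?_ ?_) (add_le_add ?_ ?_)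
    · exact (H₁ f hf _ J (fun n => κ * N.σ b n * tEps ε) ht ht1 hTn).trans
        (ENNReal.ofReal_le_ofReal (hmin ε J hC₁ ha hρ2 h0 h1 hJ))
    · exact (H₃ ε J (fun n => N.σ b n) h0 h1 hJ hvn).trans (ENNReal.ofReal_le_ofReal (htail hC₃ h0 h1))
    · exact (H₂ f hf _ J (fun n => κ * N.σ b n * tEps ε) ht ht1 hTn).trans
        (ENNReal.ofReal_le_ofReal (hmin ε J hC₂ ha' hρ3 h0 h1 hJ))
    · exact (H₄ ε J (fun n => N.σ b n) h0 h1 hJ hvn).trans (ENNReal.ofReal_le_ofReal (htail hC₄ h0 h1))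
  have hzero : ∑ η ∈ N.Z 0,
      (ENNReal.ofReal (min |N.coeff f 0 η| (κ * N.σ b 0 * tEps ε) ^ p) +
        ENNReal.ofReal ((ε * N.σ b 0) ^ p * Q)) * N.ψNormPow p 0 η = 0 :=
    Finset.sum_eq_zero fun η _ => by rw [ψNormPow_zero hp0, mul_zero]
  -- Level `-1` is outside the two-sided bounds, but it is one needlet of norm `1`. Both of its
  -- terms are `O(t_ε^p)`, and `ρ ≤ rate₀ < 1`.
  have hneg : ∑ η ∈ N.Z (-1),
      (ENNReal.ofReal (min |N.coeff f (-1) η| (κ * B * tEps ε) ^ p) +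
        ENNReal.ofReal ((ε * B) ^ p * Q)) * N.ψNormPow p (-1) η ≤
      ENNReal.ofReal (K₅ * Φ) := by
    obtain ⟨z, hz⟩ := Finset.card_eq_one.1 N.card_Z_neg_one
    have hQ1 : Q ≤ 1 := by
      refine Real.exp_le_one_iff.2 ?_
      have : 0 ≤ (1 - (1 - rate₀ ν s) / 4) * (κ * Real.sqrt (Real.log (1 / ε)) / 2) ^ 2 :=
        mul_nonneg (by linarith) (sq_nonneg _)
      linarith
    rw [hz, Finset.sum_singleton, ψNormPow_neg_one hp0, mul_one,
      ← ENNReal.ofReal_add (by positivity) (by positivity)]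
    refine ENNReal.ofReal_le_ofReal ?_
    have hε : ε * B ≤ c₁ * B * tEps ε := by
      have := rpow_le_tEps_rpow zero_le_one h0 h1
      simp only [Real.rpow_one] at this
      nlinarith
    have hpow : tEps ε ^ p ≤ tEps ε ^ (p * ρ) :=
      Real.rpow_le_rpow_of_exponent_ge ht ht1.le (by nlinarith)
    calc _ ≤ (κ * B * tEps ε) ^ p + (c₁ * B * tEps ε) ^ p * 1 := by
          gcongr
          exact min_le_right _ _
      _ = ((κ * B) ^ p + (c₁ * B) ^ p) * tEps ε ^ p * 1 := by
          rw [Real.mul_rpow (by positivity) ht.le, Real.mul_rpow (by positivity) ht.le]; ring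
      _ ≤ ((κ * B) ^ p + (c₁ * B) ^ p) * tEps ε ^ (p * ρ) * (c₀ * Real.log (1 / ε) ^ a) := by
          gcongr
          exact hone h0 h1
      _ = _ := by rw [hK₅, hΦ]; ring
  rw [sum_Icc_neg_one_natCast, hzero, add_zero]
  refine (add_le_add hneg hpos).trans_eq ?_
  rw [← ENNReal.ofReal_add (by positivity) (by positivity),
    ← ENNReal.ofReal_add (by positivity) (by positivity),
    ← ENNReal.ofReal_add (by positivity) (by positivity),
    ← ENNReal.ofReal_add (by positivity) (by positivity)]
  congr 1; ring

end NeedletSystem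
namespace NeedletSystem

variable {γ : Measure ℝ} {N : NeedletSystem γ}

/-! ### The risk -/

theorem HalfBound.exists_ψNormPow_two_le {τ : ℝ} {S : ℕ → Finset ℝ} {k : ℕ → ℝ → ℕ}
    (h : N.HalfBound τ S k) :
    ∃ C : ℝ, 0 < C ∧ ∀ n : ℕ, 1 ≤ n → ∀ η ∈ S n, N.ψNormPow 2 n η ≤ ENNReal.ofReal C := by
  obtain ⟨c, C, -, hC, H⟩ := h.bounds 2 (by norm_num)
  refine ⟨C, hC, fun n hn η hη => ?_⟩
  simpa using (H n hn η hη).2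

theorem exists_σ_le [IsProbabilityMeasure γ] (hγ : ∀ᵐ x ∂γ, x ∈ Set.Icc (-1 : ℝ) 1)
    {S S' : ℕ → Finset ℝ} {k k' : ℕ → ℝ → ℕ} {τ τ' : ℝ}
    (h : N.HalfBound τ S k) (h' : N.HalfBound τ' S' k') (hSS' : ∀ n : ℕ, N.Z n = S n ∪ S' n)
    {b : ℕ → ℝ} {ν c : ℝ} (hν : 0 ≤ ν) (hc : 0 < c)
    (hb : ∀ i : ℕ, 1 ≤ i → c * (i : ℝ) ^ (-ν) ≤ b i) :
    ∃ A : ℝ, 0 < A ∧ ∀ n : ℕ, 1 ≤ n → N.σ b n ≤ A * ((2 : ℝ) ^ n) ^ ν := by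
  obtain ⟨C, hC, H⟩ := h.exists_ψNormPow_two_le
  obtain ⟨C', hC', H'⟩ := h'.exists_ψNormPow_two_le
  refine ⟨Real.sqrt (max C C') / c, by positivity, fun n hn => ?_⟩
  refine N.σ_le hγ hν hc (by positivity) hb fun η hη => ?_
  rcases Finset.mem_union.1 (hSS' n ▸ hη) with hη | hη
  · exact (H n hn η hη).trans (ENNReal.ofReal_le_ofReal (le_max_left _ _))
  · exact (H' n hn η hη).trans (ENNReal.ofReal_le_ofReal (le_max_right _ _))

/-- Splitting the loss into the contributions of the levels and the bias. -/
theorem eLpNorm_estimator_sub_rpow_le [IsProbabilityMeasure γ]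
    (hγ : ∀ᵐ x ∂γ, x ∈ Set.Icc (-1 : ℝ) 1) {p : ℝ} (hp : 1 ≤ p) (f : Lp ℝ 2 γ)
    (b Y : ℕ → ℝ) {κ ν ε : ℝ} {J : ℕ} (hJ : maxLevel ν ε = J) :
    eLpNorm (fun x => N.estimator b κ ν ε Y x - f x) (ENNReal.ofReal p) γ ^ p ≤
      2 ^ (p - 1) * (((J + 2 : ℕ) : ℝ≥0∞) ^ (p - 1) * ∑ j ∈ Finset.Icc (-1 : ℤ) J,
        eLpNorm (fun x => ∑ η ∈ N.Z j, (hardThreshold (κ * tEps ε * N.σ b j)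
          (N.empCoeff b Y j η) - N.coeff f j η) * N.ψ j η x) (ENNReal.ofReal p) γ ^ p +
        eLpNorm (fun x => N.partialSum f J x - f x) (ENNReal.ofReal p) γ ^ p) := by
  have hp1 : 1 ≤ ENNReal.ofReal p := ENNReal.one_le_ofReal.2 hp
  have hp0 : 0 ≤ p := by linarith
  set F : ℤ → ℝ → ℝ := fun j x => ∑ η ∈ N.Z j, (hardThreshold (κ * tEps ε * N.σ b j)
    (N.empCoeff b Y j η) - N.coeff f j η) * N.ψ j η x with hF
  have hFm : ∀ j ∈ Finset.Icc (-1 : ℤ) J, AEStronglyMeasurable (F j) γ := fun j hj =>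
    aestronglyMeasurable_level hγ (Finset.mem_Icc.1 hj).1 fun η =>
      hardThreshold (κ * tEps ε * N.σ b j) (N.empCoeff b Y j η) - N.coeff f j η
  have e : (fun x => N.estimator b κ ν ε Y x - f x) =
      (∑ j ∈ Finset.Icc (-1 : ℤ) J, F j) + fun x => N.partialSum f J x - f x := by
    ext x
    simp only [Pi.add_apply, Finset.sum_apply, hF, sub_mul, Finset.sum_sub_distrib]
    rw [estimator, partialSum, hJ]
    ring
  rw [e]
  calc _ ≤ (eLpNorm (∑ j ∈ Finset.Icc (-1 : ℤ) J, F j) (ENNReal.ofReal p) γ +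
          eLpNorm (fun x => N.partialSum f J x - f x) (ENNReal.ofReal p) γ) ^ p := by
        gcongr
        exact eLpNorm_add_le (Finset.aestronglyMeasurable_sum _ hFm)
          ((aestronglyMeasurable_partialSum hγ f J).sub (Lp.aestronglyMeasurable f)) hp1
    _ ≤ _ := ENNReal.rpow_add_le_mul_rpow_add_rpow _ _ hp
    _ ≤ _ := by
        refine mul_le_mul' le_rfl (add_le_add ?_ le_rfl)
        calc _ ≤ (∑ j ∈ Finset.Icc (-1 : ℤ) J, eLpNorm (F j) (ENNReal.ofReal p) γ) ^ p := by
              gcongr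
              exact eLpNorm_sum_le hFm hp1
          -- Convexity over the `J + 2` levels, the source of the factor `log^{p-1}`.
          _ ≤ _ := ENNReal.rpow_sum_le_const_mul_sum_rpow _ _ hp
          _ = _ := by
              have : (J : ℤ) + 1 - -1 = ((J + 2 : ℕ) : ℤ) := by push_cast; ring
              rw [Int.card_Icc, this, Int.toNat_natCast]

/-- The levels and the bias are assembled for two abstract halves with parameters `τ` and `τ'`. Any
`a` above both values of `levelPower` is allowed, so the fraction in `logPower₁` plays no part in
the estimate. -/
theorem lintegral_loss_le [IsProbabilityMeasure γ]
    (hγ : ∀ᵐ x ∂γ, x ∈ Set.Icc (-1 : ℝ) 1) (hsynth : N.SynthesisBound)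
    {S S' : ℕ → Finset ℝ} {k k' : ℕ → ℝ → ℕ} {τ τ' : ℝ}
    (h : N.HalfBound τ S k) (h' : N.HalfBound τ' S' k') (hdisj : ∀ n, Disjoint (S n) (S' n))
    (hunion : ∀ n : ℕ, N.Z n = S n ∪ S' n)
    {p π s ν κ M a : ℝ} {r : ℝ≥0∞} (hτ : -(1 / 2) < τ) (hτ' : -(1 / 2) < τ')
    (hp : 1 < p) (hπ : 1 ≤ π) (hr : 0 < r) (hM : 0 ≤ M) (hκ0 : 0 < κ)
    (hs : smoothnessThreshold p π τ < s) (hs' : smoothnessThreshold p π τ' < s)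
    (hκ : 16 * p * (1 + 4 * max (excess p τ) (excess p τ')) ≤ κ ^ 2)
    (ha : levelPower p π ν s τ ≤ a) (ha' : levelPower p π ν s τ' ≤ a)
    {G : Type*} [NormedAddCommGroup G] [InnerProductSpace ℝ G] [CompleteSpace G]
    {K : Lp ℝ 2 γ →L[ℝ] G} {g : ℕ → G} {b : ℕ → ℝ}
    (hK : IsSVD K N.basis g b) (hb : IsRegular b ν) :
    ∃ C : ℝ, 0 < C ∧ ∀ (Ω : Type*) [MeasurableSpace Ω] (P : Measure Ω) [IsProbabilityMeasure P]
      (W : G → Ω → ℝ), IsWhiteNoise W P → ∀ ε : ℝ, 0 < ε → ε ≤ 1 / 2 →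
      ∀ f ∈ N.besovBall s π r M,
        ∫⁻ ω, eLpNorm (fun x => N.estimator b κ ν ε (observation K g W ε f ω) x - f x)
            (ENNReal.ofReal p) γ ^ p ∂P ≤
          ENNReal.ofReal (C * Real.log (1 / ε) ^ (p - 1 + a) *
            tEps ε ^ (p * rate p π ν s τ τ')) := by
  have hp0 : 0 < p := by linarith
  have hν : 0 ≤ ν := hK.nonneg_of_isRegular hb
  have hν' : -(1 / 2) < ν := by linarith
  obtain ⟨hb0, c, _, hc, -, hbc⟩ := hb
  have hbne : ∀ i, b i ≠ 0 := by
    intro i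
    rcases Nat.eq_zero_or_pos i with rfl | hi
    · exact hb0
    · have hi' : (0 : ℝ) < i := by exact_mod_cast hi
      exact ((mul_pos hc (Real.rpow_pos_of_pos hi' _)).trans_le (hbc i hi).1).ne'
  have hsum : ∀ n, ∀ F : ℝ → ℝ≥0∞, ∑ η ∈ S n, F η + ∑ η ∈ S' n, F η = ∑ η ∈ N.Z n, F η := by
    intro n F
    rw [hunion, Finset.sum_union (hdisj n)]
  obtain ⟨hR0, hR1, hR2, hR3, hR4⟩ := rate_bounds hν' hs
  obtain ⟨-, -, hR2', hR3', hR4'⟩ := rate_bounds hν' hs'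
  set ρ := rate p π ν s τ τ' with hρ
  have hρ0 : 0 < ρ := lt_min hR0 (lt_min hR2 hR2')
  have hρ1 : ρ ≤ rate₀ ν s := min_le_left _ _
  have hρ2 : ρ ≤ rate₁ p π ν s τ := (min_le_right _ _).trans (min_le_left _ _)
  have hρ3 : ρ ≤ rate₁ p π ν s τ' := (min_le_right _ _).trans (min_le_right _ _)
  set y := min (biasExponent p π s τ) (biasExponent p π s τ') with hy
  have hy0 : 0 < y := lt_min hR4 hR4'
  have hρy : ρ * (ν + 1 / 2) ≤ y := by
    refine le_min ?_ ?_
    · exact (mul_le_mul_of_nonneg_right (le_min hρ1 hρ2) (by linarith)).trans hR3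
    · exact (mul_le_mul_of_nonneg_right (le_min hρ1 hρ3) (by linarith)).trans hR3'
  have ha0 : 0 ≤ a := (levelPower_nonneg _ _ _ _ _).trans ha
  obtain ⟨A, hA, hσ⟩ := exists_σ_le hγ h h' hunion hν hc fun i hi => (hbc i hi).1
  obtain ⟨C₁, hC₁, H₁⟩ := exists_level_majorant hγ hsynth hK hbne hp.le
    (δ := (1 - rate₀ ν s) / 4) (by linarith) (by linarith)
  obtain ⟨C₂, hC₂, H₂⟩ := sum_levels_le h h' hsum (e := max (excess p τ) (excess p τ'))
    hτ hτ' hp hν hπ hr hM hκ0 hs hs' (le_max_left _ _) (le_max_right _ _) hκ ha ha' hρ0 hρ1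
    hρ2 hρ3 hA hσ
  obtain ⟨C₃, hC₃, H₃⟩ := eLpNorm_level_le hsynth h h' hsum (s := s) hτ hτ' hp hπ hr hM
    (min_le_left _ _ : y ≤ _) (min_le_right _ _)
  obtain ⟨E, hE, HE⟩ := level_add_two_le hν'
  have hl2 : 0 < Real.log 2 := Real.log_pos (by norm_num)
  have h2y : (0 : ℝ) < 2 ^ y - 1 := by
    have := Real.one_lt_rpow (x := 2) (by norm_num) hy0
    linarith
  set D := (C₃ / (2 ^ y - 1) * 2 ^ y) ^ p * Real.log 2 ^ (0 - (p - 1 + a)) with hD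
  have hD0 : 0 < D := by positivity
  refine ⟨2 ^ (p - 1) * (E ^ (p - 1) * (C₁ * C₂) + D), by positivity,
    fun Ω _ P _ W hW ε h0 h1 f hf => ?_⟩
  have ht := tEps_pos h0 h1
  have hL := log_inv_pos h0 h1
  set L := Real.log (1 / ε) with hLdef
  obtain ⟨J, hJ, hJ1, hJ2⟩ := exists_maxLevel_eq hν' h0 h1
  set l := κ * Real.sqrt L / 2 with hl
  have hl0 : 0 ≤ l := by positivity
  have hT : ∀ j, κ * tEps ε * N.σ b j = 2 * (ε * N.σ b j * l) := fun j => by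
    rw [tEps]; ring
  choose! U hUm hUle hUint using fun j (hj : -1 ≤ j) => H₁ Ω P W hW ε l h0.le hl0 f j hj
  have hbias : eLpNorm (fun x => N.partialSum f J x - f x) (ENNReal.ofReal p) γ ^ p ≤
      ENNReal.ofReal (D * L ^ (p - 1 + a) * tEps ε ^ (p * ρ)) := by
    calc _ ≤ ENNReal.ofReal (C₃ / (2 ^ y - 1) * ((2 : ℝ) ^ J) ^ (-y)) ^ p := by
          gcongr
          exact eLpNorm_partialSum_sub_le hγ (ENNReal.one_le_ofReal.2 hp.le) hC₃.le hy0
            (H₃ f hf) J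
      _ ≤ ENNReal.ofReal (C₃ / (2 ^ y - 1) * (2 ^ y * tEps ε ^ ρ)) ^ p := by
          gcongr
          exact two_pow_rpow_neg_le hν hy0.le hρy h0 h1 hJ2
      _ = ENNReal.ofReal ((C₃ / (2 ^ y - 1) * 2 ^ y) ^ p * tEps ε ^ (p * ρ) * L ^ (0 : ℝ)) := by
          rw [ENNReal.ofReal_rpow_of_nonneg (by positivity) hp0.le, ← mul_assoc,
            Real.mul_rpow (by positivity) (by positivity), ← Real.rpow_mul ht.le, mul_comm ρ,
            Real.rpow_zero, mul_one]
      _ ≤ ENNReal.ofReal ((C₃ / (2 ^ y - 1) * 2 ^ y) ^ p * tEps ε ^ (p * ρ) *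
            (Real.log 2 ^ (0 - (p - 1 + a)) * L ^ (p - 1 + a))) := by
          refine ENNReal.ofReal_le_ofReal (mul_le_mul_of_nonneg_left ?_ (by positivity))
          exact log_inv_rpow_le (by linarith) h0 h1
      _ = _ := by congr 1; rw [hD]; ring
  have hlev : ∑ j ∈ Finset.Icc (-1 : ℤ) J, ∫⁻ ω, U j ω ∂P ≤
      ENNReal.ofReal (C₁ * (C₂ * (L ^ a * tEps ε ^ (p * ρ)))) := by
    calc _ ≤ _ := Finset.sum_le_sum fun j hj => hUint j (Finset.mem_Icc.1 hj).1
      _ = _ := (Finset.mul_sum _ _ _).symm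
      _ ≤ _ := mul_le_mul' le_rfl (H₂ f hf ε J h0 h1 hJ1)
      _ = _ := (ENNReal.ofReal_mul hC₁.le).symm
  have hJE : ((J + 2 : ℕ) : ℝ≥0∞) ^ (p - 1) ≤ ENNReal.ofReal ((E * L) ^ (p - 1)) := by
    rw [← ENNReal.ofReal_natCast, ENNReal.ofReal_rpow_of_nonneg (by positivity) (by linarith)]
    refine ENNReal.ofReal_le_ofReal (Real.rpow_le_rpow (by positivity) ?_ (by linarith))
    push_cast
    exact HE ε J h0 h1 hJ1
  have h2p : (2 : ℝ≥0∞) ^ (p - 1) = ENNReal.ofReal (2 ^ (p - 1)) := by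
    rw [← ENNReal.ofReal_rpow_of_pos (by norm_num), ENNReal.ofReal_ofNat]
  calc _ ≤ ∫⁻ ω, 2 ^ (p - 1) * (((J + 2 : ℕ) : ℝ≥0∞) ^ (p - 1) *
          ∑ j ∈ Finset.Icc (-1 : ℤ) J, U j ω +
          ENNReal.ofReal (D * L ^ (p - 1 + a) * tEps ε ^ (p * ρ))) ∂P := by
        refine lintegral_mono fun ω => (eLpNorm_estimator_sub_rpow_le hγ hp.le f b _ hJ).trans ?_
        refine mul_le_mul' le_rfl (add_le_add (mul_le_mul' le_rfl
          (Finset.sum_le_sum fun j hj => ?_)) hbias)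
        rw [hT]
        exact hUle j (Finset.mem_Icc.1 hj).1 ω
    _ = 2 ^ (p - 1) * (((J + 2 : ℕ) : ℝ≥0∞) ^ (p - 1) *
          ∑ j ∈ Finset.Icc (-1 : ℤ) J, ∫⁻ ω, U j ω ∂P +
          ENNReal.ofReal (D * L ^ (p - 1 + a) * tEps ε ^ (p * ρ))) := by
        rw [lintegral_const_mul' _ _ (by rw [h2p]; exact ENNReal.ofReal_ne_top),
          lintegral_add_right _ measurable_const, lintegral_const, measure_univ, mul_one,
          lintegral_const_mul' _ _ (hJE.trans_lt ENNReal.ofReal_lt_top).ne,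
          lintegral_finsetSum' _ fun j hj => hUm j (Finset.mem_Icc.1 hj).1]
    _ ≤ ENNReal.ofReal (2 ^ (p - 1)) * (ENNReal.ofReal ((E * L) ^ (p - 1)) *
          ENNReal.ofReal (C₁ * (C₂ * (L ^ a * tEps ε ^ (p * ρ)))) +
          ENNReal.ofReal (D * L ^ (p - 1 + a) * tEps ε ^ (p * ρ))) := by
        rw [h2p]
        exact mul_le_mul' le_rfl (add_le_add (mul_le_mul' hJE hlev) le_rfl)
    _ = _ := by
        rw [← ENNReal.ofReal_mul (by positivity), ← ENNReal.ofReal_add (by positivity)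
          (by positivity), ← ENNReal.ofReal_mul (by positivity)]
        congr 1
        rw [Real.mul_rpow hE.le hL.le, Real.rpow_add hL]
        ring

end NeedletSystem
end Needlet

end

/-! ### The risk bound over the Besov ball -/

theorem theorem3
    (p α β π s ν κ M : ℝ) (r : ℝ≥0∞)
    (hp : 1 < p) (hβ : -(1 / 2) < β) (hαβ : β ≤ α) (hν : -(1 / 2) < ν)
    (hπ : 1 ≤ π) (hr : 0 < r) (hM : 0 < M)
    -- the needlet system and its properties
    (N : Needlet.NeedletSystem (Needlet.jacobiMeasure α β))
    (hcard : N.CardBound) (hsum : N.SumNormBound α) (hsynth : N.SynthesisBound)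
    (hright : N.RightNormBounds α) (hleft : N.LeftNormBounds β)
    -- the operator, diagonalised by the basis that underlies the needlets
    {G : Type*} [NormedAddCommGroup G] [InnerProductSpace ℝ G] [CompleteSpace G]
    (K : Lp ℝ 2 (Needlet.jacobiMeasure α β) →L[ℝ] G) (g : ℕ → G) (b : ℕ → ℝ)
    (hK : Needlet.IsSVD K N.basis g b) (hb : Needlet.IsRegular b ν)
    -- the tuning constant and the smoothness
    (hκ : 0 < κ)
    (hκp : 16 * p * (1 + 4 * max (Needlet.excess p α) (Needlet.excess p β)) ≤ κ ^ 2)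
    (hs : max (Needlet.smoothnessThreshold p π α) (Needlet.smoothnessThreshold p π β) < s) :
    Needlet.logPower p π ν s α β ≤ 2 ∧
    ∃ C : ℝ, 0 < C ∧
      ∀ (Ω : Type*) [MeasurableSpace Ω] (P : Measure Ω) [IsProbabilityMeasure P]
        (W : G → Ω → ℝ), Needlet.IsWhiteNoise W P →
      ∀ ε : ℝ, 0 < ε → ε ≤ 1 / 2 →
      ∀ f ∈ N.besovBall s π r M,
        ∫⁻ ω, eLpNorm
            (fun x => N.estimator b κ ν ε (Needlet.observation K g W ε f ω) x - f x)
            (ENNReal.ofReal p) (Needlet.jacobiMeasure α β) ^ p ∂P ≤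
          ENNReal.ofReal
            (C * Real.log (1 / ε) ^ (p - 1 + Needlet.logPower p π ν s α β) *
              Needlet.tEps ε ^ (p * Needlet.rate p π ν s α β)) := by
  have hα : -(1 / 2) < α := by linarith
  have := Needlet.isProbabilityMeasure_jacobiMeasure N.ne_zero
  obtain ⟨h₁, h₂⟩ := Needlet.levelPower_le_and_le_two (p := p) (π := π) (ν := ν) (s := s) hα
  obtain ⟨h₃, h₄⟩ := Needlet.levelPower_le_and_le_two (p := p) (π := π) (ν := ν) (s := s) hβ
  exact ⟨max_le h₂ h₄, Needlet.NeedletSystem.lintegral_loss_le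
    (Needlet.ae_mem_Icc_jacobiMeasure α β) hsynth
    (Needlet.NeedletSystem.halfBound_right hcard hright)
    (Needlet.NeedletSystem.halfBound_left hcard hleft)
    (fun n => Finset.disjoint_filter_filter_not _ _ _)
    (fun n => (Finset.filter_union_filter_not_eq _ _).symm) hα hβ hp hπ hr hM.le hκ
    ((le_max_left _ _).trans_lt hs) ((le_max_right _ _).trans_lt hs) hκp
    (h₁.trans (le_max_left _ _)) (h₃.trans (le_max_right _ _)) hK hb⟩
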